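/- For an integer $d\ge 2$ let $M^d$ be the $d$-th member of Kühnel's series of triangulated sphere bundles over the circle, i.e. the simplicial complex with vertex set $\mathbb{Z}/(2d+3)\mathbb{Z}$ whose facets are the sets $$\{i,\,i+1,\,\dots,\,i+d+1\}\setminus\{i+j\},\qquad i\in\mathbb{Z}/(2d+3)\mathbb{Z},\quad 1\le j\le d .$$ A stacked $m$-sphere is a complex obtained from the boundary complex of an $(m+1)$-simplex by finitely many (possibly zero) stellar subdivisions of facets. A PL $m$-sphere is a complex whose underlying polyhedron is PL homeomorphic to the boundary of an $(m+1)$-simplex, and a combinatorial $d$-manifold is a finite simplicial complex all of whose vertex links are PL $(d-1)$-spheres. Walkup's class $\mathcal{K}(d)$ consists of the combinatorial $d$-manifolds all of whose vertex links are stacked $(d-1)$-spheres. A complex is $2$-neighborly if any two of its vertices are joined by an edge. A combinatorial manifold $K$ with $n$ vertices is tight if, for its canonical embedding $|K|\subset\Delta^{n-1}\subset E^{n-1}$ (the vertices of $K$ being the vertices of the simplex $\Delta^{n-1}$), the homomorphism $$H_i(|K|\cap h;\mathbb{F}_2)\longrightarrow H_i(|K|;\mathbb{F}_2)$$ induced by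 inclusion in singular homology is injective for every open or closed half-space $h\subset E^{n-1}$ and every $i\ge 0$. Then, for every $d\ge 2$, the complex $M^d$ has exactly $2d+3$ vertices, is $2$-neighborly, lies in $\mathcal{K}(d)$, and is tight. -/

import Mathlib

open CategoryTheory

/-! ### Simplicial complexes -/

section Complexes

variable {V : Type} [DecidableEq V]

/-- The set of vertices of a simplicial complex. -/
def complexVertices (K : PreAbstractSimplicialComplex V) : Set V :=
  {v | {v} ∈ K.faces}

/-- A facet is an inclusion-maximal face. -/
def IsFacet (K : PreAbstractSimplicialComplex V) (t : Finset V) : Prop :=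
  Maximal (fun s => s ∈ K.faces) t

/-- The link of `v` in `K`. -/
def complexLink (K : PreAbstractSimplicialComplex V) (v : V) : PreAbstractSimplicialComplex V where
  faces := {s | s.Nonempty ∧ v ∉ s ∧ insert v s ∈ K.faces}
  isRelLowerSet_faces := by
    rintro s ⟨hs, hv, hK⟩
    refine ⟨hs, fun t hts ht => ⟨ht, fun h => hv (hts h), ?_⟩⟩
    exact (K.isRelLowerSet_faces hK).2 (Finset.insert_subset_insert v hts)
      (Finset.insert_nonempty v t)

/-- The boundary complex of the simplex with vertex set `s`: all nonempty proper subsets of `s`. -/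
def simplexBoundary (s : Finset V) : PreAbstractSimplicialComplex V where
  faces := {t | t.Nonempty ∧ t ⊂ s}
  isRelLowerSet_faces := by
    rintro t ⟨ht, hts⟩
    exact ⟨ht, fun u hut hu => ⟨hu, lt_of_le_of_lt hut hts⟩⟩

/-- The stellar subdivision of the face `t` of `K` at the new vertex `x`, for a facet `t`:
the face `t` is replaced by the cone with apex `x` over the boundary of `t`. -/
def stackFacet (K : PreAbstractSimplicialComplex V) (t : Finset V) (x : V) :
    PreAbstractSimplicialComplex V where
  faces := {s | (s ∈ K.faces ∧ ¬ t ⊆ s) ∨ ∃ u, u ⊂ t ∧ s.Nonempty ∧ s ⊆ insert x u}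
  isRelLowerSet_faces := by
    rintro s (⟨hs, hts⟩ | ⟨u, hu, hs, hsu⟩)
    · refine ⟨(K.isRelLowerSet_faces hs).1, fun r hrs hr => Or.inl ⟨?_, fun h => hts (h.trans hrs)⟩⟩
      exact (K.isRelLowerSet_faces hs).2 hrs hr
    · exact ⟨hs, fun r hrs hr => Or.inr ⟨u, hu, hr, hrs.trans hsu⟩⟩

/-- Stacked `m`-spheres: the complexes obtained from the boundary of an `(m+1)`-simplex by
successive stellar subdivisions of facets. -/
inductive IsStackedSphere (m : ℕ) : PreAbstractSimplicialComplex V → Prop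
  | boundary (s : Finset V) (hs : s.card = m + 2) : IsStackedSphere m (simplexBoundary s)
  | stack (K : PreAbstractSimplicialComplex V) (t : Finset V) (x : V)
      (hK : IsStackedSphere m K) (ht : IsFacet K t) (hx : x ∉ complexVertices K) :
      IsStackedSphere m (stackFacet K t x)

/-- `K` is `k`-neighborly: any `k` (or fewer) of its vertices span a face. -/
def IsNeighborly (k : ℕ) (K : PreAbstractSimplicialComplex V) : Prop :=
  ∀ s : Finset V, s.Nonempty → (∀ v ∈ s, v ∈ complexVertices K) → s.card ≤ k → s ∈ K.faces

end Complexes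

/-! ### Polyhedra, piecewise linear spheres and combinatorial manifolds -/

section Polyhedra

/-- The underlying polyhedron `|K|` of `K` in its canonical embedding: the vertices of `K` are
vertices of the standard simplex, which spans an affine space of dimension `card V - 1`, and
`|K|` is the union of the faces of that simplex which correspond to faces of `K`. -/
def polyhedron {V : Type} [Fintype V] (K : PreAbstractSimplicialComplex V) : Set (V → ℝ) :=
  {x | x ∈ stdSimplex ℝ V ∧ ∃ s ∈ K.faces, ∀ v, v ∉ s → x v = 0}

/-- The sets `X` and `Y` are piecewise linearly homeomorphic: there is a homeomorphism `X → Y`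
and a covering of `X` by finitely many convex polytopes on each of which it is affine. -/
def IsPLHomeomorphic {E F : Type} [AddCommGroup E] [Module ℝ E] [TopologicalSpace E]
    [AddCommGroup F] [Module ℝ F] [TopologicalSpace F] (X : Set E) (Y : Set F) : Prop :=
  ∃ (e : X ≃ₜ Y) (S : Set (Finset E)), S.Finite ∧ (⋃ p ∈ S, convexHull ℝ (p : Set E)) = X ∧
    ∀ p ∈ S, ∃ g : E →ᵃ[ℝ] F, ∀ x : X, (x : E) ∈ convexHull ℝ (p : Set E) → g x = e x

variable {V : Type} [Fintype V] [DecidableEq V]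

/-- `K` is a PL `m`-sphere: it is PL homeomorphic to the boundary of an `(m+1)`-simplex. -/
def IsPLSphere (m : ℕ) (K : PreAbstractSimplicialComplex V) : Prop :=
  IsPLHomeomorphic (polyhedron K)
    (polyhedron (simplexBoundary (Finset.univ : Finset (Fin (m + 2)))))

/-- Combinatorial `d`-manifolds (`1 ≤ d`): all vertex links are PL `(d-1)`-spheres. -/
def IsCombinatorialManifold (d : ℕ) (K : PreAbstractSimplicialComplex V) : Prop :=
  ∀ v ∈ complexVertices K, IsPLSphere (d - 1) (complexLink K v)

/-- Walkup's class `𝒦(d)` (`1 ≤ d`): combinatorial `d`-manifolds all of whose vertex links are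
stacked `(d-1)`-spheres. -/
def InWalkupClass (d : ℕ) (K : PreAbstractSimplicialComplex V) : Prop :=
  IsCombinatorialManifold d K ∧ ∀ v ∈ complexVertices K, IsStackedSphere (d - 1) (complexLink K v)

end Polyhedra

/-! ### Tightness -/

section Tightness

/-- The homomorphism `H_i(A; 𝔽) → H_i(X; 𝔽)` in singular homology induced by `A ⊆ X`. -/
noncomputable def singularHomologyInclusion (𝔽 : Type) [Field 𝔽] (i : ℕ) {E : Type}
    [TopologicalSpace E] {A X : Set E} (h : A ⊆ X) :
    ((AlgebraicTopology.singularHomologyFunctor (ModuleCat.{0} 𝔽) i).obj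
        (ModuleCat.of 𝔽 𝔽)).obj (TopCat.of A) ⟶
      ((AlgebraicTopology.singularHomologyFunctor (ModuleCat.{0} 𝔽) i).obj
        (ModuleCat.of 𝔽 𝔽)).obj (TopCat.of X) :=
  ((AlgebraicTopology.singularHomologyFunctor (ModuleCat.{0} 𝔽) i).obj (ModuleCat.of 𝔽 𝔽)).map
    (TopCat.ofHom ⟨Set.inclusion h, continuous_inclusion h⟩)

/-- Open or closed half-spaces. -/
def IsHalfSpace {E : Type} [AddCommGroup E] [Module ℝ E] [TopologicalSpace E]
    (H : Set E) : Prop :=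
  ∃ (f : E →L[ℝ] ℝ) (c : ℝ), f ≠ 0 ∧ (H = {x | f x ≤ c} ∨ H = {x | f x < c})

/-- A subset `X` of a Euclidean space is `k`-tight with respect to `𝔽`: for every open or closed
half-space `H` the map `H_i(X ∩ H; 𝔽) → H_i(X; 𝔽)` is injective for all `i ≤ k`. -/
def IsKTightSet (𝔽 : Type) [Field 𝔽] (k : ℕ) {E : Type} [AddCommGroup E] [Module ℝ E]
    [TopologicalSpace E] (X : Set E) : Prop :=
  ∀ H : Set E, IsHalfSpace H → ∀ i ≤ k,
    Function.Injective
      (singularHomologyInclusion 𝔽 i (Set.inter_subset_left : X ∩ H ⊆ X)).hom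

/-- `K` is tight: its canonical embedding is `k`-tight with respect to `𝔽₂` for all `k`.
Every half-space of the affine span of the standard simplex is the trace of one of the
half-spaces of `V → ℝ`, whose other traces are empty or the whole affine span. -/
def IsTightComplex {V : Type} [Fintype V] (K : PreAbstractSimplicialComplex V) : Prop :=
  ∀ k : ℕ, IsKTightSet (ZMod 2) k (polyhedron K)

end Tightness

/-! ### Kühnel's series -/

/-- Kühnel's complex `M^d` on the vertex set `ℤ/(2d+3)`: the facets are the sets
`{i, i+1, …, i+d+1} \ {i+j}` with `i ∈ ℤ/(2d+3)` and `1 ≤ j ≤ d`. -/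
def kuehnelComplex (d : ℕ) : PreAbstractSimplicialComplex (ZMod (2 * d + 3)) where
  faces := {s | s.Nonempty ∧ ∃ (i : ZMod (2 * d + 3)) (j : ℕ), 1 ≤ j ∧ j ≤ d ∧
    s ⊆ ((Finset.range (d + 2)).erase j).image (fun k : ℕ => i + (k : ZMod (2 * d + 3)))}
  isRelLowerSet_faces := by
    rintro s ⟨hs, i, j, h1, h2, hsub⟩
    exact ⟨hs, fun t hts ht => ⟨ht, i, j, h1, h2, hts.trans hsub⟩⟩

/-! Call a set of `d + 2` cyclically consecutive vertices an arc, and let N be the complex of all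
subsets of arcs (`InArc`), a (d+1)-dimensional disc bundle over the circle. M^d consists of the
nonempty simplices of N that contain no `d + 1` consecutive vertices
(`isFaceOrEmpty_or_consecutive`, `not_consecutive_subset`). A block of `d + 1` consecutive vertices
lies in exactly two arcs, so M^d is the boundary of N; and since a non-face has more than `d`
vertices, M^d and N have the same simplices with at most `d` vertices. Two vertices out of `2d + 3`
are at most `d + 1` steps apart in one of the two directions, hence share an arc, which gives
2-neighborliness for `d ≥ 2`.

Walkup's class: the arcs through a vertex v form a chain in which each arises from the previous one
by exchanging one vertex. Removing v from them gives a stacked ball whose boundary is the link of v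
(`isStackedSphere_complexLink_kuehnelComplex`). A stacking step changes the polyhedron only by a
linear bijection, which moves the new vertex to the barycentre of the subdivided facet, so stacked
spheres are PL spheres (`IsStackedSphere.isPLSphere`).

Tightness: a half-space meets |K| in a set which retains only the homology of the subcomplex induced
on the set W of vertices it contains. Chain-level subdivision and a straight-line homotopy reduce
tightness to `SimplicialInjective`: a cycle z in the induced subcomplex K[W] that bounds in K bounds
in K[W] (`isTightComplex_of_simplicialInjective`). Chains are taken modulo two and augmented, so
that every homotopy comes from one cone formula.

For M^d, let w be a chain of M^d with boundary z in W. In N, the part of the link of a vertex lying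
in any vertex set is a union of two cones meeting in a cone, so w can be pushed inside N off the
vertices outside W, one after another (`exists_push_inArc`). In low dimension the result already
lies in M^d. When w has the dimension `d` of M^d, the correction x is a sum of arcs, and the pushed
chain may contain blocks inside W. However, x is constant on the arcs that meet the complement of W,
because two vertices always share an arc; replacing x by that constant times the sum F of all arcs
gives a filling in both W and M^d, because each block cancels in the boundary of F
(`simplicialInjective_kuehnelComplex`). -/

/-! ### Singular chains modulo two -/

section SingularChains

/-- The inclusion of the `i`-th face of the standard simplex. -/
noncomputable def simplexFace (n : ℕ) (i : Fin (n + 2)) :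
    C(stdSimplex ℝ (Fin (n + 1)), stdSimplex ℝ (Fin (n + 2))) :=
  ⟨stdSimplex.map i.succAbove, stdSimplex.continuous_map _⟩

/-- Singular chains with coefficients in `ZMod 2`. -/
abbrev SingularChain (X : Type) [TopologicalSpace X] (n : ℕ) : Type :=
  C(stdSimplex ℝ (Fin (n + 1)), X) →₀ ZMod 2

variable {X Y : Type} [TopologicalSpace X] [TopologicalSpace Y]

/-- The boundary operator on singular chains modulo two. -/
noncomputable def singularBoundary (n : ℕ) :
    SingularChain X (n + 1) →ₗ[ZMod 2] SingularChain X n :=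
  ∑ i : Fin (n + 2), Finsupp.lmapDomain (ZMod 2) (ZMod 2) (fun σ => σ.comp (simplexFace n i))

/-- The map of singular chains induced by a continuous map. -/
noncomputable def singularMap (f : C(X, Y)) (n : ℕ) :
    SingularChain X n →ₗ[ZMod 2] SingularChain Y n :=
  Finsupp.lmapDomain (ZMod 2) (ZMod 2) f.comp

@[simp]
lemma singularBoundary_single (n : ℕ) (σ : C(stdSimplex ℝ (Fin (n + 2)), X)) (a : ZMod 2) :
    singularBoundary n (Finsupp.single σ a) =
      ∑ i, Finsupp.single (σ.comp (simplexFace n i)) a := by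
  simp [singularBoundary, Finsupp.mapDomain_single]

@[simp]
lemma singularMap_single (f : C(X, Y)) (n : ℕ) (σ : C(stdSimplex ℝ (Fin (n + 1)), X))
    (a : ZMod 2) : singularMap f n (Finsupp.single σ a) = Finsupp.single (f.comp σ) a := by
  simp [singularMap, Finsupp.mapDomain_single]

lemma singularMap_boundary (f : C(X, Y)) (n : ℕ) (c : SingularChain X (n + 1)) :
    singularMap f n (singularBoundary n c) = singularBoundary n (singularMap f (n + 1) c) := by
  induction c using Finsupp.induction_linear with
  | zero => simp
  | add a b ha hb => simp only [map_add, ha, hb]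
  | single σ a => simp [ContinuousMap.comp_assoc]

open Simplicial

/-- Mathlib's singular chain complex with coefficients in `ZMod 2`. -/
noncomputable abbrev modTwoSingularComplex (X : Type) [TopologicalSpace X] :
    ChainComplex (ModuleCat.{0} (ZMod 2)) ℕ :=
  (TopCat.toSSet.obj (TopCat.of X)).chainComplex (ModuleCat.of (ZMod 2) (ZMod 2))

/-- The comparison from singular chains to Mathlib's singular chain complex. -/
noncomputable def singularChainTo (X : Type) [TopologicalSpace X] (n : ℕ) :
    SingularChain X n →ₗ[ZMod 2] (modTwoSingularComplex X).X n :=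
  Finsupp.lsum (ZMod 2) fun σ =>
    ((TopCat.toSSet.obj (TopCat.of X)).ιChainComplex (n := n) (R := ModuleCat.of (ZMod 2) (ZMod 2))
      (((TopCat.of X).toSSetObjEquiv (.op ⦋n⦌)).symm σ)).hom

/-- The inverse of `singularChainTo`. -/
noncomputable def singularChainFrom (X : Type) [TopologicalSpace X] (n : ℕ) :
    (modTwoSingularComplex X).X n ⟶ ModuleCat.of (ZMod 2) (SingularChain X n) :=
  Limits.Sigma.desc fun x => ModuleCat.ofHom
    (Finsupp.lsingle ((TopCat.of X).toSSetObjEquiv (.op ⦋n⦌) x))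

lemma ι_singularChainFrom (n : ℕ) (x : (TopCat.toSSet.obj (TopCat.of X)) _⦋n⦌) :
    (TopCat.toSSet.obj (TopCat.of X)).ιChainComplex x ≫ singularChainFrom X n =
      ModuleCat.ofHom (Finsupp.lsingle ((TopCat.of X).toSSetObjEquiv (.op ⦋n⦌) x)) :=
  Limits.Sigma.ι_desc _ _

lemma singularChainFrom_to (n : ℕ) (c : SingularChain X n) :
    (singularChainFrom X n).hom (singularChainTo X n c) = c := by
  induction c using Finsupp.induction_linear with
  | zero => simp
  | add a b ha hb => simp only [map_add, ha, hb]
  | single σ a =>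
    have := congr($(ι_singularChainFrom (X := X) n
      (((TopCat.of X).toSSetObjEquiv (.op ⦋n⦌)).symm σ)).hom a)
    simpa [singularChainTo] using this

lemma singularChainTo_from (n : ℕ) (c : (modTwoSingularComplex X).X n) :
    singularChainTo X n ((singularChainFrom X n).hom c) = c := by
  have : singularChainFrom X n ≫ ModuleCat.ofHom (singularChainTo X n) = 𝟙 _ := by
    refine SSet.chainComplex_hom_ext fun x => ?_
    rw [← Category.assoc, ι_singularChainFrom]
    ext
    simp [singularChainTo]
  exact congr($(this).hom c)

lemma singularChainTo_boundary (n : ℕ) (c : SingularChain X (n + 1)) :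
    singularChainTo X n (singularBoundary n c) =
      ((modTwoSingularComplex X).d (n + 1) n).hom (singularChainTo X (n + 1) c) := by
  induction c using Finsupp.induction_linear with
  | zero => simp
  | add a b ha hb => simp only [map_add, ha, hb]
  | single σ a =>
    have := congr($((TopCat.toSSet.obj (TopCat.of X)).ιChainComplex_d
      (ModuleCat.of (ZMod 2) (ZMod 2))
      (((TopCat.of X).toSSetObjEquiv (.op ⦋n + 1⦌)).symm σ)).hom a)
    simp only [ModuleCat.hom_comp, LinearMap.comp_apply] at this
    simp only [singularChainTo, Finsupp.lsum_single, singularBoundary_single, map_sum]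
    rw [this]
    simp only [ModuleCat.hom_sum, LinearMap.sum_apply]
    refine Finset.sum_congr rfl fun i _ => ?_
    -- The alternating signs of the simplicial differential act trivially modulo two.
    have h2 : ((-1 : ℤ) ^ i.val) • ((TopCat.toSSet.obj (TopCat.of X)).ιChainComplex
        (R := ModuleCat.of (ZMod 2) (ZMod 2)) ((TopCat.toSSet.obj (TopCat.of X)).δ i
          (((TopCat.of X).toSSetObjEquiv (.op ⦋n + 1⦌)).symm σ))).hom a =
        ((TopCat.toSSet.obj (TopCat.of X)).ιChainComplex
        (R := ModuleCat.of (ZMod 2) (ZMod 2)) ((TopCat.toSSet.obj (TopCat.of X)).δ i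
          (((TopCat.of X).toSSetObjEquiv (.op ⦋n + 1⦌)).symm σ))).hom a := by
      rw [← map_zsmul]
      congr 1
      rcases neg_one_pow_eq_or ℤ i.val with h | h <;> simp [h, ZMod.neg_eq_self_mod_two]
    refine Eq.trans ?_ h2.symm
    congr 3

lemma singularChainTo_map (f : C(X, Y)) (n : ℕ) (c : SingularChain X n) :
    singularChainTo Y n (singularMap f n c) =
      ((SSet.chainComplexMap (TopCat.toSSet.map (TopCat.ofHom f))
        (ModuleCat.of (ZMod 2) (ZMod 2))).f n).hom (singularChainTo X n c) := by
  induction c using Finsupp.induction_linear with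
  | zero => simp
  | add a b ha hb => simp only [map_add, ha, hb]
  | single σ a =>
    have := congr($(SSet.ι_chainComplexMap_f _ _ (TopCat.toSSet.map (TopCat.ofHom f))
      (ModuleCat.of (ZMod 2) (ZMod 2))
      (((TopCat.of X).toSSetObjEquiv (.op ⦋n⦌)).symm σ)).hom a)
    simp only [ModuleCat.hom_comp, LinearMap.comp_apply] at this
    simp only [singularChainTo, Finsupp.lsum_single, singularMap_single]
    rw [this]
    congr 3

/-- A chain-level criterion for injectivity in singular homology. -/
theorem singularHomology_map_injective (f : C(X, Y)) (n : ℕ)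
    (h : ∀ (z : SingularChain X n) (w : SingularChain Y (n + 1)),
      singularBoundary n w = singularMap f n z → ∃ u, singularBoundary n u = z) :
    Function.Injective
      (((AlgebraicTopology.singularHomologyFunctor (ModuleCat.{0} (ZMod 2)) n).obj
        (ModuleCat.of (ZMod 2) (ZMod 2))).map (TopCat.ofHom f)).hom := by
  set φ := SSet.chainComplexMap (TopCat.toSSet.map (TopCat.ofHom f))
        (ModuleCat.of (ZMod 2) (ZMod 2)) with hφ
  change Function.Injective (HomologicalComplex.homologyMap φ n).hom
  -- Homology embeds into chains modulo boundaries (the opcycles), so the vanishing of a class can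
  -- be tested by asking whether a representative is a boundary.
  have key (Z : Type) [TopologicalSpace Z] (x : (modTwoSingularComplex Z).X n) :
      ((modTwoSingularComplex Z).pOpcycles n).hom x = 0 ↔
        ∃ u, ((modTwoSingularComplex Z).d (n + 1) n).hom u = x := by
    have := ((modTwoSingularComplex Z).sc' (n + 1) n
      ((ComplexShape.down ℕ).next n)).moduleCat_pOpcycles_eq_zero_iff x
    have h2 := ((modTwoSingularComplex Z).sc n).moduleCat_pOpcycles_eq_zero_iff x
    have e : (ComplexShape.down ℕ).prev n = n + 1 := by simp
    refine h2.trans ?_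
    change (∃ y, ((modTwoSingularComplex Z).d ((ComplexShape.down ℕ).prev n) n).hom y = x) ↔ _
    rw [e]
  rw [injective_iff_map_eq_zero]
  intro x hx
  obtain ⟨c, rfl⟩ := (ModuleCat.epi_iff_surjective
    ((modTwoSingularComplex X).homologyπ n)).1 inferInstance x
  have hι := (ModuleCat.mono_iff_injective ((modTwoSingularComplex X).homologyι n)).1 inferInstance
  apply hι
  rw [map_zero]
  have e1 := congr($((modTwoSingularComplex X).homology_π_ι n).hom c)
  simp only [ModuleCat.hom_comp, LinearMap.comp_apply] at e1
  rw [e1, key]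
  set z := ((modTwoSingularComplex X).iCycles n).hom c
  have e2 := congr($(HomologicalComplex.homologyι_naturality φ n).hom
    (((modTwoSingularComplex X).homologyπ n).hom c))
  have e3 := congr($(HomologicalComplex.p_opcyclesMap φ n).hom z)
  simp only [ModuleCat.hom_comp, LinearMap.comp_apply] at e2 e3
  rw [hx, map_zero, e1, e3] at e2
  obtain ⟨w, hw⟩ := (key Y _).1 e2.symm
  obtain ⟨u, hu⟩ := h ((singularChainFrom X n).hom z) ((singularChainFrom Y (n + 1)).hom w) (by
    apply (Function.LeftInverse.injective (singularChainFrom_to (X := Y) n))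
    rw [singularChainTo_boundary, singularChainTo_map, singularChainTo_from,
      singularChainTo_from, hw])
  refine ⟨singularChainTo X (n + 1) u, ?_⟩
  rw [← singularChainTo_boundary, hu, singularChainTo_from]

end SingularChains

/-! ### Ordered chains modulo two -/

section TupleChains

/-- Formal sums modulo two of `n`-tuples of elements of `E`. -/
abbrev TupleChain (E : Type) (n : ℕ) : Type := (Fin n → E) →₀ ZMod 2

variable {E E' F F' : Type}

/-- The boundary of a tuple is the sum of the tuples obtained by deleting one entry. -/
noncomputable def tupleBoundary (n : ℕ) : TupleChain E (n + 1) →ₗ[ZMod 2] TupleChain E n :=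
  ∑ i : Fin (n + 1), Finsupp.lmapDomain (ZMod 2) (ZMod 2) (fun v => v ∘ i.succAbove)

/-- The cone operator prepends an entry. -/
noncomputable def tupleCone (b : E) (n : ℕ) : TupleChain E n →ₗ[ZMod 2] TupleChain E (n + 1) :=
  Finsupp.lmapDomain (ZMod 2) (ZMod 2) (Fin.cons (α := fun _ => E) b)

/-- The map of ordered chains induced by a map of vertices. -/
noncomputable def tupleMap (g : E → F) (n : ℕ) : TupleChain E n →ₗ[ZMod 2] TupleChain F n :=
  Finsupp.lmapDomain (ZMod 2) (ZMod 2) (g ∘ ·)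

@[simp]
lemma tupleBoundary_single (n : ℕ) (v : Fin (n + 1) → E) (a : ZMod 2) :
    tupleBoundary n (Finsupp.single v a) = ∑ i, Finsupp.single (v ∘ Fin.succAbove i) a := by
  simp [tupleBoundary, Finsupp.mapDomain_single]

@[simp]
lemma tupleCone_single (b : E) (n : ℕ) (v : Fin n → E) (a : ZMod 2) :
    tupleCone b n (Finsupp.single v a) = Finsupp.single (Fin.cons (α := fun _ => E) b v) a := by
  simp [tupleCone, Finsupp.mapDomain_single]

@[simp]
lemma tupleMap_single (g : E → F) (n : ℕ) (v : Fin n → E) (a : ZMod 2) :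
    tupleMap g n (Finsupp.single v a) = Finsupp.single (g ∘ v) a := by
  simp [tupleMap, Finsupp.mapDomain_single]

lemma tupleBoundary_cone_zero (b : E) (c : TupleChain E 0) :
    tupleBoundary 0 (tupleCone b 0 c) = c := by
  induction c using Finsupp.induction_linear with
  | zero => simp
  | add x y hx hy => simp only [map_add, hx, hy]
  | single v a =>
    rw [tupleCone_single, tupleBoundary_single, Fin.sum_univ_succ, Finset.univ_eq_empty,
      Finset.sum_empty, add_zero]
    congr 1

/-- Deleting the apex gives back `c`; deleting any other entry commutes with prepending `b`. All
homotopies on ordered chains below are derived from this formula. -/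
lemma tupleBoundary_cone (b : E) (n : ℕ) (c : TupleChain E (n + 1)) :
    tupleBoundary (n + 1) (tupleCone b (n + 1) c) = c + tupleCone b n (tupleBoundary n c) := by
  induction c using Finsupp.induction_linear with
  | zero => simp
  | add x y hx hy => simp only [map_add, hx, hy]; abel
  | single v a =>
    simp only [tupleCone_single, tupleBoundary_single, Fin.sum_univ_succ (n := n + 1), map_sum]
    congr 1
    refine Finset.sum_congr rfl fun i _ => ?_
    congr 1
    ext j
    refine Fin.cases ?_ (fun j => ?_) j <;> simp [Fin.succ_succAbove_succ]

lemma tuple_single_eq_cone (n : ℕ) (v : Fin (n + 1) → E) (a : ZMod 2) :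
    Finsupp.single v a = tupleCone (v 0) n (Finsupp.single (Fin.tail v) a) := by
  rw [tupleCone_single, Fin.cons_self_tail]

/-- Linear maps out of ordered chains of positive length agree if they agree on cones. -/
lemma tupleChain_induction {n : ℕ} {P : TupleChain E (n + 1) → Prop} (c : TupleChain E (n + 1))
    (h0 : P 0) (hadd : ∀ x y, P x → P y → P (x + y))
    (hcone : ∀ b v, P (tupleCone b n (Finsupp.single v 1))) : P c := by
  induction c using Finsupp.induction_linear with
  | zero => exact h0
  | add x y hx hy => exact hadd _ _ hx hy
  | single v a =>
    obtain rfl | rfl : a = 0 ∨ a = 1 := by revert a; decide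
    · simpa using h0
    · rw [tuple_single_eq_cone]; exact hcone _ _

/-- By the cone formula, the boundary of `v + b * ∂v` is `∂v + ∂v + b * ∂∂v`, so the claim passes up
from the shorter tuple. -/
lemma tupleBoundary_boundary (n : ℕ) (c : TupleChain E (n + 2)) :
    tupleBoundary n (tupleBoundary (n + 1) c) = 0 := by
  induction n with
  | zero =>
    refine tupleChain_induction (P := fun c => tupleBoundary 0 (tupleBoundary 1 c) = 0) c (by simp)
      (fun x y hx hy => by simp only [map_add, hx, hy, add_zero]) fun b v => ?_
    rw [tupleBoundary_cone, map_add, tupleBoundary_cone_zero, ZModModule.add_self]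
  | succ n ih =>
    refine tupleChain_induction
      (P := fun c => tupleBoundary (n + 1) (tupleBoundary (n + 2) c) = 0) c (by simp)
      (fun x y hx hy => by simp only [map_add, hx, hy, add_zero]) fun b v => ?_
    rw [tupleBoundary_cone, map_add, tupleBoundary_cone, ih, map_zero, add_zero,
      ZModModule.add_self]

lemma tupleMap_boundary (g : E → F) (n : ℕ) (c : TupleChain E (n + 1)) :
    tupleMap g n (tupleBoundary n c) = tupleBoundary n (tupleMap g (n + 1) c) := by
  induction c using Finsupp.induction_linear with
  | zero => simp
  | add x y hx hy => simp only [map_add, hx, hy]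
  | single v a => simp [Function.comp_assoc]

lemma tupleMap_cone (g : E → F) (b : E) (n : ℕ) (c : TupleChain E n) :
    tupleMap g (n + 1) (tupleCone b n c) = tupleCone (g b) n (tupleMap g n c) := by
  induction c using Finsupp.induction_linear with
  | zero => simp
  | add x y hx hy => simp only [map_add, hx, hy]
  | single v a =>
    simp only [tupleCone_single, tupleMap_single]
    congr 1
    ext j
    refine Fin.cases ?_ (fun j => ?_) j <;> simp

/-- The chains all of whose tuples have their entries in `S`. -/
def tupleSupported (S : Set E) (n : ℕ) : Submodule (ZMod 2) (TupleChain E n) :=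
  Finsupp.supported (ZMod 2) (ZMod 2) {v | ∀ i, v i ∈ S}

lemma tupleSupported_mono {S T : Set E} (h : S ⊆ T) (n : ℕ) :
    tupleSupported S n ≤ tupleSupported T n :=
  Finsupp.supported_mono fun _ hv i => h (hv i)

lemma single_mem_tupleSupported {S : Set E} {n : ℕ} {v : Fin n → E} (h : ∀ i, v i ∈ S)
    (a : ZMod 2) : Finsupp.single v a ∈ tupleSupported S n :=
  Finsupp.single_mem_supported _ _ h

/-- With `N = ⊥` this proves linear identities that hold only on part of the basis, for instance on
tuples whose affine simplex stays in a given set. -/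
lemma map_mem_of_supported {α : Type} {M : Type*} [AddCommGroup M] [Module (ZMod 2) M]
    (f : (α →₀ ZMod 2) →ₗ[ZMod 2] M) {s : Set α} (N : Submodule (ZMod 2) M)
    (h : ∀ v ∈ s, f (Finsupp.single v 1) ∈ N) {c : α →₀ ZMod 2}
    (hc : c ∈ Finsupp.supported (ZMod 2) (ZMod 2) s) : f c ∈ N := by
  rw [Finsupp.supported_eq_span_single] at hc
  refine Submodule.span_induction ?_ (by simp) (fun x y _ _ hx hy => ?_) (fun a x _ hx => ?_) hc
  · rintro _ ⟨v, hv, rfl⟩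
    exact h v hv
  · rw [map_add]; exact N.add_mem hx hy
  · rw [map_smul]; exact N.smul_mem a hx

lemma tupleCone_mem {S : Set E} {b : E} (hb : b ∈ S) {n : ℕ} {c : TupleChain E n}
    (hc : c ∈ tupleSupported S n) : tupleCone b n c ∈ tupleSupported S (n + 1) := by
  refine map_mem_of_supported _ _ (fun v hv => ?_) hc
  rw [tupleCone_single]
  exact single_mem_tupleSupported (Fin.cases hb hv) _

/-- The chain homotopy between two augmentation-preserving chain maps obtained by coning,
where `b` chooses the apex of the cone. -/
noncomputable def tupleHomotopy (A B : ∀ n, TupleChain E n →ₗ[ZMod 2] TupleChain F n)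
    (b : ∀ n, (Fin (n + 1) → E) → F) : ∀ n, TupleChain E n →ₗ[ZMod 2] TupleChain F (n + 1)
  | 0 => 0
  | n + 1 => Finsupp.lsum (ZMod 2) fun v => LinearMap.toSpanSingleton (ZMod 2) _
      (tupleCone (b n v) (n + 1) (A (n + 1) (Finsupp.single v 1) + B (n + 1) (Finsupp.single v 1) +
        tupleHomotopy A B b n (tupleBoundary n (Finsupp.single v 1))))

lemma tupleHomotopy_single (A B : ∀ n, TupleChain E n →ₗ[ZMod 2] TupleChain F n)
    (b : ∀ n, (Fin (n + 1) → E) → F) (n : ℕ) (v : Fin (n + 1) → E) :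
    tupleHomotopy A B b (n + 1) (Finsupp.single v 1) =
      tupleCone (b n v) (n + 1) (A (n + 1) (Finsupp.single v 1) + B (n + 1) (Finsupp.single v 1) +
        tupleHomotopy A B b n (tupleBoundary n (Finsupp.single v 1))) := by
  rw [tupleHomotopy, Finsupp.lsum_single, LinearMap.toSpanSingleton_apply, one_smul]

lemma linear_ext_single {α : Type} {M : Type*} [AddCommGroup M] [Module (ZMod 2) M]
    {f g : (α →₀ ZMod 2) →ₗ[ZMod 2] M}
    (h : ∀ v, f (Finsupp.single v 1) = g (Finsupp.single v 1)) (c : α →₀ ZMod 2) : f c = g c := by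
  have : f = g := Finsupp.lhom_ext' fun v => LinearMap.ext_ring (h v)
  rw [this]

/-- The chain `A v + B v + H(∂v)` is a cycle by the formula one degree lower, so its cone bounds it,
whatever the apex. The apex matters only for supports and naturality. The homotopy may start at zero
because `A` and `B` agree on the empty tuple. -/
lemma tupleHomotopy_spec {A B : ∀ n, TupleChain E n →ₗ[ZMod 2] TupleChain F n}
    (b : ∀ n, (Fin (n + 1) → E) → F)
    (hA : ∀ n c, tupleBoundary n (A (n + 1) c) = A n (tupleBoundary n c))
    (hB : ∀ n c, tupleBoundary n (B (n + 1) c) = B n (tupleBoundary n c))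
    (h0 : A 0 = B 0) (n : ℕ) (c : TupleChain E (n + 1)) :
    tupleBoundary (n + 1) (tupleHomotopy A B b (n + 1) c) +
      tupleHomotopy A B b n (tupleBoundary n c) = A (n + 1) c + B (n + 1) c := by
  induction n with
  | zero =>
    refine linear_ext_single (f := tupleBoundary 1 ∘ₗ tupleHomotopy A B b 1 +
      tupleHomotopy A B b 0 ∘ₗ tupleBoundary 0) (g := A 1 + B 1) (fun v => ?_) c
    simp only [LinearMap.add_apply, LinearMap.comp_apply]
    rw [tupleHomotopy_single, tupleBoundary_cone]
    simp only [map_add, hA, hB, h0, tupleHomotopy, LinearMap.zero_apply, add_zero, map_zero,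
      ZModModule.add_self]
  | succ n ih =>
    refine linear_ext_single (f := tupleBoundary (n + 2) ∘ₗ tupleHomotopy A B b (n + 2) +
      tupleHomotopy A B b (n + 1) ∘ₗ tupleBoundary (n + 1)) (g := A (n + 2) + B (n + 2))
      (fun v => ?_) c
    simp only [LinearMap.add_apply, LinearMap.comp_apply]
    rw [tupleHomotopy_single, tupleBoundary_cone]
    have := ih (tupleBoundary (n + 1) (Finsupp.single v 1))
    rw [tupleBoundary_boundary, map_zero, add_zero] at this
    rw [map_add (tupleBoundary (n + 1)), this, map_add (tupleBoundary (n + 1)), hA, hB, ZModModule.add_self, map_zero,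
      add_zero, add_assoc, ZModModule.add_self, add_zero]

lemma tupleHomotopy_mem {A B : ∀ n, TupleChain E n →ₗ[ZMod 2] TupleChain F n}
    {b : ∀ n, (Fin (n + 1) → E) → F} {S : Set E} {T : Set F}
    (hA : ∀ n v, (∀ i, v i ∈ S) → A n (Finsupp.single v 1) ∈ tupleSupported T n)
    (hB : ∀ n v, (∀ i, v i ∈ S) → B n (Finsupp.single v 1) ∈ tupleSupported T n)
    (hb : ∀ n v, (∀ i, v i ∈ S) → b n v ∈ T) (n : ℕ) (v : Fin n → E) (hv : ∀ i, v i ∈ S) :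
    tupleHomotopy A B b n (Finsupp.single v 1) ∈ tupleSupported T (n + 1) := by
  induction n with
  | zero => simp [tupleHomotopy]
  | succ n ih =>
    rw [tupleHomotopy_single]
    refine tupleCone_mem (hb _ _ hv) (add_mem (add_mem (hA _ _ hv) (hB _ _ hv)) ?_)
    rw [tupleBoundary_single, map_sum]
    exact sum_mem fun i _ => ih _ fun j => hv _

lemma tupleHomotopy_natural {A B : ∀ n, TupleChain E n →ₗ[ZMod 2] TupleChain F n}
    {b : ∀ n, (Fin (n + 1) → E) → F} {A' B' : ∀ n, TupleChain E' n →ₗ[ZMod 2] TupleChain F' n}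
    {b' : ∀ n, (Fin (n + 1) → E') → F'} (g : E → E') (k : F → F')
    (hA : ∀ n c, tupleMap k n (A n c) = A' n (tupleMap g n c))
    (hB : ∀ n c, tupleMap k n (B n c) = B' n (tupleMap g n c))
    (hb : ∀ n v, k (b n v) = b' n (g ∘ v)) (n : ℕ) (c : TupleChain E n) :
    tupleMap k (n + 1) (tupleHomotopy A B b n c) =
      tupleHomotopy A' B' b' n (tupleMap g n c) := by
  induction n with
  | zero => simp [tupleHomotopy]
  | succ n ih =>
    refine linear_ext_single (f := tupleMap k (n + 2) ∘ₗ tupleHomotopy A B b (n + 1))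
      (g := tupleHomotopy A' B' b' (n + 1) ∘ₗ tupleMap g (n + 1)) (fun v => ?_) c
    simp only [LinearMap.comp_apply]
    rw [tupleHomotopy_single, tupleMap_cone, tupleMap_single, tupleHomotopy_single]
    simp only [map_add, hA, hB, ih, tupleMap_boundary, hb, tupleMap_single]

end TupleChains

/-! ### Simplicial chains modulo two -/

section FaceChains

set_option linter.unusedSectionVars false

variable {V : Type} [Fintype V] [DecidableEq V]

/-- The simplicial boundary operator modulo two, on functions on the set of all finite sets of
vertices; the empty set spans the augmentation. -/
def faceBoundary : (Finset V → ZMod 2) →ₗ[ZMod 2] (Finset V → ZMod 2) where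
  toFun c t := ∑ x ∈ tᶜ, c (insert x t)
  map_add' c c' := by ext t; simp [Finset.sum_add_distrib]
  map_smul' a c := by ext t; simp [Finset.mul_sum]

/-- The cone operator with apex `p` on simplicial chains. -/
def faceCone (p : V) : (Finset V → ZMod 2) →ₗ[ZMod 2] (Finset V → ZMod 2) where
  toFun c t := if p ∈ t then c (t.erase p) else 0
  map_add' c c' := by ext t; by_cases h : p ∈ t <;> simp [h]
  map_smul' a c := by ext t; by_cases h : p ∈ t <;> simp [h]

lemma faceBoundary_apply (c : Finset V → ZMod 2) (t : Finset V) :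
    faceBoundary c t = ∑ x ∈ tᶜ, c (insert x t) := rfl

lemma faceCone_apply (p : V) (c : Finset V → ZMod 2) (t : Finset V) :
    faceCone p c t = if p ∈ t then c (t.erase p) else 0 := rfl

lemma faceBoundary_boundary (c : Finset V → ZMod 2) : faceBoundary (faceBoundary c) = 0 := by
  ext t
  simp only [faceBoundary_apply, Pi.zero_apply]
  rw [Finset.sum_sigma']
  refine Finset.sum_involution (fun a _ => ⟨a.2, a.1⟩) ?_ ?_ ?_ ?_
  · rintro ⟨x, y⟩ h
    simp only [Finset.insert_comm x y]
    exact CharTwo.add_self_eq_zero _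
  · rintro ⟨x, y⟩ h _ h2
    simp only [Finset.mem_sigma, Finset.mem_compl, Finset.mem_insert, not_or] at h
    simp only [Sigma.mk.injEq] at h2
    exact h.2.1 h2.1
  · rintro ⟨x, y⟩ h
    simp only [Finset.mem_sigma, Finset.mem_compl, Finset.mem_insert, not_or] at h ⊢
    exact ⟨h.2.2, fun e => h.2.1 e.symm, h.1⟩
  · rintro ⟨x, y⟩ h
    rfl

/-- Coning is exterior multiplication by `p`: sets already containing `p` are killed. This makes the
formula valid for every chain, with no condition on `p`, and the empty set makes it valid in the
lowest degree as well. -/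
lemma faceBoundary_cone (p : V) (c : Finset V → ZMod 2) :
    faceBoundary (faceCone p c) + faceCone p (faceBoundary c) = c := by
  ext t
  simp only [Pi.add_apply, faceBoundary_apply, faceCone_apply]
  by_cases hp : p ∈ t
  · rw [if_pos hp]
    have h1 : (t.erase p)ᶜ = insert p tᶜ := by
      ext x
      by_cases hx : x = p <;> simp [hx]
    rw [h1, Finset.sum_insert (by simpa using hp), Finset.insert_erase hp, add_left_comm]
    have h2 : ∑ x ∈ tᶜ, (if p ∈ insert x t then c ((insert x t).erase p) else 0) =
        ∑ x ∈ tᶜ, c (insert x (t.erase p)) := by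
      refine Finset.sum_congr rfl fun x hx => ?_
      have : x ≠ p := by rintro rfl; simp [hp] at hx
      rw [if_pos (Finset.mem_insert_of_mem hp), Finset.erase_insert_of_ne this]
    rw [h2, CharTwo.add_self_eq_zero, add_zero]
  · rw [if_neg hp, add_zero, Finset.sum_eq_single p]
    · rw [if_pos (Finset.mem_insert_self _ _), Finset.erase_insert hp]
    · intro x _ hx
      rw [if_neg]
      simp [hp, Ne.symm hx]
    · simp [hp]

lemma faceBoundary_single (S : Finset V) :
    faceBoundary (Pi.single S (1 : ZMod 2)) = ∑ x ∈ S, Pi.single (S.erase x) 1 := by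
  ext t
  rw [faceBoundary_apply, Finset.sum_apply]
  simp only [Pi.single_apply]
  rw [Finset.sum_boole, Finset.sum_boole]
  congr 2
  ext x
  simp only [Finset.mem_filter, Finset.mem_compl]
  constructor
  · rintro ⟨h, rfl⟩
    simp [h]
  · rintro ⟨h, rfl⟩
    simp [h]

/-- The chains supported on the sets satisfying `Q`. -/
def faceSupported (Q : Finset V → Prop) : Submodule (ZMod 2) (Finset V → ZMod 2) where
  carrier := {c | ∀ S, c S ≠ 0 → Q S}
  add_mem' := by
    intro a b ha hb S h
    by_cases h1 : a S = 0
    · exact hb S fun h2 => h (by simp [h1, h2])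
    · exact ha S h1
  zero_mem' := by intro S h; simp at h
  smul_mem' := by
    intro a c hc S h
    exact hc S fun h2 => h (by simp [h2])

lemma single_mem_faceSupported {Q : Finset V → Prop} {S : Finset V} (h : Q S) :
    Pi.single S (1 : ZMod 2) ∈ faceSupported Q := by
  intro T hT
  by_cases e : T = S
  · exact e ▸ h
  · simp [e] at hT

lemma faceSupported_mono {Q Q' : Finset V → Prop} (h : ∀ S, Q S → Q' S) :
    faceSupported Q ≤ faceSupported Q' := fun _ hc S hS => h S (hc S hS)

lemma faceBoundary_mem {Q Q' : Finset V → Prop} (h : ∀ S x, x ∉ S → Q (insert x S) → Q' S)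
    {c : Finset V → ZMod 2} (hc : c ∈ faceSupported Q) : faceBoundary c ∈ faceSupported Q' := by
  intro S hS
  obtain ⟨x, hx, h2⟩ := Finset.exists_ne_zero_of_sum_ne_zero hS
  exact h S x (by simpa using hx) (hc _ h2)

lemma faceCone_mem {Q Q' : Finset V → Prop} {p : V}
    (h : ∀ S, p ∉ S → Q S → Q' (insert p S)) {c : Finset V → ZMod 2}
    (hc : c ∈ faceSupported Q) : faceCone p c ∈ faceSupported Q' := by
  intro S hS
  rw [faceCone_apply] at hS
  by_cases hp : p ∈ S
  · rw [if_pos hp] at hS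
    simpa [hp] using h _ (Finset.notMem_erase p S) (hc _ hS)
  · simp [hp] at hS

lemma faceChain_eq_sum (c : Finset V → ZMod 2) : c = ∑ S, c S • Pi.single S (1 : ZMod 2) := by
  ext T
  simp [Finset.sum_apply, Pi.single_apply]

/-- The simplicial chain of a tuple: its set of entries, or zero if there is a repetition. -/
def tupleFace : ∀ n : ℕ, (Fin n → V) → (Finset V → ZMod 2)
  | 0, _ => Pi.single ∅ 1
  | n + 1, v => faceCone (v 0) (tupleFace n (Fin.tail v))

/-- The chain map from ordered chains to simplicial chains. -/
noncomputable def faceOfTuple (n : ℕ) : TupleChain V n →ₗ[ZMod 2] (Finset V → ZMod 2) :=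
  Finsupp.lsum (ZMod 2) fun v => LinearMap.toSpanSingleton (ZMod 2) _ (tupleFace n v)

lemma faceOfTuple_single (n : ℕ) (v : Fin n → V) :
    faceOfTuple n (Finsupp.single v 1) = tupleFace n v := by
  simp [faceOfTuple]

lemma faceOfTuple_cone (b : V) (n : ℕ) (c : TupleChain V n) :
    faceOfTuple (n + 1) (tupleCone b n c) = faceCone b (faceOfTuple n c) := by
  refine linear_ext_single (f := faceOfTuple (n + 1) ∘ₗ tupleCone b n)
    (g := faceCone b ∘ₗ faceOfTuple n) (fun v => ?_) c
  simp [faceOfTuple_single, tupleFace]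

/-- Both chain complexes satisfy the same cone formula and `faceOfTuple` commutes with cones, so it
suffices to induct on cones. -/
lemma faceOfTuple_boundary (n : ℕ) (c : TupleChain V (n + 1)) :
    faceOfTuple n (tupleBoundary n c) = faceBoundary (faceOfTuple (n + 1) c) := by
  induction n with
  | zero =>
    refine tupleChain_induction (P := fun c => faceOfTuple 0 (tupleBoundary 0 c) =
      faceBoundary (faceOfTuple 1 c)) c (by simp)
      (fun x y hx hy => by simp only [map_add, hx, hy]) fun b v => ?_
    rw [tupleBoundary_cone_zero, faceOfTuple_cone]
    have h := faceBoundary_cone b (faceOfTuple 0 (Finsupp.single v 1))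
    have h2 : faceBoundary (faceOfTuple 0 (Finsupp.single v 1)) = 0 := by
      rw [faceOfTuple_single, tupleFace, faceBoundary_single, Finset.sum_empty]
    rw [h2, map_zero, add_zero] at h
    exact h.symm
  | succ n ih =>
    refine tupleChain_induction (P := fun c => faceOfTuple (n + 1) (tupleBoundary (n + 1) c) =
      faceBoundary (faceOfTuple (n + 2) c)) c (by simp)
      (fun x y hx hy => by simp only [map_add, hx, hy]) fun b v => ?_
    rw [tupleBoundary_cone, map_add, faceOfTuple_cone, faceOfTuple_cone, ih]
    have h := faceBoundary_cone b (faceOfTuple (n + 1) (Finsupp.single v 1))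
    nth_rewrite 1 [← h]
    rw [add_assoc, ZModModule.add_self, add_zero]

lemma tupleFace_mem (n : ℕ) (v : Fin n → V) :
    tupleFace n v ∈ faceSupported fun S => S ⊆ Finset.univ.image v ∧ S.card = n := by
  induction n with
  | zero => exact single_mem_faceSupported (by simp)
  | succ n ih =>
    refine faceCone_mem (fun S hS h => ?_) (ih (Fin.tail v))
    refine ⟨Finset.insert_subset (by simp) (h.1.trans ?_), by
      rw [Finset.card_insert_of_notMem hS, h.2]⟩
    intro x hx
    obtain ⟨i, -, rfl⟩ := Finset.mem_image.1 hx
    exact Finset.mem_image_of_mem v (Finset.mem_univ i.succ)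

/-- The ordered chains whose tuples have their set of entries in `Q`. -/
def tupleFaceSupported (Q : Finset V → Prop) (n : ℕ) : Submodule (ZMod 2) (TupleChain V n) :=
  Finsupp.supported (ZMod 2) (ZMod 2) {v | Q (Finset.univ.image v)}

lemma faceOfTuple_mem {Q : Finset V → Prop} (hQ : ∀ S T, S ⊆ T → Q T → Q S) {n : ℕ}
    {c : TupleChain V n} (hc : c ∈ tupleFaceSupported Q n) :
    faceOfTuple n c ∈ faceSupported fun S => Q S ∧ S.card = n := by
  refine map_mem_of_supported _ _ (fun v hv => ?_) hc
  rw [faceOfTuple_single]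
  exact faceSupported_mono (fun S hS => ⟨hQ _ _ hS.1 hv, hS.2⟩) (tupleFace_mem n v)

variable [Nonempty V]

/-- An element of a nonempty set of vertices. -/
noncomputable def faceVertex (S : Finset V) : V := by
  classical exact if h : S.Nonempty then h.choose else Classical.arbitrary V

lemma faceVertex_mem {S : Finset V} (h : S.Nonempty) : faceVertex S ∈ S := by
  rw [faceVertex, dif_pos h]
  exact h.choose_spec

/-- A chain map from simplicial chains to ordered chains. -/
noncomputable def tupleOfFace : ∀ n : ℕ, (Finset V → ZMod 2) →ₗ[ZMod 2] TupleChain V n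
  | 0 => (LinearMap.proj ∅).smulRight (Finsupp.single ![] 1)
  | n + 1 => ∑ S : Finset V, (LinearMap.proj S).smulRight
      (tupleCone (faceVertex S) n (tupleOfFace n (faceBoundary (Pi.single S 1))))

lemma tupleOfFace_succ_single (n : ℕ) (S : Finset V) :
    tupleOfFace (n + 1) (Pi.single S 1) =
      tupleCone (faceVertex S) n (tupleOfFace n (faceBoundary (Pi.single S 1))) := by
  rw [tupleOfFace, LinearMap.sum_apply, Finset.sum_eq_single S]
  · simp
  · intro T _ hT
    simp [hT]
  · simp

/-- The lift of `S` is the cone, from a chosen vertex of `S`, over the lift of its boundary; the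
latter is a cycle by induction and `∂∂ = 0`. -/
lemma tupleOfFace_boundary (n : ℕ) (c : Finset V → ZMod 2) :
    tupleBoundary n (tupleOfFace (n + 1) c) = tupleOfFace n (faceBoundary c) := by
  have key : ∀ S : Finset V, tupleBoundary n (tupleOfFace (n + 1) (Pi.single S 1)) =
      tupleOfFace n (faceBoundary (Pi.single S 1)) := by
    intro S
    rw [tupleOfFace_succ_single]
    cases n with
    | zero => rw [tupleBoundary_cone_zero]
    | succ n =>
      rw [tupleBoundary_cone, tupleOfFace_boundary n, faceBoundary_boundary, map_zero,
        map_zero, add_zero]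
  rw [faceChain_eq_sum c]
  simp only [map_sum, map_smul, key]

lemma tupleOfFace_single_mem (n : ℕ) (S : Finset V) :
    tupleOfFace n (Pi.single S 1) ∈ tupleSupported (S : Set V) n := by
  induction n generalizing S with
  | zero =>
    rw [tupleOfFace, LinearMap.smulRight_apply]
    exact Submodule.smul_mem _ _ (single_mem_tupleSupported (fun i => i.elim0) _)
  | succ n ih =>
    rw [tupleOfFace_succ_single, faceBoundary_single, map_sum]
    rcases S.eq_empty_or_nonempty with rfl | hS
    · simp
    · refine tupleCone_mem (faceVertex_mem hS) (sum_mem fun x _ => ?_)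
      exact tupleSupported_mono (by exact_mod_cast Finset.erase_subset x S) n (ih _)

lemma tupleSupported_le {Q : Finset V → Prop} (hQ : ∀ S T, S ⊆ T → Q T → Q S) {S : Finset V}
    (hS : Q S) (n : ℕ) : tupleSupported (S : Set V) n ≤ tupleFaceSupported Q n :=
  Finsupp.supported_mono fun v hv => hQ _ S (by
    intro x hx
    obtain ⟨i, -, rfl⟩ := Finset.mem_image.1 hx
    exact hv i) hS

lemma tupleOfFace_mem {Q : Finset V → Prop} (hQ : ∀ S T, S ⊆ T → Q T → Q S) (n : ℕ)
    {c : Finset V → ZMod 2} (hc : c ∈ faceSupported Q) :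
    tupleOfFace n c ∈ tupleFaceSupported Q n := by
  rw [faceChain_eq_sum c, map_sum]
  refine sum_mem fun S _ => ?_
  rw [map_smul]
  by_cases h : c S = 0
  · simp [h]
  · exact Submodule.smul_mem _ _ (tupleSupported_le hQ (hc S h) n (tupleOfFace_single_mem n S))

/-- The homotopy between the identity of the ordered chains and the projection to the
simplicial chains. -/
noncomputable def orderHomotopy (n : ℕ) : TupleChain V n →ₗ[ZMod 2] TupleChain V (n + 1) :=
  tupleHomotopy (fun _ => LinearMap.id) (fun n => tupleOfFace n ∘ₗ faceOfTuple n)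
    (fun _ v => v 0) n

lemma orderHomotopy_spec (n : ℕ) (c : TupleChain V (n + 1)) :
    tupleBoundary (n + 1) (orderHomotopy (n + 1) c) + orderHomotopy n (tupleBoundary n c) =
      c + tupleOfFace (n + 1) (faceOfTuple (n + 1) c) := by
  refine tupleHomotopy_spec (A := fun _ => LinearMap.id)
    (B := fun n => tupleOfFace n ∘ₗ faceOfTuple n) _ (fun _ _ => rfl) (fun n c => ?_) ?_ n c
  · simp only [LinearMap.comp_apply]
    rw [tupleOfFace_boundary, faceOfTuple_boundary]
  · refine LinearMap.ext fun c => (linear_ext_single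
      (f := (tupleOfFace 0 ∘ₗ faceOfTuple 0 : TupleChain V 0 →ₗ[ZMod 2] _))
      (g := LinearMap.id) (fun v => ?_) c).symm
    simp only [LinearMap.comp_apply, faceOfTuple_single, tupleFace, tupleOfFace,
      LinearMap.smulRight_apply, LinearMap.proj_apply, Pi.single_eq_same, one_smul,
      LinearMap.id_apply]
    congr 1
    exact Subsingleton.elim _ _

/-- The two chain maps and the apex `v 0` use only entries of the tuple `v`, so the homotopy
respects every subcomplex. -/
lemma orderHomotopy_mem {Q : Finset V → Prop} (hQ : ∀ S T, S ⊆ T → Q T → Q S) {n : ℕ}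
    {c : TupleChain V n} (hc : c ∈ tupleFaceSupported Q n) :
    orderHomotopy n c ∈ tupleFaceSupported Q (n + 1) := by
  refine map_mem_of_supported _ _ (fun v hv => ?_) hc
  refine tupleSupported_le hQ hv _ (tupleHomotopy_mem (S := ↑(Finset.univ.image v))
    (fun n w hw => single_mem_tupleSupported hw _) (fun n w hw => ?_) (fun n w hw => hw 0) n v ?_)
  · simp only [LinearMap.comp_apply, faceOfTuple_single]
    have h1 : tupleFace n w ∈ faceSupported fun S => S ⊆ Finset.univ.image v := by
      refine faceSupported_mono (fun S hS => hS.1.trans ?_) (tupleFace_mem n w)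
      intro x hx
      obtain ⟨i, -, rfl⟩ := Finset.mem_image.1 hx
      exact_mod_cast hw i
    have h2 := tupleOfFace_mem (fun S T h hT => h.trans hT) n h1
    refine Finsupp.supported_mono (fun u hu i => ?_) h2
    exact_mod_cast hu (Finset.mem_image_of_mem u (Finset.mem_univ i))
  · intro i
    simp

end FaceChains

/-! ### Barycentric subdivision of ordered chains -/

section Subdivision

set_option linter.unusedSectionVars false

variable {E F : Type} [AddCommGroup E] [Module ℝ E] [AddCommGroup F] [Module ℝ F]

/-- The barycentre of a tuple. -/
noncomputable def tupleBarycentre (n : ℕ) (v : Fin (n + 1) → E) : E :=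
  (n + 1 : ℝ)⁻¹ • ∑ i, v i

/-- The barycentric subdivision of ordered chains. -/
noncomputable def tupleSubdivision : ∀ n : ℕ, TupleChain E n →ₗ[ZMod 2] TupleChain E n
  | 0 => LinearMap.id
  | n + 1 => Finsupp.lsum (ZMod 2) fun v => LinearMap.toSpanSingleton (ZMod 2) _
      (tupleCone (tupleBarycentre n v) n
        (tupleSubdivision n (tupleBoundary n (Finsupp.single v 1))))

lemma tupleSubdivision_single (n : ℕ) (v : Fin (n + 1) → E) :
    tupleSubdivision (n + 1) (Finsupp.single v 1) =
      tupleCone (tupleBarycentre n v) n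
        (tupleSubdivision n (tupleBoundary n (Finsupp.single v 1))) := by
  rw [tupleSubdivision, Finsupp.lsum_single, LinearMap.toSpanSingleton_apply, one_smul]

lemma tupleSubdivision_boundary (n : ℕ) (c : TupleChain E (n + 1)) :
    tupleBoundary n (tupleSubdivision (n + 1) c) = tupleSubdivision n (tupleBoundary n c) := by
  have key : ∀ v : Fin (n + 1) → E, tupleBoundary n (tupleSubdivision (n + 1) (.single v 1)) =
      tupleSubdivision n (tupleBoundary n (.single v 1)) := by
    intro v
    rw [tupleSubdivision_single]
    cases n with
    | zero => rw [tupleBoundary_cone_zero]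
    | succ n =>
      rw [tupleBoundary_cone, tupleSubdivision_boundary n, tupleBoundary_boundary, map_zero,
        map_zero, add_zero]
  exact linear_ext_single (f := tupleBoundary n ∘ₗ tupleSubdivision (n + 1))
    (g := tupleSubdivision n ∘ₗ tupleBoundary n) key c

lemma tupleSubdivision_natural (g : E →ₗ[ℝ] F) (n : ℕ) (c : TupleChain E n) :
    tupleMap g n (tupleSubdivision n c) = tupleSubdivision n (tupleMap g n c) := by
  induction n with
  | zero => rfl
  | succ n ih =>
    refine linear_ext_single (f := tupleMap g (n + 1) ∘ₗ tupleSubdivision (n + 1))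
      (g := tupleSubdivision (n + 1) ∘ₗ tupleMap g (n + 1)) (fun v => ?_) c
    simp only [LinearMap.comp_apply]
    rw [tupleSubdivision_single, tupleMap_cone, tupleMap_single, tupleSubdivision_single, ih,
      tupleMap_boundary, tupleMap_single]
    congr 2
    simp [tupleBarycentre]

lemma tupleBarycentre_mem {S : Set E} (hS : Convex ℝ S) (n : ℕ) (v : Fin (n + 1) → E)
    (hv : ∀ i, v i ∈ S) : tupleBarycentre n v ∈ S := by
  rw [tupleBarycentre, Finset.smul_sum]
  refine hS.sum_mem (fun i _ => by positivity) ?_ fun i _ => hv i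
  simp only [Finset.sum_const, Finset.card_univ, Fintype.card_fin, nsmul_eq_mul]
  push_cast
  field_simp

lemma tupleSubdivision_mem {S : Set E} (hS : Convex ℝ S) {n : ℕ} {c : TupleChain E n}
    (hc : c ∈ tupleSupported S n) : tupleSubdivision n c ∈ tupleSupported S n := by
  induction n with
  | zero => exact hc
  | succ n ih =>
    refine map_mem_of_supported _ _ (fun v hv => ?_) hc
    rw [tupleSubdivision_single]
    refine tupleCone_mem (tupleBarycentre_mem hS n v hv) (ih ?_)
    rw [tupleBoundary_single]
    exact sum_mem fun i _ => single_mem_tupleSupported (fun j => hv _) _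

/-- The iterated barycentric subdivision. -/
noncomputable def tupleSubdivisionIter : ∀ _ n : ℕ, TupleChain E n →ₗ[ZMod 2] TupleChain E n
  | 0, _ => LinearMap.id
  | k + 1, n => tupleSubdivision n ∘ₗ tupleSubdivisionIter k n

lemma tupleSubdivisionIter_boundary (k n : ℕ) (c : TupleChain E (n + 1)) :
    tupleBoundary n (tupleSubdivisionIter k (n + 1) c) =
      tupleSubdivisionIter k n (tupleBoundary n c) := by
  induction k with
  | zero => rfl
  | succ k ih => simp [tupleSubdivisionIter, tupleSubdivision_boundary, ih]

lemma tupleSubdivisionIter_natural (g : E →ₗ[ℝ] F) (k n : ℕ) (c : TupleChain E n) :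
    tupleMap g n (tupleSubdivisionIter k n c) = tupleSubdivisionIter k n (tupleMap g n c) := by
  induction k with
  | zero => rfl
  | succ k ih => simp [tupleSubdivisionIter, tupleSubdivision_natural, ih]

lemma tupleSubdivisionIter_mem {S : Set E} (hS : Convex ℝ S) (k : ℕ) {n : ℕ} {c : TupleChain E n}
    (hc : c ∈ tupleSupported S n) : tupleSubdivisionIter k n c ∈ tupleSupported S n := by
  induction k with
  | zero => exact hc
  | succ k ih => exact tupleSubdivision_mem hS ih

lemma tupleSubdivisionIter_zero (k : ℕ) :
    (tupleSubdivisionIter k 0 : TupleChain E 0 →ₗ[ZMod 2] _) = LinearMap.id := by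
  induction k with
  | zero => rfl
  | succ k ih => rw [tupleSubdivisionIter, ih]; rfl

/-- The homotopy between the identity and the iterated barycentric subdivision. -/
noncomputable def subdivisionHomotopy (k n : ℕ) : TupleChain E n →ₗ[ZMod 2] TupleChain E (n + 1) :=
  tupleHomotopy (fun _ => LinearMap.id) (tupleSubdivisionIter k) (fun _ v => v 0) n

lemma subdivisionHomotopy_spec (k n : ℕ) (c : TupleChain E (n + 1)) :
    tupleBoundary (n + 1) (subdivisionHomotopy k (n + 1) c) +
      subdivisionHomotopy k n (tupleBoundary n c) = c + tupleSubdivisionIter k (n + 1) c :=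
  tupleHomotopy_spec (A := fun _ => LinearMap.id) (B := tupleSubdivisionIter k) _
    (fun _ _ => rfl) (fun n c => tupleSubdivisionIter_boundary k n c)
    (tupleSubdivisionIter_zero k).symm n c

lemma subdivisionHomotopy_natural (g : E →ₗ[ℝ] F) (k n : ℕ) (c : TupleChain E n) :
    tupleMap g (n + 1) (subdivisionHomotopy k n c) = subdivisionHomotopy k n (tupleMap g n c) :=
  tupleHomotopy_natural g g (fun _ _ => rfl) (fun n c => tupleSubdivisionIter_natural g k n c)
    (fun _ _ => rfl) n c

lemma subdivisionHomotopy_mem {S : Set E} (hS : Convex ℝ S) (k n : ℕ) (v : Fin n → E)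
    (hv : ∀ i, v i ∈ S) :
    subdivisionHomotopy k n (Finsupp.single v 1) ∈ tupleSupported S (n + 1) :=
  tupleHomotopy_mem (S := S) (fun _ _ hw => single_mem_tupleSupported hw _)
    (fun _ _ hw => tupleSubdivisionIter_mem hS k (single_mem_tupleSupported hw _))
    (fun _ _ hw => hw 0) n v hv

end Subdivision

/-! ### Shrinking of diameters under barycentric subdivision -/

section Mesh

variable {E : Type} [NormedAddCommGroup E] [NormedSpace ℝ E]

/-- The chains whose tuples have diameter at most `r`. -/
def tupleMesh (E : Type) [NormedAddCommGroup E] (r : ℝ) (n : ℕ) :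
    Submodule (ZMod 2) (TupleChain E n) :=
  Finsupp.supported (ZMod 2) (ZMod 2) {v | ∀ i j, dist (v i) (v j) ≤ r}

/-- The difference is the mean of the `n + 1` vectors `v i - v k`, one of which vanishes, whence the
factor `n / (n + 1)`. It is weakened to a fixed `N` because the subdivision recurses through smaller
`n`. -/
lemma dist_tupleBarycentre_le {N n : ℕ} (hn : n ≤ N) (v : Fin (n + 1) → E) {r : ℝ}
    (hv : ∀ i j, dist (v i) (v j) ≤ r) (k : Fin (n + 1)) :
    dist (tupleBarycentre n v) (v k) ≤ N / (N + 1) * r := by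
  have hr : 0 ≤ r := dist_nonneg.trans (hv k k)
  have h1 : tupleBarycentre n v - v k = (n + 1 : ℝ)⁻¹ • ∑ i, (v i - v k) := by
    rw [Finset.sum_sub_distrib, smul_sub, tupleBarycentre]
    congr 1
    rw [Finset.sum_const, Finset.card_univ, Fintype.card_fin, ← Nat.cast_smul_eq_nsmul ℝ,
      smul_smul]
    push_cast
    rw [inv_mul_cancel₀ (by positivity), one_smul]
  rw [dist_eq_norm, h1, norm_smul, Real.norm_of_nonneg (by positivity)]
  have h2 : ‖∑ i, (v i - v k)‖ ≤ n * r := by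
    rw [Fin.sum_univ_succAbove _ k, sub_self, zero_add]
    refine (norm_sum_le _ _).trans ?_
    have : ∀ i ∈ (Finset.univ : Finset (Fin n)), ‖v (k.succAbove i) - v k‖ ≤ r := fun i _ => by
      rw [← dist_eq_norm]; exact hv _ _
    refine (Finset.sum_le_sum this).trans ?_
    simp
  have h3 : (n : ℝ) / (n + 1) ≤ N / (N + 1) := by
    have : (n : ℝ) ≤ N := by exact_mod_cast hn
    rw [div_le_div_iff₀ (by positivity) (by positivity)]
    nlinarith
  calc (n + 1 : ℝ)⁻¹ * ‖∑ i, (v i - v k)‖ ≤ (n + 1 : ℝ)⁻¹ * (n * r) := by gcongr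
    _ = n / (n + 1) * r := by ring
    _ ≤ _ := by gcongr

/-- Two entries of a subdivided tuple either both come from the subdivided boundary, where induction
applies, or one is the barycentre. In the second case the other lies in a closed ball about it,
since balls are convex and subdivision stays in convex sets. -/
lemma tupleSubdivision_mesh {N n : ℕ} (hn : n ≤ N + 1) {r : ℝ} (hr : 0 ≤ r) {c : TupleChain E n}
    (hc : c ∈ tupleMesh E r n) : tupleSubdivision n c ∈ tupleMesh E (N / (N + 1) * r) n := by
  induction n with
  | zero =>
    refine Finsupp.supported_mono ?_ (show c ∈ Finsupp.supported (ZMod 2) (ZMod 2) Set.univ by simp)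
    exact fun v _ i => i.elim0
  | succ n ih =>
    refine map_mem_of_supported _ _ (fun v hv => ?_) hc
    rw [tupleSubdivision_single]
    have h1 : tupleSubdivision n (tupleBoundary n (Finsupp.single v 1)) ∈
        tupleMesh E (N / (N + 1) * r) n := by
      refine ih (by omega) ?_
      rw [tupleBoundary_single]
      exact sum_mem fun i _ => Finsupp.single_mem_supported _ _ fun j k => hv _ _
    have h2 : tupleSubdivision n (tupleBoundary n (Finsupp.single v 1)) ∈
        tupleSupported (Metric.closedBall (tupleBarycentre n v) (N / (N + 1) * r)) n := by
      refine tupleSubdivision_mem (convex_closedBall _ _) ?_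
      rw [tupleBoundary_single]
      refine sum_mem fun i _ => single_mem_tupleSupported (fun j => ?_) _
      rw [Metric.mem_closedBall, dist_comm]
      exact dist_tupleBarycentre_le (by omega) v hv _
    have h3 : tupleSubdivision n (tupleBoundary n (Finsupp.single v 1)) ∈
        Finsupp.supported (ZMod 2) (ZMod 2)
          ({w | ∀ i j, dist (w i) (w j) ≤ N / (N + 1) * r} ∩
            {w | ∀ i, w i ∈ Metric.closedBall (tupleBarycentre n v) (N / (N + 1) * r)}) := by
      rw [Finsupp.supported_inter]
      exact ⟨h1, h2⟩
    refine map_mem_of_supported _ _ (fun w hw => ?_) h3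
    rw [tupleCone_single]
    refine Finsupp.single_mem_supported _ _ fun i j => ?_
    have h0 : 0 ≤ N / (N + 1) * r := by positivity
    refine Fin.cases (Fin.cases ?_ (fun j => ?_) j) (fun i => Fin.cases ?_ (fun j => ?_) j) i
    · simpa using h0
    · rw [Fin.cons_zero, Fin.cons_succ, dist_comm]; exact hw.2 j
    · rw [Fin.cons_zero, Fin.cons_succ]; exact hw.2 i
    · rw [Fin.cons_succ, Fin.cons_succ]; exact hw.1 i j

lemma tupleSubdivisionIter_mesh (n : ℕ) {r : ℝ} (hr : 0 ≤ r) (k : ℕ)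
    {c : TupleChain E (n + 1)} (hc : c ∈ tupleMesh E r (n + 1)) :
    tupleSubdivisionIter k (n + 1) c ∈ tupleMesh E ((n / (n + 1)) ^ k * r) (n + 1) := by
  induction k with
  | zero => simpa [tupleSubdivisionIter] using hc
  | succ k ih =>
    rw [pow_succ', mul_assoc]
    exact tupleSubdivision_mesh (N := n) le_rfl (by positivity) ih

lemma exists_subdivisionIter_mesh (n : ℕ) {r δ : ℝ} (hr : 0 ≤ r) (hδ : 0 < δ) :
    ∃ k₀, ∀ k ≥ k₀, ∀ c ∈ tupleMesh E r (n + 1),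
      tupleSubdivisionIter k (n + 1) c ∈ tupleMesh E δ (n + 1) := by
  have h1 : Filter.Tendsto (fun k : ℕ => ((n : ℝ) / (n + 1)) ^ k * r) Filter.atTop (nhds 0) := by
    have := (tendsto_pow_atTop_nhds_zero_of_lt_one (r := (n : ℝ) / (n + 1)) (by positivity)
      (by rw [div_lt_one (by positivity)]; linarith)).mul_const r
    simpa using this
  obtain ⟨k₀, hk⟩ := Filter.eventually_atTop.1 (h1.eventually (gt_mem_nhds hδ))
  refine ⟨k₀, fun k hkk c hc => ?_⟩
  refine Finsupp.supported_mono (fun v hv i j => ?_) (tupleSubdivisionIter_mesh n hr k hc)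
  exact (hv i j).trans (hk k hkk).le

end Mesh

/-! ### Realization of ordered chains by affine singular simplices -/

section Realization

set_option linter.unusedSectionVars false

lemma eq_of_add_eq_zero_modTwo {M : Type*} [AddCommGroup M] [Module (ZMod 2) M] {a b : M}
    (h : a + b = 0) : a = b := by
  rw [← add_zero a, ← ZModModule.add_self b, ← add_assoc, h, zero_add]

lemma sum_simplexFace_smul {E : Type*} [AddCommGroup E] [Module ℝ E] (n : ℕ) (i : Fin (n + 2))
    (t : stdSimplex ℝ (Fin (n + 1))) (u : Fin (n + 2) → E) :
    ∑ j, (simplexFace n i t) j • u j = ∑ j, t j • u (i.succAbove j) := by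
  change ∑ j, (FunOnFinite.linearMap ℝ ℝ i.succAbove t) j • u j = _
  simp only [FunOnFinite.linearMap_apply_apply, Finset.sum_smul]
  rw [← Finset.sum_fiberwise Finset.univ i.succAbove (fun j => t j • u (i.succAbove j))]
  refine Finset.sum_congr rfl fun j _ => Finset.sum_congr rfl fun k hk => ?_
  rw [(Finset.mem_filter.1 hk).2]

variable {α : Type} {E : Type} [AddCommGroup E] [Module ℝ E] [TopologicalSpace E]
  [IsTopologicalAddGroup E] [ContinuousSMul ℝ E] {X Y : Type} [TopologicalSpace X]
  [TopologicalSpace Y]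

/-- The affine simplex whose vertices are the images of the tuple under `p` lies in `A`. -/
def AffineIn (p : α → E) (A : Set E) (n : ℕ) (v : Fin n → α) : Prop :=
  ∀ t ∈ stdSimplex ℝ (Fin n), ∑ i, t i • p (v i) ∈ A

/-- The affine simplex with the given vertices. -/
def affineSimplex (p : α → E) {A : Set E} {n : ℕ} {v : Fin n → α} (h : AffineIn p A n v) :
    C(stdSimplex ℝ (Fin n), A) where
  toFun t := ⟨∑ i, t i • p (v i), h t t.2⟩
  continuous_toFun := by
    refine Continuous.subtype_mk ?_ _
    refine continuous_finsetSum _ fun i _ => ?_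
    exact ((continuous_apply i).comp continuous_subtype_val).smul continuous_const

lemma AffineIn.face {p : α → E} {A : Set E} {n : ℕ} {v : Fin (n + 2) → α}
    (h : AffineIn p A (n + 2) v) (i : Fin (n + 2)) : AffineIn p A (n + 1) (v ∘ i.succAbove) := by
  intro t ht
  have := h _ (simplexFace n i ⟨t, ht⟩).2
  have h2 := sum_simplexFace_smul n i ⟨t, ht⟩ (fun j => p (v j))
  change ∑ j, (simplexFace n i ⟨t, ht⟩) j • p (v j) ∈ A at this
  rw [h2] at this
  exact this

lemma affineSimplex_face {p : α → E} {A : Set E} {n : ℕ} {v : Fin (n + 2) → α}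
    (h : AffineIn p A (n + 2) v) (i : Fin (n + 2)) :
    (affineSimplex p h).comp (simplexFace n i) = affineSimplex p (h.face i) := by
  exact ContinuousMap.ext fun t => Subtype.ext (sum_simplexFace_smul n i t (fun j => p (v j)))

open Classical in
/-- The singular chain obtained by realizing tuples as affine simplices in `A` and composing
with `F`. -/
noncomputable def realize (p : α → E) {A : Set E} (F : C(A, X)) (n : ℕ) :
    TupleChain α (n + 1) →ₗ[ZMod 2] SingularChain X n :=
  Finsupp.lsum (ZMod 2) fun v => LinearMap.toSpanSingleton (ZMod 2) _
    -- Zero is a junk value for tuples whose affine simplex leaves `A`; compatibility with the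
    -- boundary is claimed only for chains that avoid such tuples.
    (if h : AffineIn p A (n + 1) v then Finsupp.single (F.comp (affineSimplex p h)) 1 else 0)

lemma realize_single (p : α → E) {A : Set E} (F : C(A, X)) (n : ℕ) {v : Fin (n + 1) → α}
    (h : AffineIn p A (n + 1) v) :
    realize p F n (Finsupp.single v 1) = Finsupp.single (F.comp (affineSimplex p h)) 1 := by
  simp [realize, h]

lemma realize_boundary (p : α → E) {A : Set E} (F : C(A, X)) (n : ℕ) {c : TupleChain α (n + 2)}
    (hc : c ∈ Finsupp.supported (ZMod 2) (ZMod 2) {v | AffineIn p A (n + 2) v}) :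
    singularBoundary n (realize p F (n + 1) c) = realize p F n (tupleBoundary (n + 1) c) := by
  have := map_mem_of_supported (singularBoundary n ∘ₗ realize p F (n + 1) +
    realize p F n ∘ₗ tupleBoundary (n + 1)) ⊥ (fun v hv => ?_) hc
  · exact eq_of_add_eq_zero_modTwo this
  · simp only [LinearMap.add_apply, LinearMap.comp_apply, Submodule.mem_bot]
    rw [realize_single p F _ hv, singularBoundary_single, tupleBoundary_single, map_sum,
      ← Finset.sum_add_distrib]
    refine Finset.sum_eq_zero fun i _ => ?_
    rw [realize_single p F _ (AffineIn.face hv i), ContinuousMap.comp_assoc, affineSimplex_face,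
      ZModModule.add_self]

lemma AffineIn.of_convex {A : Set E} (hA : Convex ℝ A) {n : ℕ} {v : Fin n → E}
    (h : ∀ i, v i ∈ A) : AffineIn id A n v :=
  fun _ ht => hA.sum_mem (fun i _ => ht.1 i) ht.2 fun i _ => h i

lemma tupleSupported_le_affineIn {A : Set E} (hA : Convex ℝ A) (n : ℕ) :
    tupleSupported A n ≤ Finsupp.supported (ZMod 2) (ZMod 2) {v | AffineIn id A n v} :=
  Finsupp.supported_mono fun _ hv => AffineIn.of_convex hA hv

lemma singularMap_realize (p : α → E) {A : Set E} (F : C(A, X)) (f : C(X, Y)) (n : ℕ)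
    (c : TupleChain α (n + 1)) :
    singularMap f n (realize p F n c) = realize p (f.comp F) n c := by
  refine linear_ext_single (f := singularMap f n ∘ₗ realize p F n) (g := realize p (f.comp F) n)
    (fun v => ?_) c
  rw [LinearMap.comp_apply]
  by_cases h : AffineIn p A (n + 1) v
  · rw [realize_single p F n h, realize_single p _ n h, singularMap_single, ContinuousMap.comp_assoc]
  · simp [realize, h]

/-- Realization is natural with respect to linear maps. -/
lemma realize_comp {E' : Type} [AddCommGroup E'] [Module ℝ E'] [TopologicalSpace E']
    [IsTopologicalAddGroup E'] [ContinuousSMul ℝ E'] {A : Set E} {A' : Set E'}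
    (hA : Convex ℝ A) (hA' : Convex ℝ A') (g : E →ₗ[ℝ] E') (F : C(A, X)) (F' : C(A', X))
    (hg : ∀ x (hx : x ∈ A), ∃ hx' : g x ∈ A', F ⟨x, hx⟩ = F' ⟨g x, hx'⟩) (n : ℕ)
    {c : TupleChain E (n + 1)} (hc : c ∈ tupleSupported A (n + 1)) :
    realize id F n c = realize id F' n (tupleMap g (n + 1) c) := by
  have := map_mem_of_supported (realize id F n +
    realize id F' n ∘ₗ tupleMap g (n + 1)) ⊥ (fun v hv => ?_) hc
  · exact eq_of_add_eq_zero_modTwo this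
  · simp only [LinearMap.add_apply, LinearMap.comp_apply, Submodule.mem_bot]
    have h1 := AffineIn.of_convex hA hv
    have h2 : AffineIn id A' (n + 1) (g ∘ v) :=
      AffineIn.of_convex hA' fun i => (hg _ (hv i)).choose
    rw [tupleMap_single, realize_single _ _ _ h1, realize_single _ _ _ h2]
    have : F.comp (affineSimplex id h1) = F'.comp (affineSimplex id h2) := by
      ext t
      obtain ⟨hx', e⟩ := hg _ (affineSimplex id h1 t).2
      refine e.trans ?_
      simp only [ContinuousMap.comp_apply]
      congr 1
      apply Subtype.ext
      simp [affineSimplex]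
    rw [this, ZModModule.add_self]

/-- The tuple of vertices of the standard simplex. -/
def standardTuple (n : ℕ) : Fin (n + 1) → (Fin (n + 1) → ℝ) := fun i => Pi.single i 1

lemma standardTuple_mem (n : ℕ) (i : Fin (n + 1)) :
    standardTuple n i ∈ stdSimplex ℝ (Fin (n + 1)) := single_mem_stdSimplex ℝ i

/-- The linear extension of the inclusion of a face of the standard simplex. -/
noncomputable def faceLinear (n : ℕ) (i : Fin (n + 2)) :
    (Fin (n + 1) → ℝ) →ₗ[ℝ] (Fin (n + 2) → ℝ) :=
  FunOnFinite.linearMap ℝ ℝ i.succAbove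

lemma faceLinear_standardTuple (n : ℕ) (i : Fin (n + 2)) :
    faceLinear n i ∘ standardTuple n = standardTuple (n + 1) ∘ i.succAbove := by
  ext1 j
  exact congr_arg Subtype.val (stdSimplex.map_vertex (S := ℝ) i.succAbove j)

lemma sum_smul_standardTuple (n : ℕ) (t : Fin (n + 1) → ℝ) :
    ∑ i, t i • standardTuple n i = t := by
  ext j
  simp [standardTuple, Finset.sum_apply, Pi.single_apply]

lemma realize_face (n m : ℕ) (i : Fin (n + 2)) (σ : C(stdSimplex ℝ (Fin (n + 2)), X))
    {c : TupleChain (Fin (n + 1) → ℝ) (m + 1)}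
    (hc : c ∈ tupleSupported (stdSimplex ℝ (Fin (n + 1))) (m + 1)) :
    realize id (σ.comp (simplexFace n i)) m c =
      realize id σ m (tupleMap (faceLinear n i) (m + 1) c) :=
  realize_comp (convex_stdSimplex ℝ _) (convex_stdSimplex ℝ _) _ _ _
    (fun x hx => ⟨(simplexFace n i ⟨x, hx⟩).2, rfl⟩) m hc

end Realization

/-! ### Barycentric subdivision of singular chains -/

section SingularSubdivision

variable {X Y : Type} [TopologicalSpace X] [TopologicalSpace Y]

/-- The iterated barycentric subdivision of singular chains. -/
noncomputable def singularSubdivision (k n : ℕ) : SingularChain X n →ₗ[ZMod 2] SingularChain X n :=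
  Finsupp.lsum (ZMod 2) fun σ => LinearMap.toSpanSingleton (ZMod 2) _
    (realize id σ n (tupleSubdivisionIter k (n + 1) (Finsupp.single (standardTuple n) 1)))

/-- The homotopy between the identity and the iterated barycentric subdivision. -/
noncomputable def singularSubdivisionHomotopy (k n : ℕ) :
    SingularChain X n →ₗ[ZMod 2] SingularChain X (n + 1) :=
  Finsupp.lsum (ZMod 2) fun σ => LinearMap.toSpanSingleton (ZMod 2) _
    (realize id σ (n + 1) (subdivisionHomotopy k (n + 1) (Finsupp.single (standardTuple n) 1)))

lemma singularSubdivision_single (k n : ℕ) (σ : C(stdSimplex ℝ (Fin (n + 1)), X)) :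
    singularSubdivision k n (Finsupp.single σ 1) =
      realize id σ n (tupleSubdivisionIter k (n + 1) (Finsupp.single (standardTuple n) 1)) := by
  simp [singularSubdivision]

lemma singularSubdivisionHomotopy_single (k n : ℕ) (σ : C(stdSimplex ℝ (Fin (n + 1)), X)) :
    singularSubdivisionHomotopy k n (Finsupp.single σ 1) =
      realize id σ (n + 1)
        (subdivisionHomotopy k (n + 1) (Finsupp.single (standardTuple n) 1)) := by
  simp [singularSubdivisionHomotopy]

lemma standardSubdivision_mem (k n : ℕ) :
    tupleSubdivisionIter k (n + 1) (Finsupp.single (standardTuple n) 1) ∈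
      tupleSupported (stdSimplex ℝ (Fin (n + 1))) (n + 1) :=
  tupleSubdivisionIter_mem (convex_stdSimplex ℝ _) k
    (single_mem_tupleSupported (standardTuple_mem n) _)

lemma standardSubdivisionHomotopy_mem (k n : ℕ) :
    subdivisionHomotopy k (n + 1) (Finsupp.single (standardTuple n) 1) ∈
      tupleSupported (stdSimplex ℝ (Fin (n + 1))) (n + 2) :=
  subdivisionHomotopy_mem (convex_stdSimplex ℝ _) k _ _ (standardTuple_mem n)

/-- Subdivision is defined on the universal simplex and pushed forward by `σ`. Faces are compatible
because a face inclusion extends to a linear map, under which subdivision of tuples is natural. -/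
lemma singularSubdivision_boundary (k n : ℕ) (c : SingularChain X (n + 1)) :
    singularBoundary n (singularSubdivision k (n + 1) c) =
      singularSubdivision k n (singularBoundary n c) := by
  refine linear_ext_single (f := singularBoundary n ∘ₗ singularSubdivision k (n + 1))
    (g := singularSubdivision k n ∘ₗ singularBoundary n) (fun σ => ?_) c
  simp only [LinearMap.comp_apply]
  rw [singularSubdivision_single, realize_boundary id σ n (tupleSupported_le_affineIn
    (convex_stdSimplex ℝ _) _ (standardSubdivision_mem k (n + 1))), tupleSubdivisionIter_boundary,
    tupleBoundary_single, singularBoundary_single, map_sum, map_sum, map_sum]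
  refine Finset.sum_congr rfl fun i _ => ?_
  rw [singularSubdivision_single, realize_face _ _ _ _ (standardSubdivision_mem k n),
    tupleSubdivisionIter_natural, tupleMap_single, faceLinear_standardTuple]

lemma singularSubdivision_map (f : C(X, Y)) (k n : ℕ) (c : SingularChain X n) :
    singularMap f n (singularSubdivision k n c) = singularSubdivision k n (singularMap f n c) := by
  refine linear_ext_single (f := singularMap f n ∘ₗ singularSubdivision k n)
    (g := singularSubdivision k n ∘ₗ singularMap f n) (fun σ => ?_) c
  simp only [LinearMap.comp_apply]
  rw [singularSubdivision_single, singularMap_realize, singularMap_single,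
    singularSubdivision_single]

/-- The cycle condition, which is void in degree zero. -/
def IsSingularCycle : ∀ n : ℕ, SingularChain X n → Prop
  | 0, _ => True
  | n + 1, c => singularBoundary n c = 0

lemma realize_standardTuple (n : ℕ) (σ : C(stdSimplex ℝ (Fin (n + 1)), X)) :
    realize id σ n (Finsupp.single (standardTuple n) 1) = Finsupp.single σ 1 := by
  rw [realize_single _ _ _ (AffineIn.of_convex (convex_stdSimplex ℝ _) (standardTuple_mem n))]
  congr 1
  ext t
  simp only [ContinuousMap.comp_apply]
  congr 1
  exact Subtype.ext (sum_smul_standardTuple n t)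

lemma singularSubdivisionHomotopy_zero (k : ℕ) (c : SingularChain X 0) :
    singularBoundary 0 (singularSubdivisionHomotopy k 0 c) = c + singularSubdivision k 0 c := by
  refine linear_ext_single (f := singularBoundary 0 ∘ₗ singularSubdivisionHomotopy k 0)
    (g := LinearMap.id + singularSubdivision k 0) (fun σ => ?_) c
  simp only [LinearMap.comp_apply, LinearMap.add_apply, LinearMap.id_apply]
  rw [singularSubdivisionHomotopy_single, realize_boundary id σ 0 (tupleSupported_le_affineIn
    (convex_stdSimplex ℝ _) _ (standardSubdivisionHomotopy_mem k 0))]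
  have := subdivisionHomotopy_spec k 0 (Finsupp.single (standardTuple 0) 1)
  rw [show subdivisionHomotopy k 0 = (0 : TupleChain (Fin (0 + 1) → ℝ) 0 →ₗ[ZMod 2] _) from rfl,
    LinearMap.zero_apply, add_zero] at this
  rw [this, map_add, realize_standardTuple, singularSubdivision_single]

lemma singularSubdivisionHomotopy_succ (k n : ℕ) (c : SingularChain X (n + 1)) :
    singularBoundary (n + 1) (singularSubdivisionHomotopy k (n + 1) c) +
      singularSubdivisionHomotopy k n (singularBoundary n c) =
        c + singularSubdivision k (n + 1) c := by
  refine linear_ext_single (f := singularBoundary (n + 1) ∘ₗ singularSubdivisionHomotopy k (n + 1)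
      + singularSubdivisionHomotopy k n ∘ₗ singularBoundary n)
    (g := LinearMap.id + singularSubdivision k (n + 1)) (fun σ => ?_) c
  simp only [LinearMap.comp_apply, LinearMap.add_apply, LinearMap.id_apply]
  have := subdivisionHomotopy_spec k (n + 1) (Finsupp.single (standardTuple (n + 1)) 1)
  rw [singularSubdivisionHomotopy_single, realize_boundary id σ _ (tupleSupported_le_affineIn
    (convex_stdSimplex ℝ _) _ (standardSubdivisionHomotopy_mem k (n + 1))),
    singularSubdivision_single]
  nth_rewrite 2 [← realize_standardTuple (n + 1) σ]
  rw [← map_add, ← this, map_add]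
  congr 1
  rw [tupleBoundary_single, singularBoundary_single, map_sum, map_sum, map_sum]
  refine Finset.sum_congr rfl fun i _ => ?_
  rw [singularSubdivisionHomotopy_single,
    realize_face _ _ _ _ (standardSubdivisionHomotopy_mem k n),
    subdivisionHomotopy_natural, tupleMap_single, faceLinear_standardTuple]

/-- A cycle is homologous to its iterated barycentric subdivision. -/
lemma exists_boundary_eq_subdivision (k : ℕ) {n : ℕ} {c : SingularChain X n}
    (hc : IsSingularCycle n c) :
    ∃ u, singularBoundary n u = c + singularSubdivision k n c := by
  refine ⟨singularSubdivisionHomotopy k n c, ?_⟩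
  cases n with
  | zero => exact singularSubdivisionHomotopy_zero k c
  | succ n =>
    have := singularSubdivisionHomotopy_succ k n c
    rwa [show singularBoundary n c = 0 from hc, map_zero, add_zero] at this

lemma singularSubdivision_isCycle (k : ℕ) {n : ℕ} {c : SingularChain X n}
    (hc : IsSingularCycle n c) : IsSingularCycle n (singularSubdivision k n c) := by
  cases n with
  | zero => trivial
  | succ n =>
    change singularBoundary n _ = 0
    rw [singularSubdivision_boundary, show singularBoundary n c = 0 from hc, map_zero]

/-- Subdivided pieces stay in the image of `σ`, so pointwise lower bounds on coordinates known for
`σ` carry over to them. -/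
lemma realize_range {n m : ℕ} (σ : C(stdSimplex ℝ (Fin (n + 1)), X))
    (c : TupleChain (Fin (n + 1) → ℝ) (m + 1)) :
    realize id σ m c ∈ Finsupp.supported (ZMod 2) (ZMod 2)
      {τ : C(stdSimplex ℝ (Fin (m + 1)), X) | Set.range τ ⊆ Set.range σ} := by
  refine map_mem_of_supported (realize id σ m) _ (s := Set.univ) (fun v _ => ?_) (by simp)
  by_cases h : AffineIn id (stdSimplex ℝ (Fin (n + 1))) (m + 1) v
  · rw [realize_single _ _ _ h]
    refine Finsupp.single_mem_supported _ _ ?_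
    rintro _ ⟨t, rfl⟩
    exact ⟨_, rfl⟩
  · simp [realize, h]

/-- Sufficiently fine subdivisions of a singular simplex consist of small simplices. -/
lemma eventually_subdivision_small {X : Type} [MetricSpace X] {n : ℕ}
    (σ : C(stdSimplex ℝ (Fin (n + 1)), X)) {ε : ℝ} (hε : 0 < ε) :
    ∀ᶠ k in Filter.atTop, singularSubdivision k n (Finsupp.single σ 1) ∈
      Finsupp.supported (ZMod 2) (ZMod 2)
        {τ : C(stdSimplex ℝ (Fin (n + 1)), X) | ∀ s t, dist (τ s) (τ t) < ε} := by
  have hu := CompactSpace.uniformContinuous_of_continuous σ.continuous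
  obtain ⟨δ, hδ, hσ⟩ := Metric.uniformContinuous_iff.1 hu ε hε
  -- The vertices of the standard simplex have mutual sup-distance at most 1. The mesh bound is not
  -- strict, hence `δ / 2`.
  obtain ⟨k₀, hk⟩ := exists_subdivisionIter_mesh (E := Fin (n + 1) → ℝ) n (r := 1) zero_le_one
    (half_pos hδ)
  filter_upwards [Filter.eventually_ge_atTop k₀] with k hkk
  have h1 := hk k hkk (Finsupp.single (standardTuple n) 1) (by
    refine Finsupp.single_mem_supported _ _ fun i j => ?_
    rw [dist_pi_le_iff zero_le_one]
    intro l
    rw [standardTuple, standardTuple, Pi.single_apply, Pi.single_apply]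
    split_ifs <;> simp)
  have h2 := Finsupp.supported_inter (M := ZMod 2) (R := ZMod 2)
    {v : Fin (n + 1) → (Fin (n + 1) → ℝ) | ∀ i j, dist (v i) (v j) ≤ δ / 2}
    {v | ∀ i, v i ∈ stdSimplex ℝ (Fin (n + 1))} ▸ Submodule.mem_inf.2 
      ⟨h1, standardSubdivision_mem k n⟩
  rw [singularSubdivision_single]
  refine map_mem_of_supported _ _ (fun v hv => ?_) h2
  have h := AffineIn.of_convex (convex_stdSimplex ℝ _) hv.2
  rw [realize_single _ _ _ h]
  refine Finsupp.single_mem_supported _ _ fun s t => hσ ?_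
  have key : ∀ (s : stdSimplex ℝ (Fin (n + 1))) (b : Fin (n + 1) → ℝ),
      (∀ i, dist (v i) b ≤ δ / 2) → dist (∑ i, s i • v i) b ≤ δ / 2 := fun s b hb =>
    (convex_closedBall b (δ / 2)).sum_mem (fun i _ => s.2.1 i) s.2.2
      fun i _ => Metric.mem_closedBall.2 (hb i)
  have : dist (∑ i, s i • v i) (∑ i, t i • v i) ≤ δ / 2 := by
    refine key s _ fun i => ?_
    rw [dist_comm]
    exact key t _ fun j => hv.1 j i
  exact lt_of_le_of_lt this (half_lt_self hδ)

end SingularSubdivision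

/-! ### Detecting tightness of a complex by simplicial chains -/

section Prism

set_option linter.unusedSectionVars false

variable {E F : Type} [AddCommGroup E] [Module ℝ E] [AddCommGroup F] [Module ℝ F]

/-- The prism operator on ordered chains. -/
noncomputable def prism (n : ℕ) : TupleChain E n →ₗ[ZMod 2] TupleChain (E × ℝ) (n + 1) :=
  tupleHomotopy (tupleMap fun x => (x, (0 : ℝ))) (tupleMap fun x => (x, (1 : ℝ)))
    (fun _ v => (v 0, 0)) n

lemma prism_spec (n : ℕ) (c : TupleChain E (n + 1)) :
    tupleBoundary (n + 1) (prism (n + 1) c) + prism n (tupleBoundary n c) =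
      tupleMap (fun x => (x, (0 : ℝ))) (n + 1) c + tupleMap (fun x => (x, (1 : ℝ))) (n + 1) c := by
  refine tupleHomotopy_spec _ (fun n c => (tupleMap_boundary _ n c).symm)
    (fun n c => (tupleMap_boundary _ n c).symm) ?_ n c
  refine LinearMap.ext fun c => linear_ext_single (fun v => ?_) c
  rw [tupleMap_single, tupleMap_single]
  congr 1
  exact Subsingleton.elim _ _

lemma prism_natural (g : E →ₗ[ℝ] F) (n : ℕ) (c : TupleChain E n) :
    tupleMap (g.prodMap (LinearMap.id : ℝ →ₗ[ℝ] ℝ)) (n + 1) (prism n c) =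
      prism n (tupleMap g n c) := by
  refine tupleHomotopy_natural g _ (fun n c => ?_) (fun n c => ?_) (fun n v => ?_) n c
  · exact linear_ext_single (f := tupleMap _ n ∘ₗ tupleMap _ n)
      (g := tupleMap _ n ∘ₗ tupleMap g n) (fun v => by
        simp only [LinearMap.comp_apply, tupleMap_single]
        congr 1) c
  · exact linear_ext_single (f := tupleMap _ n ∘ₗ tupleMap _ n)
      (g := tupleMap _ n ∘ₗ tupleMap g n) (fun v => by
        simp only [LinearMap.comp_apply, tupleMap_single]
        congr 1) c
  · simp

lemma prism_mem {S : Set E} (n : ℕ) (v : Fin n → E) (hv : ∀ i, v i ∈ S) :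
    prism n (Finsupp.single v 1) ∈ tupleSupported (S ×ˢ Set.Icc (0 : ℝ) 1) (n + 1) := by
  refine tupleHomotopy_mem (S := S) (T := S ×ˢ Set.Icc (0 : ℝ) 1) (fun n w hw => ?_)
    (fun n w hw => ?_)
    (fun n w hw => Set.mk_mem_prod (hw 0) (by simp)) n v hv
  · rw [tupleMap_single]
    exact single_mem_tupleSupported (fun i => Set.mk_mem_prod (hw i) (by simp)) _
  · rw [tupleMap_single]
    exact single_mem_tupleSupported (fun i => Set.mk_mem_prod (hw i) (by simp)) _

end Prism

/-! ### Deforming small singular simplices to affine simplices on nearby vertices -/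

section Vertices

set_option linter.unusedSectionVars false

variable {V : Type} [Fintype V] [DecidableEq V]

/-- The ordered chain of the vertices of a singular chain, where `φ` chooses for each point a
nearby vertex. -/
noncomputable def vertexChain (φ : (V → ℝ) → V) (A : Set (V → ℝ)) (n : ℕ) :
    SingularChain A n →ₗ[ZMod 2] TupleChain V (n + 1) :=
  Finsupp.lmapDomain (ZMod 2) (ZMod 2) fun σ i => φ (σ (stdSimplex.vertex i))

lemma vertexChain_single (φ : (V → ℝ) → V) {A : Set (V → ℝ)} (n : ℕ)
    (σ : C(stdSimplex ℝ (Fin (n + 1)), A)) (a : ZMod 2) :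
    vertexChain φ A n (Finsupp.single σ a) =
      Finsupp.single (fun i => φ (σ (stdSimplex.vertex i))) a := by
  simp [vertexChain, Finsupp.mapDomain_single]

lemma vertexChain_boundary (φ : (V → ℝ) → V) {A : Set (V → ℝ)} (n : ℕ)
    (c : SingularChain A (n + 1)) :
    tupleBoundary (n + 1) (vertexChain φ A (n + 1) c) = vertexChain φ A n (singularBoundary n c) := by
  refine linear_ext_single (f := tupleBoundary (n + 1) ∘ₗ vertexChain φ A (n + 1))
    (g := vertexChain φ A n ∘ₗ singularBoundary n) (fun σ => ?_) c
  simp only [LinearMap.comp_apply]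
  rw [vertexChain_single, tupleBoundary_single, singularBoundary_single, map_sum]
  refine Finset.sum_congr rfl fun i _ => ?_
  rw [vertexChain_single]
  congr 1
  ext1 j
  simp only [Function.comp_apply, ContinuousMap.comp_apply]
  have : simplexFace n i (stdSimplex.vertex j) = stdSimplex.vertex (i.succAbove j) :=
    stdSimplex.map_vertex _ _
  rw [this]

lemma vertexChain_map (φ : (V → ℝ) → V) {A X : Set (V → ℝ)} (h : A ⊆ X) (n : ℕ)
    (c : SingularChain A n) :
    vertexChain φ X n (singularMap ⟨Set.inclusion h, continuous_inclusion h⟩ n c) =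
      vertexChain φ A n c := by
  refine linear_ext_single (f := vertexChain φ X n ∘ₗ singularMap _ n)
    (g := vertexChain φ A n) (fun σ => ?_) c
  simp only [LinearMap.comp_apply]
  rw [singularMap_single, vertexChain_single, vertexChain_single]
  rfl

/-- The point of the standard simplex which is a vertex. -/
def vertexPoint (v : V) : V → ℝ := Pi.single v 1

/-- The chosen vertices of `σ` belong to the supports of all points of `σ`, and the straight
segments from the points of `σ` to the affine simplex spanned by these vertices lie in `A`. -/
def VertexAdmissible (φ : (V → ℝ) → V) (A : Set (V → ℝ)) {n : ℕ}
    (σ : C(stdSimplex ℝ (Fin (n + 1)), A)) : Prop :=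
  ∀ s ∈ stdSimplex ℝ (Fin (n + 1)), ∀ t, ∀ r ∈ Set.Icc (0 : ℝ) 1,
    (1 - r) • (σ t : V → ℝ) + r • ∑ i, s i • vertexPoint (φ (σ (stdSimplex.vertex i))) ∈ A

variable {φ : (V → ℝ) → V} {A : Set (V → ℝ)}

lemma VertexAdmissible.affineIn {n : ℕ} {σ : C(stdSimplex ℝ (Fin (n + 1)), A)}
    (h : VertexAdmissible φ A σ) :
    AffineIn vertexPoint A (n + 1) fun i => φ (σ (stdSimplex.vertex i)) := by
  intro t ht
  have := h t ht ⟨t, ht⟩ 1 (by simp)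
  simpa using this

lemma VertexAdmissible.face {n : ℕ} {σ : C(stdSimplex ℝ (Fin (n + 2)), A)}
    (h : VertexAdmissible φ A σ) (i : Fin (n + 2)) :
    VertexAdmissible φ A (σ.comp (simplexFace n i)) := by
  intro s hs t r hr
  have := h _ (simplexFace n i ⟨s, hs⟩).2 (simplexFace n i t) r hr
  have h2 := sum_simplexFace_smul n i ⟨s, hs⟩
    (fun j => vertexPoint (φ (σ (stdSimplex.vertex j))))
  change (1 - r) • (σ (simplexFace n i t) : V → ℝ) +
    r • ∑ j, (simplexFace n i ⟨s, hs⟩) j • vertexPoint (φ (σ (stdSimplex.vertex j))) ∈ A at this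
  rw [h2] at this
  have h3 : ∀ j, simplexFace n i (stdSimplex.vertex j) = stdSimplex.vertex (i.succAbove j) :=
    fun j => stdSimplex.map_vertex _ _
  simp only [ContinuousMap.comp_apply, h3]
  exact this

/-- The straight-line homotopy from `σ` to the affine simplex spanned by the chosen vertices. -/
noncomputable def vertexHomotopy {n : ℕ} {σ : C(stdSimplex ℝ (Fin (n + 1)), A)}
    (h : VertexAdmissible φ A σ) :
    C((stdSimplex ℝ (Fin (n + 1)) ×ˢ Set.Icc (0 : ℝ) 1 : Set ((Fin (n + 1) → ℝ) × ℝ)), A) where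
  toFun x := ⟨(1 - x.1.2) • (σ ⟨x.1.1, x.2.1⟩ : V → ℝ) +
    x.1.2 • ∑ i, x.1.1 i • vertexPoint (φ (σ (stdSimplex.vertex i))),
    h x.1.1 x.2.1 ⟨x.1.1, x.2.1⟩ x.1.2 x.2.2⟩
  continuous_toFun := by
    refine Continuous.subtype_mk ?_ _
    have h1 : Continuous fun x : (stdSimplex ℝ (Fin (n + 1)) ×ˢ Set.Icc (0 : ℝ) 1 :
        Set ((Fin (n + 1) → ℝ) × ℝ)) => (σ ⟨x.1.1, x.2.1⟩ : V → ℝ) := by fun_prop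
    fun_prop

lemma convex_prismDomain (n : ℕ) :
    Convex ℝ (stdSimplex ℝ (Fin (n + 1)) ×ˢ Set.Icc (0 : ℝ) 1 : Set ((Fin (n + 1) → ℝ) × ℝ)) :=
  (convex_stdSimplex ℝ _).prod (convex_Icc 0 1)

open Classical in
/-- The homotopy operator given by the straight-line homotopies. -/
noncomputable def vertexHomotopyChain (φ : (V → ℝ) → V) (A : Set (V → ℝ)) (n : ℕ) :
    SingularChain A n →ₗ[ZMod 2] SingularChain A (n + 1) :=
  Finsupp.lsum (ZMod 2) fun σ => LinearMap.toSpanSingleton (ZMod 2) _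
    (if h : VertexAdmissible φ A σ then realize id (vertexHomotopy h) (n + 1)
      (prism (n + 1) (Finsupp.single (standardTuple n) 1)) else 0)

lemma vertexHomotopyChain_single {n : ℕ} {σ : C(stdSimplex ℝ (Fin (n + 1)), A)}
    (h : VertexAdmissible φ A σ) :
    vertexHomotopyChain φ A n (Finsupp.single σ 1) = realize id (vertexHomotopy h) (n + 1)
      (prism (n + 1) (Finsupp.single (standardTuple n) 1)) := by
  simp [vertexHomotopyChain, h]

/-- The bottom of the prism gives back `σ`, the top gives the affine simplex on the chosen vertices,
and the remaining term is the lateral part over the boundary. -/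
lemma vertexHomotopyChain_boundary_single {n : ℕ} {σ : C(stdSimplex ℝ (Fin (n + 1)), A)}
    (h : VertexAdmissible φ A σ) :
    singularBoundary n (vertexHomotopyChain φ A n (Finsupp.single σ 1)) +
      realize id (vertexHomotopy h) n
        (prism n (tupleBoundary n (Finsupp.single (standardTuple n) 1))) =
      Finsupp.single σ 1 + realize vertexPoint (ContinuousMap.id A) n
        (vertexChain φ A n (Finsupp.single σ 1)) := by
  rw [vertexHomotopyChain_single h, realize_boundary id _ n (tupleSupported_le_affineIn
    (convex_prismDomain n) _ (prism_mem _ _ (standardTuple_mem n))), ← map_add, prism_spec,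
    map_add, tupleMap_single, tupleMap_single, vertexChain_single, realize_single _ _ _ h.affineIn,
    realize_single _ _ _ (AffineIn.of_convex (convex_prismDomain n)
      fun i => ⟨standardTuple_mem n i, by simp⟩),
    realize_single _ _ _ (AffineIn.of_convex (convex_prismDomain n)
      fun i => ⟨standardTuple_mem n i, by simp⟩)]
  have e1 : ∀ (t : stdSimplex ℝ (Fin (n + 1))) (r : ℝ),
      ∑ i, t i • (standardTuple n i, r) = ((t : Fin (n + 1) → ℝ), r) := by
    intro t r
    refine Prod.ext ?_ ?_
    · rw [Prod.fst_sum]; exact sum_smul_standardTuple n t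
    · rw [Prod.snd_sum]
      simp [← Finset.sum_mul]
  congr 2
  · refine ContinuousMap.ext fun t => Subtype.ext ?_
    have : affineSimplex id (AffineIn.of_convex (convex_prismDomain n)
      (v := (fun x => (x, (0 : ℝ))) ∘ standardTuple n)
      fun i => ⟨standardTuple_mem n i, by simp⟩) t = ⟨(t, 0), t.2, by simp⟩ :=
      Subtype.ext (e1 t 0)
    rw [ContinuousMap.comp_apply, this]
    simp [vertexHomotopy]
    rfl
  · refine ContinuousMap.ext fun t => Subtype.ext ?_
    have : affineSimplex id (AffineIn.of_convex (convex_prismDomain n)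
      (v := (fun x => (x, (1 : ℝ))) ∘ standardTuple n)
      fun i => ⟨standardTuple_mem n i, by simp⟩) t = ⟨(t, 1), t.2, by simp⟩ :=
      Subtype.ext (e1 t 1)
    rw [ContinuousMap.comp_apply, this]
    simp [vertexHomotopy, affineSimplex]

/-- The vertex chosen for a corner depends only on the point there, so the straight-line homotopy of
`σ` restricts on each face to the homotopy of that face. -/
lemma vertexHomotopyChain_face {n : ℕ} {σ : C(stdSimplex ℝ (Fin (n + 2)), A)}
    (h : VertexAdmissible φ A σ) :
    realize id (vertexHomotopy h) (n + 1)
        (prism (n + 1) (tupleBoundary (n + 1) (Finsupp.single (standardTuple (n + 1)) 1))) =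
      vertexHomotopyChain φ A n (singularBoundary n (Finsupp.single σ 1)) := by
  rw [tupleBoundary_single, singularBoundary_single, map_sum, map_sum, map_sum]
  refine Finset.sum_congr rfl fun i _ => ?_
  rw [vertexHomotopyChain_single (h.face i), ← faceLinear_standardTuple, ← tupleMap_single,
    ← prism_natural]
  refine (realize_comp (convex_prismDomain n) (convex_prismDomain (n + 1)) _ _ _
    (fun x hx => ?_) _ (prism_mem _ _ (standardTuple_mem n))).symm
  refine ⟨⟨(simplexFace n i ⟨x.1, hx.1⟩).2, hx.2⟩, Subtype.ext ?_⟩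
  have h2 := sum_simplexFace_smul n i ⟨x.1, hx.1⟩
    (fun j => vertexPoint (φ (σ (stdSimplex.vertex j))))
  have h3 : ∀ j, simplexFace n i (stdSimplex.vertex j) = stdSimplex.vertex (i.succAbove j) :=
    fun j => stdSimplex.map_vertex _ _
  change (1 - x.2) • (σ (simplexFace n i ⟨x.1, hx.1⟩) : V → ℝ) +
      x.2 • ∑ j, x.1 j • vertexPoint (φ (σ (simplexFace n i (stdSimplex.vertex j)))) =
    (1 - x.2) • (σ (simplexFace n i ⟨x.1, hx.1⟩) : V → ℝ) +
      x.2 • ∑ j, (simplexFace n i ⟨x.1, hx.1⟩) j • vertexPoint (φ (σ (stdSimplex.vertex j)))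
  rw [h2]
  simp only [h3]
  rfl

/-- A cycle of admissible singular simplices is homologous to the cycle of affine simplices
spanned by the chosen vertices. -/
lemma exists_boundary_eq_vertexChain {n : ℕ} {c : SingularChain A n}
    (hc : c ∈ Finsupp.supported (ZMod 2) (ZMod 2) {σ | VertexAdmissible φ A σ})
    (hcyc : IsSingularCycle n c) :
    ∃ u, singularBoundary n u =
      c + realize vertexPoint (ContinuousMap.id A) n (vertexChain φ A n c) := by
  refine ⟨vertexHomotopyChain φ A n c, ?_⟩
  cases n with
  | zero =>
    refine eq_of_add_eq_zero_modTwo (map_mem_of_supported (singularBoundary 0 ∘ₗ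
      vertexHomotopyChain φ A 0 + (LinearMap.id + realize vertexPoint (ContinuousMap.id A) 0 ∘ₗ
        vertexChain φ A 0)) ⊥ (fun σ hσ => ?_) hc)
    have := vertexHomotopyChain_boundary_single hσ
    rw [show prism 0 = (0 : TupleChain (Fin (0 + 1) → ℝ) 0 →ₗ[ZMod 2] _) from rfl,
      LinearMap.zero_apply, map_zero, add_zero] at this
    simp only [LinearMap.add_apply, LinearMap.comp_apply, Submodule.mem_bot, LinearMap.id_apply]
    rw [this, ZModModule.add_self]
  | succ n =>
    have h := eq_of_add_eq_zero_modTwo (map_mem_of_supported ((singularBoundary (n + 1) ∘ₗ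
      vertexHomotopyChain φ A (n + 1) + vertexHomotopyChain φ A n ∘ₗ singularBoundary n) +
      (LinearMap.id + realize vertexPoint (ContinuousMap.id A) (n + 1) ∘ₗ
        vertexChain φ A (n + 1))) ⊥ (fun σ hσ => by
          have := vertexHomotopyChain_boundary_single hσ
          rw [vertexHomotopyChain_face] at this
          simp only [LinearMap.add_apply, LinearMap.comp_apply, Submodule.mem_bot,
            LinearMap.id_apply]
          rw [this, ZModModule.add_self]) hc)
    simp only [LinearMap.add_apply, LinearMap.comp_apply, LinearMap.id_apply] at h
    rwa [show singularBoundary n c = 0 from hcyc, map_zero, add_zero] at h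

end Vertices

/-! ### Tightness from the simplicial filling criterion -/

section Detection

set_option linter.unusedSectionVars false

variable {V : Type} [Fintype V] [DecidableEq V]

/-- The empty set, or a face of `K`. -/
def IsFaceOrEmpty (K : PreAbstractSimplicialComplex V) (S : Finset V) : Prop :=
  S = ∅ ∨ S ∈ K.faces

lemma IsFaceOrEmpty.mono {K : PreAbstractSimplicialComplex V} {S T : Finset V} (h : S ⊆ T)
    (hT : IsFaceOrEmpty K T) : IsFaceOrEmpty K S := by
  rcases S.eq_empty_or_nonempty with rfl | hS
  · exact Or.inl rfl
  · rcases hT with rfl | hT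
    · exact Or.inl (Finset.subset_empty.1 h)
    · exact Or.inr ((K.isRelLowerSet_faces hT).2 h hS)

lemma vertexPoint_mem {K : PreAbstractSimplicialComplex V} {W : Finset V} {H : Set (V → ℝ)}
    (hH : Convex ℝ H) (hW : ∀ v ∈ W, vertexPoint v ∈ H) {n : ℕ} {v : Fin (n + 1) → V}
    (hv : Finset.univ.image v ⊆ W ∧ IsFaceOrEmpty K (Finset.univ.image v)) :
    AffineIn vertexPoint (polyhedron K ∩ H) (n + 1) v := by
  have hf : Finset.univ.image v ∈ K.faces := by
    refine hv.2.resolve_left fun h => ?_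
    exact Finset.univ_nonempty.ne_empty (Finset.image_eq_empty.1 h)
  intro t ht
  refine ⟨⟨(convex_stdSimplex ℝ V).sum_mem (fun i _ => ht.1 i) ht.2
    fun i _ => single_mem_stdSimplex ℝ _, _, hf, fun u hu => ?_⟩,
    hH.sum_mem (fun i _ => ht.1 i) ht.2 fun i _ =>
      hW _ (hv.1 (Finset.mem_image_of_mem v (Finset.mem_univ i)))⟩
  rw [Finset.sum_apply]
  refine Finset.sum_eq_zero fun i _ => ?_
  have : u ≠ v i := by
    rintro rfl
    exact hu (Finset.mem_image_of_mem v (Finset.mem_univ i))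
  simp [vertexPoint, this]

/-- The set of chosen vertices of `σ` spans a face if these vertices lie in the support of all
points of `σ`. -/
lemma image_mem_faces {K : PreAbstractSimplicialComplex V} {n : ℕ} {x : V → ℝ}
    (hx : x ∈ polyhedron K) {v : Fin n → V} (h : ∀ i, 0 < x (v i)) :
    IsFaceOrEmpty K (Finset.univ.image v) := by
  obtain ⟨-, s, hs, h0⟩ := hx
  refine IsFaceOrEmpty.mono ?_ (Or.inr hs)
  intro u hu
  obtain ⟨i, -, rfl⟩ := Finset.mem_image.1 hu
  by_contra hc
  exact (h i).ne' (h0 _ hc)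

/-- The chosen vertices have positive coordinates at `σ t`, so they belong to any face carrying `σ
t`, and the segments stay in that face. Convexity of `H` keeps them in `H`. -/
lemma vertexAdmissible_of_pos {K : PreAbstractSimplicialComplex V} {H : Set (V → ℝ)}
    (hH : Convex ℝ H) {φ : (V → ℝ) → V} {n : ℕ}
    {σ : C(stdSimplex ℝ (Fin (n + 1)), (polyhedron K ∩ H : Set (V → ℝ)))}
    (hφ : ∀ i, vertexPoint (φ (σ (stdSimplex.vertex i))) ∈ H)
    (hpos : ∀ i t, 0 < (σ t : V → ℝ) (φ (σ (stdSimplex.vertex i)))) :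
    VertexAdmissible φ (polyhedron K ∩ H) σ := by
  intro s hs t r hr
  have h1 : ∑ i, s i • vertexPoint (φ (σ (stdSimplex.vertex i))) ∈ stdSimplex ℝ V :=
    (convex_stdSimplex ℝ V).sum_mem (fun i _ => hs.1 i) hs.2 fun i _ => single_mem_stdSimplex ℝ _
  have h2 : ∑ i, s i • vertexPoint (φ (σ (stdSimplex.vertex i))) ∈ H :=
    hH.sum_mem (fun i _ => hs.1 i) hs.2 fun i _ => hφ i
  obtain ⟨⟨h3, S, hS, h0⟩, h4⟩ := (σ t).2
  have hr' : 0 ≤ 1 - r := by linarith [hr.2]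
  refine ⟨⟨(convex_stdSimplex ℝ V) h3 h1 hr' hr.1 (by ring), S, hS, fun u hu => ?_⟩,
    hH h4 h2 hr' hr.1 (by ring)⟩
  rw [Pi.add_apply, Pi.smul_apply, Pi.smul_apply, h0 u hu, smul_zero, zero_add, Finset.sum_apply,
    Finset.sum_eq_zero, smul_zero]
  intro i _
  have : u ≠ φ (σ (stdSimplex.vertex i)) := by
    rintro rfl
    exact (hpos i t).ne' (h0 _ hu)
  simp [vertexPoint, this]

/-- Each point of a polyhedron in `H` has a vertex of `H` in its support. -/
lemma exists_pos_of_mem {x : V → ℝ} {H : Set (V → ℝ)} (hHc : Convex ℝ Hᶜ)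
    (hx : x ∈ stdSimplex ℝ V) (hxH : x ∈ H) : ∃ v, vertexPoint v ∈ H ∧ 0 < x v := by
  classical
  by_contra! hc
  have hs : ∑ v, x v • vertexPoint v = x := by
    ext u
    simp [vertexPoint, Finset.sum_apply, Pi.single_apply]
  have hz : ∀ v, vertexPoint v ∈ H → x v = 0 := fun v hv => le_antisymm (hc v hv) (hx.1 v)
  have h1 : ∑ v with vertexPoint v ∉ H, x v • vertexPoint v ∈ Hᶜ := by
    refine hHc.sum_mem (fun i _ => hx.1 i) ?_ fun i hi => (Finset.mem_filter.1 hi).2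
    rw [← hx.2]
    refine Finset.sum_subset (Finset.subset_univ _) fun v _ hv => hz v ?_
    simpa using hv
  refine h1 ?_
  rw [Finset.sum_subset (Finset.subset_univ _), hs]
  · exact hxH
  · intro v _ hv
    rw [hz v (by simpa using hv), zero_smul]

/-- The simplicial criterion for the injectivity in homology of the inclusion of the part of a
polyhedron in a half-space. -/
def SimplicialInjective (K : PreAbstractSimplicialComplex V) : Prop :=
  ∀ W : Finset V, W.Nonempty → ∀ (n : ℕ), ∀ z w : Finset V → ZMod 2,
    z ∈ faceSupported (fun S => (S ⊆ W ∧ IsFaceOrEmpty K S) ∧ S.card = n + 1) →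
    w ∈ faceSupported (fun S => IsFaceOrEmpty K S ∧ S.card = n + 2) → faceBoundary w = z →
    ∃ u ∈ faceSupported (fun S => S ⊆ W ∧ IsFaceOrEmpty K S), faceBoundary u = z

lemma singularMap_injective {A X : Set (V → ℝ)} (h : A ⊆ X) (n : ℕ) :
    Function.Injective (singularMap ⟨Set.inclusion h, continuous_inclusion h⟩ n) := by
  refine Finsupp.mapDomain_injective fun σ τ e => ?_
  refine ContinuousMap.ext fun t => Set.inclusion_injective h ?_
  exact congr($e t)

/-- By compactness the total weight on `W` has a positive minimum along `σ`, and some coordinate in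
`W` is at least the average. -/
lemma exists_fine {A : Set (V → ℝ)} {W : Finset V} {n : ℕ}
    (σ : C(stdSimplex ℝ (Fin (n + 1)), A)) (hA : ∀ x ∈ A, ∃ v ∈ W, 0 < x v)
    (hA' : A ⊆ stdSimplex ℝ V) :
    ∀ᶠ ε in nhdsWithin (0 : ℝ) (Set.Ioi 0), ∀ t, ∃ v ∈ W, ε ≤ (σ t : V → ℝ) v := by
  obtain ⟨t₀, -, ht₀⟩ := isCompact_univ.exists_isMinOn (Set.univ_nonempty)
    (f := fun t => ∑ v ∈ W, (σ t : V → ℝ) v) (by fun_prop)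
  set m := ∑ v ∈ W, (σ t₀ : V → ℝ) v with hm
  have hmpos : 0 < m := by
    obtain ⟨v, hv, hp⟩ := hA _ (σ t₀).2
    exact Finset.sum_pos' (fun i _ => (hA' (σ t₀).2).1 i) ⟨v, hv, hp⟩
  have hW : W.Nonempty := by
    obtain ⟨v, hv, -⟩ := hA _ (σ t₀).2
    exact ⟨v, hv⟩
  have hWc : (0 : ℝ) < W.card := by exact_mod_cast hW.card_pos
  filter_upwards [Ioc_mem_nhdsGT (show 0 < m / W.card by positivity)] with ε hε t
  refine Finset.exists_le_of_sum_le hW (f := fun _ => ε) ?_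
  rw [Finset.sum_const, nsmul_eq_mul]
  have h1 : m ≤ ∑ v ∈ W, (σ t : V → ℝ) v := ht₀ (Set.mem_univ t)
  have h2 := (le_div_iff₀ hWc).1 hε.2
  linarith

lemma singularBoundary_boundary {X : Type} [TopologicalSpace X] (n : ℕ)
    (c : SingularChain X (n + 2)) : singularBoundary n (singularBoundary (n + 1) c) = 0 := by
  refine linear_ext_single (f := singularBoundary n ∘ₗ singularBoundary (n + 1))
    (g := 0) (fun σ => ?_) c
  rw [LinearMap.comp_apply, LinearMap.zero_apply, ← realize_standardTuple,
    realize_boundary id σ (n + 1) (tupleSupported_le_affineIn (convex_stdSimplex ℝ _) _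
      (single_mem_tupleSupported (standardTuple_mem _) _)), realize_boundary id σ n
        (tupleSupported_le_affineIn (convex_stdSimplex ℝ _) _ ?_), tupleBoundary_boundary, map_zero]
  rw [tupleBoundary_single]
  exact sum_mem fun i _ => single_mem_tupleSupported (fun j => standardTuple_mem _ _) _

/-- After subdivision, both `z` and `w` are replaced by chains of vertex tuples, then by simplicial
chains. The simplicial filling is lifted back to ordered chains and realized inside `A`. Of the
half-space only the convexity of `H` and of its complement is used. -/
lemma exists_boundary_of_simplicialInjective {K : PreAbstractSimplicialComplex V}
    (hK : SimplicialInjective K) {H : Set (V → ℝ)} (hHc : Convex ℝ H) (hHc' : Convex ℝ Hᶜ)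
    {X A : Set (V → ℝ)} (hX : X = polyhedron K) (hA : A = polyhedron K ∩ H) (hAX : A ⊆ X)
    (n : ℕ) (z : SingularChain A n) (w : SingularChain X (n + 1))
    (hw : singularBoundary n w =
      singularMap ⟨Set.inclusion hAX, continuous_inclusion hAX⟩ n z) :
    ∃ u, singularBoundary n u = z := by
  classical
  by_cases hz0 : z = 0
  · exact ⟨0, by simp [hz0]⟩
  set W : Finset V := Finset.univ.filter fun v => vertexPoint v ∈ H with hWdef
  have hXs : X ⊆ stdSimplex ℝ V := fun x hx => (hX ▸ hx : x ∈ polyhedron K).1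
  have hAW : ∀ x ∈ A, ∃ v ∈ W, 0 < x v := fun x hx => by
    obtain ⟨v, hv, hp⟩ := exists_pos_of_mem hHc' (hXs (hAX hx)) (hA ▸ hx).2
    exact ⟨v, by simpa [hWdef] using hv, hp⟩
  have hXW : ∀ x ∈ X, ∃ v ∈ (Finset.univ : Finset V), 0 < x v := fun x hx => by
    obtain ⟨v, -, hp⟩ := exists_pos_of_mem (H := Set.univ) (by simpa using convex_empty) (hXs hx) (by simp)
    exact ⟨v, by simp, hp⟩
  obtain ⟨σ₀, -⟩ := Finsupp.support_nonempty_iff.2 hz0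
  obtain ⟨v₀, hv₀, -⟩ := hAW _ (σ₀ (stdSimplex.vertex 0)).2
  have : Nonempty V := ⟨v₀⟩
  -- One `ε`, and then one `k`, serves all of the finitely many simplices of `z` and `w`.
  obtain ⟨ε, ⟨hε1, hε2⟩, hε⟩ := (((Filter.eventually_all_finset z.support).2 fun σ _ =>
    exists_fine σ hAW (hAX.trans hXs)).and ((Filter.eventually_all_finset w.support).2 fun σ _ =>
    exists_fine σ hXW hXs)).and self_mem_nhdsWithin |>.exists
  have hε : 0 < ε := hε
  obtain ⟨k, hk1, hk2⟩ := (((Filter.eventually_all_finset z.support).2 fun σ _ =>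
    eventually_subdivision_small σ hε).and ((Filter.eventually_all_finset w.support).2 fun σ _ =>
    eventually_subdivision_small σ hε)).exists
  -- Vertices of `W` are preferred, so the vertex chain of `z` lies in `W`. Using the same `φ` for
  -- `z` and `w` keeps the relation between them. The value `v₀` is never relevant.
  let φ : (V → ℝ) → V := fun x =>
    if h : ∃ v ∈ W, ε ≤ x v then h.choose else if h : ∃ v, ε ≤ x v then h.choose else v₀
  have hφW : ∀ x : V → ℝ, (∃ v ∈ W, ε ≤ x v) → φ x ∈ W ∧ ε ≤ x (φ x) := fun x h => by
    simp only [φ, dif_pos h]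
    exact h.choose_spec
  have hφ : ∀ x : V → ℝ, (∃ v, ε ≤ x v) → ε ≤ x (φ x) := fun x h => by
    by_cases h' : ∃ v ∈ W, ε ≤ x v
    · exact (hφW x h').2
    · simp only [φ, dif_neg h', dif_pos h]
      exact h.choose_spec
  have hsmall : ∀ x y : V → ℝ, dist x y < ε → ∀ v, ε ≤ x v → 0 < y v := fun x y hd v hv => by
    have := (dist_le_pi_dist x y v).trans_lt hd
    rw [Real.dist_eq, abs_lt] at this
    linarith [this.2]
  -- The inclusion is injective on chains, and the image of `z` is the boundary of `w`.
  have hcyc : IsSingularCycle n z := by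
    cases n with
    | zero => trivial
    | succ n =>
      refine singularMap_injective hAX n ?_
      rw [map_zero, singularMap_boundary, ← hw, singularBoundary_boundary]
  have hz' : singularSubdivision k n z ∈ Finsupp.supported (ZMod 2) (ZMod 2)
      {τ | (∀ i, φ (τ (stdSimplex.vertex i)) ∈ W) ∧
        ∀ i t, 0 < (τ t : V → ℝ) (φ (τ (stdSimplex.vertex i)))} := by
    refine map_mem_of_supported (s := (z.support : Set _)) _ _ (fun σ hσ => ?_) (fun σ hσ => hσ)
    have h1 := hk1 σ hσ
    have h2 : singularSubdivision k n (Finsupp.single σ 1) ∈ _ :=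
      singularSubdivision_single k n σ ▸ realize_range σ _
    have h3 := Submodule.mem_inf.2 ⟨h1, h2⟩
    rw [← Finsupp.supported_inter] at h3
    refine Finsupp.supported_mono ?_ h3
    rintro τ ⟨hτ1, hτ2⟩
    have hτ : ∀ t, ∃ v ∈ W, ε ≤ (τ t : V → ℝ) v := fun t => by
      obtain ⟨s, hs⟩ := hτ2 ⟨t, rfl⟩
      rw [← hs]
      exact hε1 σ hσ s
    exact ⟨fun i => (hφW _ (hτ _)).1, fun i t => hsmall _ _ (hτ1 _ _) _ (hφW _ (hτ _)).2⟩
  have hw' : singularSubdivision k (n + 1) w ∈ Finsupp.supported (ZMod 2) (ZMod 2)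
      {τ | ∀ i t, 0 < (τ t : V → ℝ) (φ (τ (stdSimplex.vertex i)))} := by
    refine map_mem_of_supported (s := (w.support : Set _)) _ _ (fun σ hσ => ?_) (fun σ hσ => hσ)
    have h1 := hk2 σ hσ
    have h2 : singularSubdivision k (n + 1) (Finsupp.single σ 1) ∈ _ :=
      singularSubdivision_single k (n + 1) σ ▸ realize_range σ _
    have h3 := Submodule.mem_inf.2 ⟨h1, h2⟩
    rw [← Finsupp.supported_inter] at h3
    refine Finsupp.supported_mono ?_ h3
    rintro τ ⟨hτ1, hτ2⟩
    have hτ : ∀ t, ∃ v, ε ≤ (τ t : V → ℝ) v := fun t => by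
      obtain ⟨s, hs⟩ := hτ2 ⟨t, rfl⟩
      rw [← hs]
      obtain ⟨v, -, hv⟩ := hε2 σ hσ s
      exact ⟨v, hv⟩
    exact fun i t => hsmall _ _ (hτ1 _ _) _ (hφ _ (hτ _))
  set z' := singularSubdivision k n z
  set w' := singularSubdivision k (n + 1) w
  set Q : Finset V → Prop := fun S => S ⊆ W ∧ IsFaceOrEmpty K S
  have hQ : ∀ S T, S ⊆ T → Q T → Q S := fun S T h hT => ⟨h.trans hT.1, hT.2.mono h⟩
  have hWH : ∀ v ∈ W, vertexPoint v ∈ H := fun v hv => by simpa [hWdef] using hv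
  have hzw : tupleBoundary (n + 1) (vertexChain φ X (n + 1) w') = vertexChain φ A n z' := by
    rw [vertexChain_boundary, singularSubdivision_boundary, hw, ← singularSubdivision_map,
      vertexChain_map]
  have hc1 : vertexChain φ A n z' ∈ tupleFaceSupported Q (n + 1) := by
    refine map_mem_of_supported _ _ (fun σ hσ => ?_) hz'
    rw [vertexChain_single]
    refine Finsupp.single_mem_supported _ _ ⟨?_, ?_⟩
    · intro v hv
      obtain ⟨i, -, rfl⟩ := Finset.mem_image.1 hv
      exact hσ.1 i
    · exact image_mem_faces (hX ▸ hAX (σ (stdSimplex.vertex 0)).2) fun i => hσ.2 i _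
  have hc2 : vertexChain φ X (n + 1) w' ∈ tupleFaceSupported (IsFaceOrEmpty K) (n + 2) := by
    refine map_mem_of_supported _ _ (fun σ hσ => ?_) hw'
    rw [vertexChain_single]
    exact Finsupp.single_mem_supported _ _
      (image_mem_faces (hX.subset (σ (stdSimplex.vertex 0)).2) fun i => hσ i _)
  obtain ⟨u, hu, hu2⟩ := hK W ⟨v₀, hv₀⟩ n _ _ (faceOfTuple_mem hQ hc1)
    (faceOfTuple_mem (fun S T h hT => hT.mono h) hc2) (by rw [← faceOfTuple_boundary, hzw])
  -- The order homotopy joins the vertex chain to the lift of its simplicial chain, which is the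
  -- boundary of the lift of `u`.
  have hb : tupleBoundary (n + 1) (orderHomotopy (n + 1) (vertexChain φ A n z') +
      tupleOfFace (n + 2) u) = vertexChain φ A n z' := by
    have h1 := orderHomotopy_spec n (vertexChain φ A n z')
    rw [← hzw, tupleBoundary_boundary, map_zero, add_zero, hzw] at h1
    rw [map_add, h1, tupleOfFace_boundary, hu2, add_assoc, ZModModule.add_self, add_zero]
  have hb2 := realize_boundary vertexPoint (ContinuousMap.id A) n
    (Finsupp.supported_mono (fun v hv => hA ▸ vertexPoint_mem hHc hWH hv)
      (add_mem (orderHomotopy_mem hQ hc1) (tupleOfFace_mem hQ (n + 2) hu)))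
  rw [hb] at hb2
  obtain ⟨u₁, hu₁⟩ := exists_boundary_eq_subdivision k hcyc
  obtain ⟨u₂, hu₂⟩ := exists_boundary_eq_vertexChain (φ := φ) (Finsupp.supported_mono
    (fun σ hσ => by
      subst hA
      exact vertexAdmissible_of_pos hHc (fun i => hWH _ (hσ.1 i)) hσ.2) hz')
    (singularSubdivision_isCycle k hcyc)
  -- The three summands join `z` to its subdivision, the subdivision to its affine version, and fill
  -- the latter.
  refine ⟨u₁ + (u₂ + realize vertexPoint (ContinuousMap.id A) (n + 1)
    (orderHomotopy (n + 1) (vertexChain φ A n z') + tupleOfFace (n + 2) u)), ?_⟩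
  rw [map_add, map_add, hu₁, hu₂, hb2, add_assoc z' (realize _ _ _ _), ZModModule.add_self,
    add_zero, add_assoc, ZModModule.add_self, add_zero]

theorem isTightComplex_of_simplicialInjective (K : PreAbstractSimplicialComplex V)
    (hK : SimplicialInjective K) : IsTightComplex K := by
  rintro _ H hH n -
  have hHconv : Convex ℝ H ∧ Convex ℝ Hᶜ := by
    obtain ⟨f, c, -, rfl | rfl⟩ := hH
    · refine ⟨convex_halfSpace_le f.isLinear c, ?_⟩
      have : {x | f x ≤ c}ᶜ = {x | c < f x} := by ext; simp
      rw [this]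
      exact convex_halfSpace_gt f.isLinear c
    · refine ⟨convex_halfSpace_lt f.isLinear c, ?_⟩
      have : {x | f x < c}ᶜ = {x | c ≤ f x} := by ext; simp
      rw [this]
      exact convex_halfSpace_ge f.isLinear c
  obtain ⟨hHc, hHc'⟩ := hHconv
  refine singularHomology_map_injective _ n fun z w hw => ?_
  exact exists_boundary_of_simplicialInjective hK hHc hHc' rfl rfl _ n z w hw

end Detection

/-! ### Filling cycles and pushing chains off a vertex -/

section Acyclicity

set_option linter.unusedSectionVars false

variable {V : Type} [Fintype V] [DecidableEq V]

lemma faceCone_boundary_cycle (p : V) {c : Finset V → ZMod 2} (hc : faceBoundary c = 0) :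
    faceBoundary (faceCone p c) = c := by
  have := faceBoundary_cone p c
  rwa [hc, map_zero, add_zero] at this

/-- Cycles of a complex which is the union of two cones bound, if the two cones intersect in a
cone. -/
lemma exists_boundary_of_two_cones {Q : Finset V → Prop} (hQ : ∀ S T, S ⊆ T → Q T → Q S) (p q : V)
    (h1 : ∀ S, S.Nonempty → Q S → Q (insert p S) ∨ Q (insert q S))
    (h2 : ∀ S, S.Nonempty → Q (insert p S) → Q (insert q S) → Q (insert p (insert q S)))
    {m : ℕ} {c : Finset V → ZMod 2}
    (hc : c ∈ faceSupported fun S => Q S ∧ S.card = m + 2) (h0 : faceBoundary c = 0) :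
    ∃ u ∈ faceSupported (fun S => Q S ∧ S.card = m + 3), faceBoundary u = c := by
  classical
  -- Split `c` into a part in the cone with apex `p` and the rest, which lies in the cone with apex
  -- `q`; their common boundary lies in the intersection. The cardinalities keep all sets involved
  -- nonempty, as `h1` and `h2` require.
  set a : Finset V → ZMod 2 := fun S => if Q (insert p S) then c S else 0 with ha
  set b : Finset V → ZMod 2 := fun S => if Q (insert p S) then 0 else c S with hb
  have hab : a + b = c := by
    ext S
    simp only [ha, hb, Pi.add_apply]
    split_ifs <;> simp
  have ha' : a ∈ faceSupported fun S => Q (insert p S) ∧ S.card = m + 2 := by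
    intro S hS
    simp only [ha] at hS
    split_ifs at hS with h
    · exact ⟨h, (hc S hS).2⟩
    · exact absurd rfl hS
  have hb' : b ∈ faceSupported fun S => Q (insert q S) ∧ S.card = m + 2 := by
    intro S hS
    simp only [hb] at hS
    split_ifs at hS with h
    · exact absurd rfl hS
    · refine ⟨(h1 S ?_ (hc S hS).1).resolve_left h, (hc S hS).2⟩
      rw [← Finset.card_pos, (hc S hS).2]
      omega
  have hd : faceBoundary a = faceBoundary b := by
    refine eq_of_add_eq_zero_modTwo ?_
    rw [← map_add, hab, h0]
  have hda : faceBoundary a ∈ faceSupported fun S => Q (insert p (insert q S)) ∧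
      S.card = m + 1 := by
    intro S hS
    have e1 := faceBoundary_mem (Q' := fun S => Q (insert p S) ∧ S.card = m + 1)
      (fun S x hx h => ⟨hQ _ _ (Finset.insert_subset_insert p (Finset.subset_insert x S)) h.1, by
        have := h.2
        rw [Finset.card_insert_of_notMem hx] at this
        omega⟩) ha' S hS
    have e2 := faceBoundary_mem (Q' := fun S => Q (insert q S) ∧ S.card = m + 1)
      (fun S x hx h => ⟨hQ _ _ (Finset.insert_subset_insert q (Finset.subset_insert x S)) h.1, by
        have := h.2
        rw [Finset.card_insert_of_notMem hx] at this
        omega⟩) hb' S (hd ▸ hS)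
    refine ⟨h2 S ?_ e1.1 e2.1, e1.2⟩
    rw [← Finset.card_pos, e1.2]
    omega
  -- Since `∂a` can be coned inside the intersection, `a + e` and `b + e` are cycles, each in a
  -- single cone, and their sum is still `c`.
  set e := faceCone p (faceBoundary a) with he
  have hde : faceBoundary e = faceBoundary a := faceCone_boundary_cycle p (faceBoundary_boundary a)
  have hep : e ∈ faceSupported fun S => Q (insert p S) ∧ S.card = m + 2 :=
    faceCone_mem (fun S hS h => ⟨by
      rw [Finset.insert_idem]
      exact hQ _ _ (Finset.insert_subset_insert p (Finset.subset_insert q S)) h.1, by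
      rw [Finset.card_insert_of_notMem hS, h.2]⟩) hda
  have heq : e ∈ faceSupported fun S => Q (insert q S) ∧ S.card = m + 2 :=
    faceCone_mem (fun S hS h => ⟨by rw [Finset.insert_comm]; exact h.1, by
      rw [Finset.card_insert_of_notMem hS, h.2]⟩) hda
  refine ⟨faceCone p (a + e) + faceCone q (b + e), add_mem ?_ ?_, ?_⟩
  · exact faceCone_mem (fun S hS h => ⟨h.1, by rw [Finset.card_insert_of_notMem hS, h.2]⟩)
      (add_mem ha' hep)
  · exact faceCone_mem (fun S hS h => ⟨h.1, by rw [Finset.card_insert_of_notMem hS, h.2]⟩)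
      (add_mem hb' heq)
  · rw [map_add, faceCone_boundary_cycle, faceCone_boundary_cycle, ← hab]
    · rw [add_add_add_comm, ZModModule.add_self, add_zero]
    · rw [map_add, hde, hd, ZModModule.add_self]
    · rw [map_add, hde, ZModModule.add_self]

/-- If the link of `v` is acyclic, chains whose boundary avoids `v` can be pushed away from `v`. -/
lemma exists_push {Q : Finset V → Prop} (hQ : ∀ S T, S ⊆ T → Q T → Q S) (v : V) {m : ℕ}
    (hlk : ∀ c ∈ faceSupported (fun S => (v ∉ S ∧ Q (insert v S)) ∧ S.card = m + 2),
      faceBoundary c = 0 → ∃ u ∈ faceSupported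
        (fun S => (v ∉ S ∧ Q (insert v S)) ∧ S.card = m + 3), faceBoundary u = c)
    {w : Finset V → ZMod 2} (hw : w ∈ faceSupported fun S => Q S ∧ S.card = m + 3)
    (hdw : faceBoundary w ∈ faceSupported fun S => v ∉ S) :
    ∃ x ∈ faceSupported (fun S => Q S ∧ S.card = m + 4),
      w + faceBoundary x ∈ faceSupported fun S => (Q S ∧ v ∉ S) ∧ S.card = m + 3 := by
  -- Here `w = w₁ + v * l`, where `l` lies in the link of `v`. In the boundary only `v * ∂l`
  -- involves `v`, so the hypothesis on `∂w` forces `∂l = 0`.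
  set w₁ : Finset V → ZMod 2 := fun S => if v ∈ S then 0 else w S with hw₁
  set l : Finset V → ZMod 2 := fun S => if v ∈ S then 0 else w (insert v S) with hl
  have hsum : w = w₁ + faceCone v l := by
    ext S
    simp only [Pi.add_apply, faceCone_apply, hw₁, hl]
    by_cases h : v ∈ S
    · simp [h]
    · simp [h]
  have hw₁' : w₁ ∈ faceSupported fun S => (Q S ∧ v ∉ S) ∧ S.card = m + 3 := by
    intro S hS
    simp only [hw₁] at hS
    split_ifs at hS with h
    · exact absurd rfl hS
    · exact ⟨⟨(hw S hS).1, h⟩, (hw S hS).2⟩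
  have hl' : l ∈ faceSupported fun S => (v ∉ S ∧ Q (insert v S)) ∧ S.card = m + 2 := by
    intro S hS
    simp only [hl] at hS
    split_ifs at hS with h
    · exact absurd rfl hS
    · have := (hw _ hS).2
      rw [Finset.card_insert_of_notMem h] at this
      exact ⟨⟨h, (hw _ hS).1⟩, by omega⟩
  have hnot : ∀ {c : Finset V → ZMod 2}, c ∈ faceSupported (fun S => v ∉ S) →
      faceBoundary c ∈ faceSupported fun S => v ∉ S := fun hc =>
    faceBoundary_mem (fun S x _ h h' => h (Finset.mem_insert_of_mem h')) hc
  have hl0 : l ∈ faceSupported fun S => v ∉ S := faceSupported_mono (fun S h => h.1.1) hl'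
  have hcyc : faceBoundary l = 0 := by
    have e1 : faceCone v (faceBoundary l) = faceBoundary w + (faceBoundary w₁ + l) := by
      have := faceBoundary_cone v l
      refine eq_of_add_eq_zero_modTwo ?_
      rw [hsum, map_add]
      have t1 := ZModModule.add_self (faceBoundary w₁)
      have t2 := ZModModule.add_self l
      linear_combination (exp := 1) this + t1 + t2
    have e2 : faceCone v (faceBoundary l) ∈ faceSupported fun S => v ∉ S := by
      rw [e1]
      exact add_mem hdw (add_mem (hnot (faceSupported_mono (fun S h => h.1.2) hw₁')) hl0)
    ext S
    by_contra hS
    have hvS : v ∉ S := hnot hl0 S hS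
    refine e2 (insert v S) ?_ (Finset.mem_insert_self v S)
    rw [faceCone_apply, if_pos (Finset.mem_insert_self v S), Finset.erase_insert hvS]
    exact hS
  -- If `∂e = l` in the link, then `∂(v * e) = e + v * l`; adding it exchanges `v * l` for `e`,
  -- which avoids `v`.
  obtain ⟨e, he, hde⟩ := hlk l hl' hcyc
  refine ⟨faceCone v e, faceCone_mem (fun S hS h => ⟨h.1.2, by
    rw [Finset.card_insert_of_notMem hS, h.2]⟩) he, ?_⟩
  have h3 : w + faceBoundary (faceCone v e) = w₁ + e := by
    have := faceBoundary_cone v e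
    rw [hde] at this
    rw [hsum]
    linear_combination (exp := 1) this
  rw [h3]
  exact add_mem hw₁' (faceSupported_mono
    (fun S h => ⟨⟨hQ _ _ (Finset.subset_insert v S) h.1.2, h.1.1⟩, h.2⟩) he)

end Acyclicity

/-! ### Tightness of Kühnel's complexes -/

section Kuehnel

variable {d : ℕ}

lemma zmod_val_add_cases {n : ℕ} [NeZero n] (a b : ZMod n) :
    (a + b).val = a.val + b.val ∧ a.val + b.val < n ∨ (a + b).val + n = a.val + b.val := by
  rcases lt_or_ge (a.val + b.val) n with h | h
  · exact Or.inl ⟨ZMod.val_add_of_lt h, h⟩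
  · exact Or.inr (ZMod.val_add_val_of_le h).symm

/-- Forward distances on the cycle add up, except possibly for one full turn. Stated as a
disjunction of linear relations, it lets `omega` settle the cyclic position arguments below. -/
lemma zmod_val_sub_cases {n : ℕ} [NeZero n] (x i j : ZMod n) :
    (x - i).val = (x - j).val + (j - i).val ∧ (x - j).val + (j - i).val < n ∨
      (x - i).val + n = (x - j).val + (j - i).val := by
  have := zmod_val_add_cases (x - j) (j - i)
  rwa [sub_add_sub_cancel] at this

lemma zmod_val_sub_eq_iff {n : ℕ} [NeZero n] {x i : ZMod n} {k : ℕ} (hk : k < n) :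
    (x - i).val = k ↔ x = i + k := by
  constructor
  · rintro rfl
    rw [ZMod.natCast_zmod_val, add_sub_cancel]
  · rintro rfl
    rw [add_sub_cancel_left, ZMod.val_natCast_of_lt hk]

/-- The set of the `k` consecutive vertices starting from `i`. -/
def consecutive (d k : ℕ) (i : ZMod (2 * d + 3)) : Finset (ZMod (2 * d + 3)) :=
  Finset.univ.filter fun x => (x - i).val < k

lemma mem_consecutive {k : ℕ} {i x : ZMod (2 * d + 3)} :
    x ∈ consecutive d k i ↔ (x - i).val < k := by
  simp [consecutive]

lemma card_consecutive {k : ℕ} (hk : k ≤ 2 * d + 3) (i : ZMod (2 * d + 3)) :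
    (consecutive d k i).card = k := by
  have : consecutive d k i = (Finset.range k).image fun j : ℕ => i + (j : ZMod (2 * d + 3)) := by
    ext x
    simp only [mem_consecutive, Finset.mem_image, Finset.mem_range]
    constructor
    · intro h
      exact ⟨_, h, ((zmod_val_sub_eq_iff (by omega)).1 rfl).symm⟩
    · rintro ⟨j, hj, rfl⟩
      rwa [(zmod_val_sub_eq_iff (by omega)).2 rfl]
  rw [this, Finset.card_image_of_injOn, Finset.card_range]
  intro a ha b hb h
  have ha : a < k := by simpa using ha
  have hb : b < k := by simpa using hb
  have e1 := (zmod_val_sub_eq_iff (x := i + (a : ZMod (2 * d + 3))) (i := i) (k := a)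
    (by omega)).2 rfl
  have e2 := (zmod_val_sub_eq_iff (x := i + (a : ZMod (2 * d + 3))) (i := i) (k := b)
    (by omega)).2 h
  omega

/-- The sets of vertices contained in `d + 2` consecutive vertices. -/
def InArc (S : Finset (ZMod (2 * d + 3))) : Prop := ∃ i, S ⊆ consecutive d (d + 2) i

lemma InArc.mono {S T : Finset (ZMod (2 * d + 3))} (h : S ⊆ T) (hT : InArc T) : InArc S :=
  hT.imp fun _ hi => h.trans hi

lemma mem_kuehnelComplex {S : Finset (ZMod (2 * d + 3))} :
    S ∈ (kuehnelComplex d).faces ↔ S.Nonempty ∧ ∃ (i : ZMod (2 * d + 3)) (j : ℕ), 1 ≤ j ∧ j ≤ d ∧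
      ∀ x ∈ S, (x - i).val < d + 2 ∧ (x - i).val ≠ j := by
  change (S.Nonempty ∧ _) ↔ _
  refine and_congr_right fun _ => exists_congr fun i => exists_congr fun j =>
    and_congr_right fun _ => and_congr_right fun _ => forall₂_congr fun x _ => ?_
  simp only [Finset.mem_image, Finset.mem_erase, Finset.mem_range]
  constructor
  · rintro ⟨k, ⟨h1, h2⟩, rfl⟩
    rw [(zmod_val_sub_eq_iff (by omega)).2 rfl]
    exact ⟨h2, h1⟩
  · rintro ⟨h1, h2⟩
    exact ⟨_, ⟨h2, h1⟩, ((zmod_val_sub_eq_iff (by omega)).1 rfl).symm⟩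

lemma isFaceOrEmpty_inArc {S : Finset (ZMod (2 * d + 3))}
    (h : IsFaceOrEmpty (kuehnelComplex d) S) : InArc S := by
  rcases h with rfl | h
  · exact ⟨0, by simp⟩
  · obtain ⟨-, i, j, -, -, h⟩ := mem_kuehnelComplex.1 h
    exact ⟨i, fun x hx => mem_consecutive.2 (h x hx).1⟩

/-- A set in an arc which is not a face contains `d + 1` consecutive vertices. -/
lemma isFaceOrEmpty_or_consecutive {S : Finset (ZMod (2 * d + 3))} (hd : 1 ≤ d) (h : InArc S) :
    IsFaceOrEmpty (kuehnelComplex d) S ∨ ∃ i, consecutive d (d + 1) i ⊆ S := by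
  rcases S.eq_empty_or_nonempty with rfl | hS
  · exact Or.inl (Or.inl rfl)
  by_contra! hc
  obtain ⟨hc1, hc2⟩ := hc
  obtain ⟨i, hi⟩ := h
  -- A missing interior position `j` would exhibit `S` as a face.
  have hmem : ∀ j : ℕ, 1 ≤ j → j ≤ d → i + (j : ZMod (2 * d + 3)) ∈ S := by
    intro j h1 h2
    by_contra hj
    refine hc1 (Or.inr (mem_kuehnelComplex.2 ⟨hS, i, j, h1, h2, fun x hx =>
      ⟨mem_consecutive.1 (hi hx), fun e => hj ?_⟩⟩))
    rwa [← (zmod_val_sub_eq_iff (by omega)).1 e]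
  have hi1 : (i + 1 - i).val = 1 := by
    have := (zmod_val_sub_eq_iff (x := i + 1) (i := i) (k := 1) (by omega)).2 (by simp)
    exact this
  have hmem' : ∀ x, 1 ≤ (x - i).val → (x - i).val ≤ d → x ∈ S := fun x h1 h2 => by
    rw [(zmod_val_sub_eq_iff (x := x) (i := i) (k := (x - i).val) (by omega)).1 rfl]
    exact hmem _ h1 h2
  -- Either end of the arc, together with the interior positions, would form a block of `d + 1`
  -- consecutive vertices.
  have hni : i ∉ S := fun h => hc2 i fun x hx => by
    rw [mem_consecutive] at hx
    rcases Nat.eq_zero_or_pos (x - i).val with h0 | h0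
    · rw [ZMod.val_eq_zero, sub_eq_zero] at h0
      rwa [h0]
    · exact hmem' x h0 (by omega)
  have hni' : ∀ x ∈ S, (x - i).val ≠ d + 1 := fun y hy h => hc2 (i + 1) fun x hx => by
    rw [mem_consecutive] at hx
    have := zmod_val_sub_cases x i (i + 1)
    rw [hi1] at this
    by_cases e : (x - i).val = d + 1
    · rw [zmod_val_sub_eq_iff (by omega)] at h e
      rwa [e, ← h]
    · exact hmem' x (by omega) (by omega)
  -- With both ends missing, `S` also lies in the arc shifted by one step, where the old last vertex
  -- has interior position `d`; so `S` is a face after all.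
  refine hc1 (Or.inr (mem_kuehnelComplex.2 ⟨hS, i + 1, d, hd, le_rfl, fun x hx => ?_⟩))
  have h1 := mem_consecutive.1 (hi hx)
  have h2 := hni' x hx
  have h3 : (x - i).val ≠ 0 := fun h => by
    rw [ZMod.val_eq_zero, sub_eq_zero] at h
    exact hni (h ▸ hx)
  have := zmod_val_sub_cases x i (i + 1)
  rw [hi1] at this
  have := ZMod.val_lt (x - (i + 1))
  omega

/-- A block of `d + 1` vertices does not fit into `S`, so the boundary and the disc bundle agree up
to this size. -/
lemma isFaceOrEmpty_of_card_le {S : Finset (ZMod (2 * d + 3))} (hd : 1 ≤ d) (h : InArc S)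
    (hS : S.card ≤ d) : IsFaceOrEmpty (kuehnelComplex d) S := by
  refine (isFaceOrEmpty_or_consecutive hd h).resolve_right ?_
  rintro ⟨i, hi⟩
  have := Finset.card_le_card hi
  rw [card_consecutive (by omega)] at this
  omega

/-- Only the two ends of the block matter: the arc must contain `j` and `j + d`, which leaves one
step of freedom, and there are too many vertices for a wrap-around. -/
lemma eq_or_eq_of_consecutive_subset {i j : ZMod (2 * d + 3)} (hd : 1 ≤ d)
    (h : consecutive d (d + 1) j ⊆ consecutive d (d + 2) i) : i = j ∨ i = j - 1 := by
  have h1 : j ∈ consecutive d (d + 1) j := by simp [mem_consecutive]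
  have h2 : j + (d : ZMod (2 * d + 3)) ∈ consecutive d (d + 1) j := by
    rw [mem_consecutive, (zmod_val_sub_eq_iff (by omega)).2 rfl]
    omega
  have e1 := mem_consecutive.1 (h h1)
  have e2 := mem_consecutive.1 (h h2)
  have e3 := zmod_val_sub_cases (j + (d : ZMod (2 * d + 3))) i j
  rw [(zmod_val_sub_eq_iff (x := j + (d : ZMod (2 * d + 3))) (by omega)).2 rfl] at e3
  have : (j - i).val = 0 ∨ (j - i).val = 1 := by omega
  rcases this with h0 | h0
  · rw [ZMod.val_eq_zero, sub_eq_zero] at h0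
    exact Or.inl h0.symm
  · rw [zmod_val_sub_eq_iff (by omega)] at h0
    right
    rw [h0]
    simp

/-- An arc contains just two blocks, and every interior position of the arc belongs to both, so
omitting one destroys both. -/
lemma not_consecutive_subset {S : Finset (ZMod (2 * d + 3))} (hd : 1 ≤ d)
    (hS : IsFaceOrEmpty (kuehnelComplex d) S) (j : ZMod (2 * d + 3)) :
    ¬ consecutive d (d + 1) j ⊆ S := by
  intro h
  have hj : j ∈ S := h (by simp [mem_consecutive])
  rcases hS with rfl | hS
  · simp at hj
  obtain ⟨-, i, k, hk1, hk2, hi⟩ := mem_kuehnelComplex.1 hS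
  have h1 := eq_or_eq_of_consecutive_subset hd
    (h.trans fun x hx => mem_consecutive.2 (hi x hx).1)
  have hik : (i + (k : ZMod (2 * d + 3)) - i).val = k := (zmod_val_sub_eq_iff (by omega)).2 rfl
  refine (hi (i + k) (h ?_)).2 hik
  rw [mem_consecutive]
  rcases h1 with rfl | rfl
  · omega
  · have e := zmod_val_sub_cases (j - 1 + (k : ZMod (2 * d + 3))) (j - 1) j
    have e1 : (j - (j - 1)).val = 1 := (zmod_val_sub_eq_iff (by omega)).2 (by simp)
    rw [hik, e1] at e
    have := ZMod.val_lt (j - 1 + (k : ZMod (2 * d + 3)) - j)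
    omega

lemma insert_consecutive_right (j : ZMod (2 * d + 3)) :
    insert (j + ((d + 1 : ℕ) : ZMod (2 * d + 3))) (consecutive d (d + 1) j) =
      consecutive d (d + 2) j := by
  ext x
  rw [Finset.mem_insert, mem_consecutive, mem_consecutive, ← zmod_val_sub_eq_iff (by omega)]
  omega

lemma insert_consecutive_left (j : ZMod (2 * d + 3)) :
    insert (j - 1) (consecutive d (d + 1) j) = consecutive d (d + 2) (j - 1) := by
  ext x
  rw [Finset.mem_insert, mem_consecutive, mem_consecutive]
  have e := zmod_val_sub_cases x (j - 1) j
  have e1 : (j - (j - 1)).val = 1 := (zmod_val_sub_eq_iff (by omega)).2 (by simp)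
  rw [e1] at e
  have e2 : x = j - 1 ↔ (x - (j - 1)).val = 0 := by rw [ZMod.val_eq_zero, sub_eq_zero]
  rw [e2]
  have := ZMod.val_lt (x - j)
  omega

lemma eq_consecutive_of_inArc {S : Finset (ZMod (2 * d + 3))} (h : InArc S)
    (hS : S.card = d + 2) : ∃ i, S = consecutive d (d + 2) i := by
  obtain ⟨i, hi⟩ := h
  exact ⟨i, Finset.eq_of_subset_of_card_le hi (by rw [card_consecutive (by omega), hS])⟩

/-- A block is an interior facet of the disc bundle: only the arcs prolonging it at either end
contain it. -/
lemma faceBoundary_consecutive (hd : 1 ≤ d) {x : Finset (ZMod (2 * d + 3)) → ZMod 2}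
    (hx : x ∈ faceSupported fun S => InArc S ∧ S.card = d + 2) (j : ZMod (2 * d + 3)) :
    faceBoundary x (consecutive d (d + 1) j) =
      x (consecutive d (d + 2) j) + x (consecutive d (d + 2) (j - 1)) := by
  have h1 : j + ((d + 1 : ℕ) : ZMod (2 * d + 3)) ∉ consecutive d (d + 1) j := by
    rw [mem_consecutive, (zmod_val_sub_eq_iff (by omega)).2 rfl]
    omega
  have hj1 : (j - 1 - j).val = 2 * d + 2 := by
    rw [zmod_val_sub_eq_iff (by omega), sub_eq_iff_eq_add, add_assoc, left_eq_add]
    have := ZMod.natCast_self (2 * d + 3)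
    push_cast at this ⊢
    linear_combination this
  have h2 : j - 1 ∉ consecutive d (d + 1) j := by
    rw [mem_consecutive, hj1]
    omega
  rw [faceBoundary_apply, Finset.sum_eq_add_of_mem (j + ((d + 1 : ℕ) : ZMod (2 * d + 3))) (j - 1)
    (by simpa using h1) (by simpa using h2), insert_consecutive_right, insert_consecutive_left]
  · intro e
    have e' := (zmod_val_sub_eq_iff (x := j - 1) (i := j) (k := d + 1) (by omega)).2 e.symm
    omega
  · rintro a ha ⟨ha1, ha2⟩
    by_contra hne
    have ha : a ∉ consecutive d (d + 1) j := by simpa using ha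
    obtain ⟨i, hi⟩ := eq_consecutive_of_inArc (hx _ hne).1 (hx _ hne).2
    have hai : a ∈ consecutive d (d + 2) i := hi ▸ Finset.mem_insert_self _ _
    rcases eq_or_eq_of_consecutive_subset hd (hi ▸ Finset.subset_insert _ _ :
      consecutive d (d + 1) j ⊆ consecutive d (d + 2) i) with rfl | rfl
    · rw [← insert_consecutive_right] at hai
      exact (Finset.mem_insert.1 hai).elim ha1 ha
    · rw [← insert_consecutive_left] at hai
      exact (Finset.mem_insert.1 hai).elim ha2 ha

end Kuehnel

/-! ### Links in the disc bundle and the filling criterion for M^d -/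

section KuehnelTight

variable {d : ℕ}

/-- A vertex `x` lies in the arc which starts `k` steps before `v`. -/
lemma mem_consecutive_sub {v x : ZMod (2 * d + 3)} {k : ℕ} (hk : k ≤ d + 1) :
    x ∈ consecutive d (d + 2) (v - k) ↔
      (x - v).val + k ≤ d + 1 ∨ 2 * d + 3 ≤ (x - v).val + k := by
  rw [mem_consecutive]
  have e := zmod_val_sub_cases x (v - k) v
  have e1 : (v - (v - (k : ZMod (2 * d + 3)))).val = k :=
    (zmod_val_sub_eq_iff (by omega)).2 (by simp)
  rw [e1] at e
  have := ZMod.val_lt (x - v)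
  omega

/-- An arc through `v` is determined by the number `k` of steps it starts before `v`. It reaches `d
+ 1 - k` steps forward and `k` steps back, which turns arcs into linear inequalities. -/
lemma inArc_insert_iff {v : ZMod (2 * d + 3)} {S : Finset (ZMod (2 * d + 3))} :
    InArc (insert v S) ↔ ∃ k ≤ d + 1, ∀ x ∈ S,
      (x - v).val + k ≤ d + 1 ∨ 2 * d + 3 ≤ (x - v).val + k := by
  constructor
  · rintro ⟨i, hi⟩
    have hv := mem_consecutive.1 (hi (Finset.mem_insert_self v S))
    have hi' : i = v - ((v - i).val : ZMod (2 * d + 3)) := by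
      rw [ZMod.natCast_zmod_val, sub_sub_cancel]
    refine ⟨(v - i).val, by omega, fun x hx => ?_⟩
    rw [← mem_consecutive_sub (by omega), ← hi']
    exact hi (Finset.mem_insert_of_mem hx)
  · rintro ⟨k, hk, h⟩
    refine ⟨v - k, Finset.insert_subset ?_ fun x hx => (mem_consecutive_sub hk).2 (h x hx)⟩
    rw [mem_consecutive_sub hk]
    simp [hk]

/-- The link of `v`, restricted to a set of vertices `W`, is acyclic in positive degrees. -/
lemma exists_boundary_link (W : Finset (ZMod (2 * d + 3))) {v : ZMod (2 * d + 3)}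
    {m : ℕ} {c : Finset (ZMod (2 * d + 3)) → ZMod 2}
    (hc : c ∈ faceSupported fun S => (S ⊆ W ∧ InArc (insert v S)) ∧ S.card = m + 2)
    (h0 : faceBoundary c = 0) :
    ∃ u ∈ faceSupported (fun S => (S ⊆ W ∧ InArc (insert v S)) ∧ S.card = m + 3),
      faceBoundary u = c := by
  have hQ : ∀ S T : Finset (ZMod (2 * d + 3)), S ⊆ T → (T ⊆ W ∧ InArc (insert v T)) →
      S ⊆ W ∧ InArc (insert v S) := fun S T h hT =>
    ⟨h.trans hT.1, hT.2.mono (Finset.insert_subset_insert v h)⟩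
  -- Arcs through `v` reach `L` only backwards and `R` only forwards. With `p` and `q` the nearest
  -- vertices of `L` and `R`, an arc through `v` that meets `L` contains `p`, and one that meets `R`
  -- contains `q`; so the link is a union of two cones. If a side is empty a single apex suffices.
  set L := W.filter fun x => d + 2 ≤ (x - v).val with hL
  set R := W.filter fun x => (x - v).val ≤ d + 1 with hR
  rcases L.eq_empty_or_nonempty with hLe | hLn
  · rcases R.eq_empty_or_nonempty with hRe | hRn
    · have hWe : ∀ S : Finset (ZMod (2 * d + 3)), S.Nonempty → ¬ S ⊆ W := by
        rintro S ⟨x, hx⟩ h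
        rcases le_or_gt (x - v).val (d + 1) with h1 | h1
        · have : x ∈ R := Finset.mem_filter.2 ⟨h hx, h1⟩
          simp [hRe] at this
        · have : x ∈ L := Finset.mem_filter.2 ⟨h hx, h1⟩
          simp [hLe] at this
      exact exists_boundary_of_two_cones hQ v v (fun S hS h => absurd h.1 (hWe S hS))
        (fun S _ h _ => by rwa [Finset.insert_idem]) hc h0
    · obtain ⟨q, hq, hmin⟩ := R.exists_min_image (fun x => (x - v).val) hRn
      have hqW := Finset.mem_filter.1 hq
      refine exists_boundary_of_two_cones hQ q q (fun S hS h => Or.inl ⟨Finset.insert_subset hqW.1 h.1, ?_⟩)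
        (fun S _ h _ => by rwa [Finset.insert_idem]) hc h0
      obtain ⟨k, hk, h2⟩ := inArc_insert_iff.1 h.2
      refine inArc_insert_iff.2 ⟨k, hk, fun x hx => ?_⟩
      rcases Finset.mem_insert.1 hx with rfl | hx
      · obtain ⟨y, hy⟩ := hS
        have hyR : y ∈ R := by
          refine Finset.mem_filter.2 ⟨h.1 hy, ?_⟩
          by_contra hlt
          have : y ∈ L := Finset.mem_filter.2 ⟨h.1 hy, by omega⟩
          simp [hLe] at this
        have := hmin y hyR
        have := (Finset.mem_filter.1 hyR).2
        rcases h2 y hy with h3 | h3 <;> omega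
      · exact h2 x hx
  · obtain ⟨p, hp, hmax⟩ := L.exists_max_image (fun x => (x - v).val) hLn
    have hpW := Finset.mem_filter.1 hp
    rcases R.eq_empty_or_nonempty with hRe | hRn
    · refine exists_boundary_of_two_cones hQ p p (fun S hS h => Or.inl ⟨Finset.insert_subset hpW.1 h.1, ?_⟩)
        (fun S _ h _ => by rwa [Finset.insert_idem]) hc h0
      obtain ⟨k, hk, h2⟩ := inArc_insert_iff.1 h.2
      refine inArc_insert_iff.2 ⟨k, hk, fun x hx => ?_⟩
      rcases Finset.mem_insert.1 hx with rfl | hx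
      · obtain ⟨y, hy⟩ := hS
        have hyL : y ∈ L := by
          refine Finset.mem_filter.2 ⟨h.1 hy, ?_⟩
          by_contra hlt
          have : y ∈ R := Finset.mem_filter.2 ⟨h.1 hy, by omega⟩
          simp [hRe] at this
        have := hmax y hyL
        have := (Finset.mem_filter.1 hyL).2
        rcases h2 y hy with h3 | h3 <;> omega
      · exact h2 x hx
    · obtain ⟨q, hq, hmin⟩ := R.exists_min_image (fun x => (x - v).val) hRn
      have hqW := Finset.mem_filter.1 hq
      refine exists_boundary_of_two_cones hQ p q (fun S hS h => ?_) (fun S hS h h' => ?_) hc h0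
      · obtain ⟨k, hk, h2⟩ := inArc_insert_iff.1 h.2
        obtain ⟨y, hy⟩ := hS
        rcases le_or_gt (y - v).val (d + 1) with h1 | h1
        · right
          have := hmin y (Finset.mem_filter.2 ⟨h.1 hy, h1⟩)
          refine ⟨Finset.insert_subset hqW.1 h.1, inArc_insert_iff.2 ⟨k, hk, fun x hx => ?_⟩⟩
          rcases Finset.mem_insert.1 hx with rfl | hx
          · rcases h2 y hy with h3 | h3 <;> omega
          · exact h2 x hx
        · left
          have := hmax y (Finset.mem_filter.2 ⟨h.1 hy, h1⟩)
          refine ⟨Finset.insert_subset hpW.1 h.1, inArc_insert_iff.2 ⟨k, hk, fun x hx => ?_⟩⟩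
          rcases Finset.mem_insert.1 hx with rfl | hx
          · rcases h2 y hy with h3 | h3 <;> omega
          · exact h2 x hx
      · refine ⟨Finset.insert_subset hpW.1 h'.1, ?_⟩
        obtain ⟨k, hk, h2⟩ := inArc_insert_iff.1 h.2
        obtain ⟨k', hk', h2'⟩ := inArc_insert_iff.1 h'.2
        have hpk := h2 p (Finset.mem_insert_self _ _)
        have hqk := h2' q (Finset.mem_insert_self _ _)
        have hp2 := hpW.2
        have hq2 := hqW.2
        obtain ⟨y, hy⟩ := hS
        have hyk := h2 y (Finset.mem_insert_of_mem hy)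
        have hyk' := h2' y (Finset.mem_insert_of_mem hy)
        have hyW : y ∈ W := h.1 (Finset.mem_insert_of_mem hy)
        -- One of the two arcs contains both `p` and `q`. If `k ≤ k'`, the first reaches at least as
        -- far forward as the second. Otherwise a vertex `y` common to both arcs decides: on the
        -- forward side it forces `q` into the first, on the backward side `p` into the second.
        have key : (q - v).val + k ≤ d + 1 ∨ 2 * d + 3 ≤ (p - v).val + k' := by
          rcases le_or_gt k k' with hkk | hkk
          · left; omega
          · rcases le_or_gt (y - v).val (d + 1) with h1 | h1
            · have := hmin y (Finset.mem_filter.2 ⟨hyW, h1⟩)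
              left; omega
            · have := hmax y (Finset.mem_filter.2 ⟨hyW, h1⟩)
              right; omega
        rw [inArc_insert_iff]
        rcases key with key | key
        · refine ⟨k, hk, fun x hx => ?_⟩
          rcases Finset.mem_insert.1 hx with rfl | hx
          · exact hpk
          rcases Finset.mem_insert.1 hx with rfl | hx
          · exact Or.inl key
          · exact h2 x (Finset.mem_insert_of_mem hx)
        · refine ⟨k', hk', fun x hx => ?_⟩
          rcases Finset.mem_insert.1 hx with rfl | hx
          · exact Or.inr key
          · exact h2' x hx

/-- Chains of dimension at least two in the disc bundle whose boundary is supported on `W` can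
be pushed into `W`. -/
lemma exists_push_inArc (W : Finset (ZMod (2 * d + 3))) {m : ℕ} (T : Finset (ZMod (2 * d + 3))) :
    ∀ w ∈ faceSupported (fun S => (InArc S ∧ S ⊆ W ∪ T) ∧ S.card = m + 3),
      faceBoundary w ∈ faceSupported (fun S => S ⊆ W) →
      ∃ x ∈ faceSupported (fun S : Finset (ZMod (2 * d + 3)) => InArc S ∧ S.card = m + 4),
        w + faceBoundary x ∈ faceSupported fun S => (InArc S ∧ S ⊆ W) ∧ S.card = m + 3 := by
  induction T using Finset.induction_on with
  | empty =>
    intro w hw _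
    exact ⟨0, zero_mem _, by simpa using hw⟩
  | insert v T _ ih =>
    intro w hw hdw
    by_cases hv : v ∈ W ∪ T
    · exact ih w (by rwa [Finset.union_insert, Finset.insert_eq_of_mem hv] at hw) hdw
    · have hsub : ∀ S : Finset (ZMod (2 * d + 3)), v ∉ S → S ⊆ W ∪ insert v T → S ⊆ W ∪ T := by
        intro S hvS hS a ha
        have := hS ha
        rw [Finset.union_insert, Finset.mem_insert] at this
        exact this.resolve_left fun e => hvS (e ▸ ha)
      -- The link of `v` in the subcomplex induced on `W ∪ T ∪ {v}` is its link in the disc bundle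
      -- restricted to `W ∪ T`, so the two-cone argument applies.
      have hlink : ∀ c ∈ faceSupported (fun S => (v ∉ S ∧ InArc (insert v S) ∧
          insert v S ⊆ W ∪ insert v T) ∧ S.card = m + 2), faceBoundary c = 0 →
          ∃ u ∈ faceSupported (fun S => (v ∉ S ∧ InArc (insert v S) ∧
            insert v S ⊆ W ∪ insert v T) ∧ S.card = m + 3), faceBoundary u = c := by
        intro c hc h0
        obtain ⟨u, hu, hu'⟩ := exists_boundary_link (W ∪ T) (v := v) (m := m) (c := c)
          (faceSupported_mono (fun S hS => ⟨⟨hsub S hS.1.1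
            ((Finset.subset_insert v S).trans hS.1.2.2), hS.1.2.1⟩, hS.2⟩) hc) h0
        refine ⟨u, faceSupported_mono (fun S hS => ⟨⟨fun h => hv (hS.1.1 h), hS.1.2, ?_⟩, hS.2⟩)
          hu, hu'⟩
        rw [Finset.union_insert]
        exact Finset.insert_subset_insert v hS.1.1
      obtain ⟨x, hx, hx'⟩ := exists_push (Q := fun S => InArc S ∧ S ⊆ W ∪ insert v T)
        (fun S S' h hS' => ⟨hS'.1.mono h, h.trans hS'.2⟩) v (m := m) hlink hw
        (faceSupported_mono (Q' := fun S => v ∉ S)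
          (fun S hS hvS => hv (Finset.mem_union_left _ (hS hvS))) hdw)
      obtain ⟨y, hy, hy'⟩ := ih (w + faceBoundary x) (faceSupported_mono (fun S hS =>
        ⟨⟨hS.1.1.1, hsub S hS.1.2 hS.1.1.2⟩, hS.2⟩) hx') (by
          rwa [map_add, faceBoundary_boundary, add_zero])
      refine ⟨x + y, add_mem (faceSupported_mono (fun S hS => ⟨hS.1.1, hS.2⟩) hx) hy, ?_⟩
      rwa [map_add, ← add_assoc]

/-- The two forward distances between distinct vertices add up to `2d + 3`, so one of them is at
most `d + 1`; and two vertices are too few to contain a block, as `d ≥ 2`. -/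
lemma pair_mem_kuehnelComplex (hd : 2 ≤ d) {S : Finset (ZMod (2 * d + 3))} (hS : S.card ≤ 2) :
    IsFaceOrEmpty (kuehnelComplex d) S := by
  refine isFaceOrEmpty_of_card_le (by omega) ?_ (by omega)
  have key : ∀ a b : ZMod (2 * d + 3), (b - a).val ≤ d + 1 → InArc {a, b} := fun a b h =>
    ⟨a, by
      intro x hx
      rw [mem_consecutive]
      rcases Finset.mem_insert.1 hx with rfl | hx
      · simp
      · rw [Finset.mem_singleton.1 hx]; omega⟩
  rcases S.eq_empty_or_nonempty with rfl | ⟨a, ha⟩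
  · exact ⟨0, by simp⟩
  have : ∃ b, S ⊆ {a, b} := by
    have h1 : (S.erase a).card ≤ 1 := by rw [Finset.card_erase_of_mem ha]; omega
    rcases Finset.card_le_one_iff_subset_singleton.1 h1 with ⟨b, hb⟩
    exact ⟨b, Finset.subset_insert_iff.2 hb⟩
  obtain ⟨b, hb⟩ := this
  refine InArc.mono hb ?_
  have e := zmod_val_sub_cases a a b
  rw [sub_self, ZMod.val_zero] at e
  rcases le_or_gt (b - a).val (d + 1) with h | h
  · exact key a b h
  · rw [Finset.pair_comm]
    exact key b a (by omega)

/-- The filling `w` is first moved into `W` within the disc bundle. The move must then be corrected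
in the top dimension, where it may leave M^d. -/
theorem simplicialInjective_kuehnelComplex (hd : 2 ≤ d) :
    SimplicialInjective (kuehnelComplex d) := by
  classical
  intro W hW n z w hz hw hwz
  have hwN : w ∈ faceSupported fun S => InArc S ∧ S.card = n + 2 :=
    faceSupported_mono (fun S hS => ⟨isFaceOrEmpty_inArc hS.1, hS.2⟩) hw
  -- In degree zero the augmented boundary makes `z` an even number of points, and joining them to
  -- one point of `W` uses only edges, all of which are present.
  rcases Nat.eq_zero_or_pos n with rfl | hn
  · obtain ⟨p, hp⟩ := hW
    refine ⟨faceCone p z, faceCone_mem (fun S hS h => ⟨Finset.insert_subset hp h.1.1,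
      pair_mem_kuehnelComplex hd ?_⟩) hz, faceCone_boundary_cycle p ?_⟩
    · rw [← hwz, faceBoundary_boundary]
    · rw [Finset.card_insert_of_notMem hS, h.2]
  by_cases hWu : W = Finset.univ
  · exact ⟨w, faceSupported_mono (fun S hS => ⟨by simp [hWu], hS.1⟩) hw, hwz⟩
  obtain ⟨v, hv⟩ : ∃ v, v ∉ W := by
    by_contra! h
    exact hWu (Finset.eq_univ_iff_forall.2 h)
  obtain ⟨m, rfl⟩ : ∃ m, n = m + 1 := ⟨n - 1, by omega⟩
  obtain ⟨x, hx, hy⟩ := exists_push_inArc W (m := m) Finset.univ w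
    (faceSupported_mono (fun S hS => ⟨⟨hS.1, fun a _ =>
      Finset.mem_union_right _ (Finset.mem_univ a)⟩, hS.2⟩) hwN)
    (by rw [hwz]; exact faceSupported_mono (fun S hS => hS.1.1) hz)
  have hdy : faceBoundary (w + faceBoundary x) = z := by
    rw [map_add, faceBoundary_boundary, add_zero, hwz]
  rcases lt_trichotomy (m + 3) (d + 1) with hm | hm | hm
  · exact ⟨_, faceSupported_mono (fun S hS => ⟨hS.1.2, isFaceOrEmpty_of_card_le (by omega)
      hS.1.1 (by omega)⟩) hy, hdy⟩
  · have hx' : x ∈ faceSupported fun S => InArc S ∧ S.card = d + 2 :=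
      faceSupported_mono (fun S hS => ⟨hS.1, by omega⟩) hx
    -- A block through `u` carries neither `w`, which lies in M^d, nor the pushed chain, which lies
    -- in `W`. Hence `∂x` vanishes on it, and `x` agrees on its two arcs. All arcs through `u` are
    -- linked in this way.
    have hconst : ∀ u, u ∉ W → ∀ e : ℕ, e ≤ d + 1 →
        x (consecutive d (d + 2) (u - e)) = x (consecutive d (d + 2) u) := by
      intro u hu e
      induction e with
      | zero => intro _; simp
      | succ e ih =>
        intro he
        rw [← ih (by omega)]
        have hu' : u ∈ consecutive d (d + 1) (u - (e : ZMod (2 * d + 3))) := by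
          rw [mem_consecutive, (zmod_val_sub_eq_iff (k := e) (by omega)).2 (by simp)]
          omega
        have h1 := faceBoundary_consecutive (by omega) hx' (u - (e : ZMod (2 * d + 3)))
        have h2 : (w + faceBoundary x) (consecutive d (d + 1) (u - (e : ZMod (2 * d + 3)))) = 0 := by
          by_contra h
          exact hu ((hy _ h).1.2 hu')
        have h3 : w (consecutive d (d + 1) (u - (e : ZMod (2 * d + 3)))) = 0 := by
          by_contra h
          exact not_consecutive_subset (by omega) (hw _ h).1 _ subset_rfl
        rw [Pi.add_apply, h3, zero_add, h1] at h2
        rw [show u - ((e + 1 : ℕ) : ZMod (2 * d + 3)) = u - e - 1 by push_cast; ring]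
        exact (CharTwo.add_eq_zero.1 h2).symm
    -- Two vertices outside `W` share an arc, so their constants agree.
    have hconst' : ∀ u, u ∉ W → x (consecutive d (d + 2) u) = x (consecutive d (d + 2) v) := by
      intro u hu
      have e := zmod_val_sub_cases u u v
      rw [sub_self, ZMod.val_zero] at e
      rcases le_or_gt (u - v).val (d + 1) with h | h
      · have := hconst u hu _ h
        rwa [ZMod.natCast_zmod_val, sub_sub_cancel, eq_comm] at this
      · have := hconst v hv (v - u).val (by omega)
        rwa [ZMod.natCast_zmod_val, sub_sub_cancel] at this
    set F : Finset (ZMod (2 * d + 3)) → ZMod 2 :=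
      fun S => if InArc S ∧ S.card = d + 2 then 1 else 0 with hF
    have hFs : F ∈ faceSupported fun S => InArc S ∧ S.card = d + 2 := by
      intro S hS
      by_contra h
      simp [hF, h] at hS
    have hF1 : ∀ i, F (consecutive d (d + 2) i) = 1 := fun i =>
      if_pos ⟨⟨i, subset_rfl⟩, card_consecutive (by omega) i⟩
    set κ := x (consecutive d (d + 2) v) with hκ
    refine ⟨w + κ • faceBoundary F, ?_, by
      rw [map_add, map_smul, faceBoundary_boundary, smul_zero, add_zero, hwz]⟩
    have hW2 : w + κ • faceBoundary F ∈ faceSupported fun S => S ⊆ W := by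
      -- By the choice of `κ`, the chain `x + κ • F` vanishes on every arc that leaves `W`.
      have e1 : w + κ • faceBoundary F = (w + faceBoundary x) + faceBoundary (x + κ • F) := by
        rw [map_add, map_smul, ← add_assoc, add_assoc w, ZModModule.add_self, add_zero]
      rw [e1]
      refine add_mem (faceSupported_mono (fun S hS => hS.1.2) hy)
        (faceBoundary_mem (Q := fun S => S ⊆ W)
          (fun S a _ h => (Finset.subset_insert a S).trans h) ?_)
      intro S hS
      obtain ⟨i, rfl⟩ : ∃ i, S = consecutive d (d + 2) i := by
        have := (add_mem hx' (Submodule.smul_mem _ κ hFs)) S hS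
        exact eq_consecutive_of_inArc this.1 this.2
      intro u hu
      by_contra huW
      refine hS ?_
      have h1 := hconst u huW (u - i).val (by have := mem_consecutive.1 hu; omega)
      rw [ZMod.natCast_zmod_val, sub_sub_cancel] at h1
      rw [Pi.add_apply, Pi.smul_apply, hF1, h1, hconst' u huW, smul_eq_mul, mul_one]
      exact CharTwo.add_self_eq_zero _
    have hM2 : w + κ • faceBoundary F ∈ faceSupported (IsFaceOrEmpty (kuehnelComplex d)) := by
      refine add_mem (faceSupported_mono (fun S hS => hS.1) hw) (Submodule.smul_mem _ κ ?_)
      intro S hS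
      have hS' := faceBoundary_mem (Q' := fun S => InArc S ∧ S.card = d + 1) (fun S a ha h =>
        ⟨h.1.mono (Finset.subset_insert a S), by
          have := h.2
          rw [Finset.card_insert_of_notMem ha] at this
          omega⟩) hFs S hS
      -- The only simplices of this size outside M^d are the blocks, and each lies in two arcs, so
      -- its coefficient in `∂F` cancels.
      refine (isFaceOrEmpty_or_consecutive (by omega) hS'.1).resolve_right ?_
      rintro ⟨j, hj⟩
      have := Finset.eq_of_subset_of_card_le hj (by rw [card_consecutive (by omega), hS'.2])
      refine hS ?_
      rw [← this, faceBoundary_consecutive (by omega) hFs, hF1, hF1]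
      exact CharTwo.add_self_eq_zero _
    exact fun S hS => ⟨hW2 S hS, hM2 S hS⟩
  -- Above dimension `d` there are no faces: with `d + 2` vertices a subset of an arc is the whole
  -- arc and contains a block.
  · have hw0 : w = 0 := by
      ext S
      by_contra h
      have h1 := hw S h
      obtain ⟨i, hi⟩ := isFaceOrEmpty_inArc h1.1
      have h2 := Finset.card_le_card hi
      rw [card_consecutive (by omega)] at h2
      have h3 := Finset.eq_of_subset_of_card_le hi (by rw [card_consecutive (by omega)]; omega)
      refine not_consecutive_subset (by omega) h1.1 i ?_
      rw [h3]
      intro a ha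
      rw [mem_consecutive] at ha ⊢
      omega
    exact ⟨0, zero_mem _, by rw [← hwz, hw0]⟩

theorem isTightComplex_kuehnelComplex (hd : 2 ≤ d) : IsTightComplex (kuehnelComplex d) :=
  isTightComplex_of_simplicialInjective _ (simplicialInjective_kuehnelComplex hd)

end KuehnelTight

/-! ### Stacked spheres are PL spheres -/

section StackedPL

set_option linter.unusedSectionVars false

variable {V : Type} [Fintype V]

lemma polyhedron_eq_iUnion_convexHull [DecidableEq V] [DecidableEq (V → ℝ)]
    (K : PreAbstractSimplicialComplex V) :
    polyhedron K = ⋃ s ∈ K.faces,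
      convexHull ℝ ((s.image fun v => (Pi.single v 1 : V → ℝ) : Finset (V → ℝ)) : Set (V → ℝ)) := by
  ext x
  simp only [Set.mem_iUnion]
  constructor
  · rintro ⟨hx, s, hs, h0⟩
    refine ⟨s, hs, ?_⟩
    have hsum : ∑ v ∈ s, x v = 1 := by
      rw [← hx.2]
      exact Finset.sum_subset (Finset.subset_univ s) fun v _ hv => h0 v hv
    have hrep : x = ∑ v ∈ s, x v • (Pi.single v 1 : V → ℝ) := by
      ext w
      simp only [Finset.sum_apply, Pi.smul_apply, smul_eq_mul, Pi.single_apply, mul_ite, mul_one,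
        mul_zero, Finset.sum_ite_eq]
      split_ifs with hw
      · rfl
      · exact h0 w hw
    rw [hrep]
    refine (convex_convexHull ℝ _).sum_mem (fun v _ => hx.1 v) hsum fun v hv =>
      subset_convexHull ℝ _ (Finset.mem_coe.2 (Finset.mem_image_of_mem _ hv))
  · rintro ⟨s, hs, hx⟩
    have hc : Convex ℝ {y : V → ℝ | y ∈ stdSimplex ℝ V ∧ ∀ v, v ∉ s → y v = 0} := by
      rintro y ⟨hy, hy0⟩ z ⟨hz, hz0⟩ a b ha hb hab
      exact ⟨convex_stdSimplex ℝ V hy hz ha hb hab, fun v hv => by simp [hy0 v hv, hz0 v hv]⟩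
    obtain ⟨h1, h2⟩ := convexHull_min (fun y hy => by
      obtain ⟨v, hv, rfl⟩ := Finset.mem_image.1 (Finset.mem_coe.1 hy)
      refine ⟨single_mem_stdSimplex ℝ v, fun w hw => Pi.single_eq_of_ne ?_ _⟩
      rintro rfl
      exact hw hv) hc hx
    exact ⟨h1, s, hs, h2⟩

/-- A continuous bijection from a compact space to a Hausdorff space is a homeomorphism, and the
simplices of `K` serve as the covering by polytopes. -/
lemma isPLHomeomorphic_of_bijOn {W : Type} [Fintype W] {K : PreAbstractSimplicialComplex V}
    {Y : Set (W → ℝ)} (L : (V → ℝ) →ₗ[ℝ] (W → ℝ)) (h : Set.BijOn L (polyhedron K) Y) :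
    IsPLHomeomorphic (polyhedron K) Y := by
  classical
  have hK := polyhedron_eq_iUnion_convexHull K
  have hfin : K.faces.Finite := Set.toFinite _
  have hcomp : IsCompact (polyhedron K) := by
    rw [hK]
    exact hfin.isCompact_biUnion fun s _ => (Finset.finite_toSet _).isCompact_convexHull (𝕜 := ℝ)
  have := isCompact_iff_compactSpace.1 hcomp
  have hcont : Continuous (h.equiv (f := L)) :=
    Continuous.subtype_mk ((LinearMap.continuous_of_finiteDimensional L).comp
      continuous_subtype_val) _
  refine ⟨hcont.homeoOfEquivCompactToT2,
    (fun s => s.image fun v => (Pi.single v 1 : V → ℝ)) '' K.faces, hfin.image _, ?_, ?_⟩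
  · rw [Set.biUnion_image, hK]
  · exact fun p _ => ⟨L.toAffineMap, fun x _ => rfl⟩

variable [DecidableEq V]

/-- The linear map which moves the vertex `x` to the barycentre of `t`. -/
noncomputable def collapseVertex (t : Finset V) (x : V) : (V → ℝ) →ₗ[ℝ] (V → ℝ) :=
  LinearMap.id + (LinearMap.proj x).smulRight
    (fun v => (if v ∈ t then (t.card : ℝ)⁻¹ else 0) - if v = x then 1 else 0)

lemma collapseVertex_apply (t : Finset V) (x : V) (y : V → ℝ) (v : V) :
    collapseVertex t x y v =
      y v + y x * ((if v ∈ t then (t.card : ℝ)⁻¹ else 0) - if v = x then 1 else 0) := by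
  simp [collapseVertex]

lemma exists_eq_zero_of_mem_polyhedron_stackFacet {K : PreAbstractSimplicialComplex V}
    {t : Finset V} {x : V} (hx : x ∉ t) {y : V → ℝ} (hy : y ∈ polyhedron (stackFacet K t x)) :
    ∃ v ∈ t, y v = 0 := by
  obtain ⟨-, s, ⟨-, hts⟩ | ⟨u, hu, -, hsu⟩, h0⟩ := hy
  · obtain ⟨v, hv, hvs⟩ := Finset.not_subset.1 hts
    exact ⟨v, hv, h0 v hvs⟩
  · obtain ⟨v, hv, hvu⟩ := Finset.exists_of_ssubset hu
    refine ⟨v, hv, h0 v fun h => ?_⟩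
    rcases Finset.mem_insert.1 (hsu h) with rfl | h
    · exact hx hv
    · exact hvu h

/-- The cone over the boundary of `t` is flattened onto `t`, and everything else is fixed because
its `x`-coordinate is zero. -/
lemma bijOn_collapseVertex {K : PreAbstractSimplicialComplex V} {t : Finset V} {x : V}
    (ht : IsFacet K t) (hx : x ∉ complexVertices K) :
    Set.BijOn (collapseVertex t x) (polyhedron (stackFacet K t x)) (polyhedron K) := by
  have hxs : ∀ s ∈ K.faces, x ∉ s := fun s hs h =>
    hx ((K.isRelLowerSet_faces hs).2 (Finset.singleton_subset_iff.2 h)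
      (Finset.singleton_nonempty x))
  have htn : t.Nonempty := (K.isRelLowerSet_faces ht.prop).1
  have hxt := hxs t ht.prop
  have htc : (0 : ℝ) < t.card := by exact_mod_cast htn.card_pos
  have hsum : ∀ y : V → ℝ, ∑ v, collapseVertex t x y v = ∑ v, y v := by
    intro y
    simp only [collapseVertex_apply, Finset.sum_add_distrib, ← Finset.mul_sum,
      Finset.sum_sub_distrib, Finset.sum_ite_mem, Finset.univ_inter, Finset.sum_const,
      Finset.sum_ite_eq', Finset.mem_univ, if_true, nsmul_eq_mul]
    rw [mul_inv_cancel₀ htc.ne']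
    simp
  have happ : ∀ (y : V → ℝ) (v : V), v ∈ t →
      collapseVertex t x y v = y v + y x * (t.card : ℝ)⁻¹ := by
    intro y v hv
    rw [collapseVertex_apply, if_pos hv, if_neg (fun e : v = x => hxt (e ▸ hv)), sub_zero]
  have happ' : ∀ (y : V → ℝ) (v : V), v ∉ t → v ≠ x → collapseVertex t x y v = y v := by
    intro y v hv hvx
    rw [collapseVertex_apply, if_neg hv, if_neg hvx, sub_zero, mul_zero, add_zero]
  have happx : ∀ y : V → ℝ, collapseVertex t x y x = 0 := by
    intro y
    rw [collapseVertex_apply, if_neg hxt, if_pos rfl]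
    ring
  have hfix : ∀ y : V → ℝ, y x = 0 → collapseVertex t x y = y := by
    intro y hy
    ext v
    rw [collapseVertex_apply, hy, zero_mul, add_zero]
  refine ⟨?_, ?_, ?_⟩
  · rintro y ⟨hy, s, hs, h0⟩
    refine ⟨⟨fun v => ?_, by rw [hsum, hy.2]⟩, ?_⟩
    · by_cases hv : v ∈ t
      · rw [happ y v hv]
        have := hy.1 v
        have := hy.1 x
        positivity
      · rcases eq_or_ne v x with rfl | hvx
        · rw [happx]
        · rw [happ' y v hv hvx]
          exact hy.1 v
    · rcases hs with ⟨hs, -⟩ | ⟨u, hu, -, hsu⟩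
      · rw [hfix y (h0 x (hxs s hs))]
        exact ⟨s, hs, h0⟩
      · refine ⟨t, ht.prop, fun v hv => ?_⟩
        rcases eq_or_ne v x with rfl | hvx
        · exact happx y
        · rw [happ' y v hv hvx]
          refine h0 v fun h => ?_
          rcases Finset.mem_insert.1 (hsu h) with h | h
          · exact hvx h
          · exact hv (hu.1 h)
  -- Some coordinate of `y` in `t` is zero; comparing images there bounds the `x`-coordinate of `z`
  -- by that of `y`. By symmetry the two agree, and then so do all coordinates.
  · have key : ∀ y ∈ polyhedron (stackFacet K t x), ∀ z ∈ polyhedron (stackFacet K t x),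
        collapseVertex t x y = collapseVertex t x z → z x ≤ y x := by
      intro y hy z hz h
      obtain ⟨v, hv, hv0⟩ := exists_eq_zero_of_mem_polyhedron_stackFacet hxt hy
      have h1 := congrFun h v
      rw [happ y v hv, happ z v hv, hv0, zero_add] at h1
      have h2 := hz.1.1 v
      exact le_of_mul_le_mul_right (by linarith) (inv_pos.2 htc)
    intro y hy z hz h
    have hxe : y x = z x := le_antisymm (key z hz y hy h.symm) (key y hy z hz h)
    ext v
    have h1 := congrFun h v
    rw [collapseVertex_apply, collapseVertex_apply, hxe] at h1
    linarith
  · rintro z ⟨hz, s, hs, h0⟩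
    by_cases hts : t ⊆ s
    · have hst : s = t := le_antisymm (ht.le_of_ge hs hts) hts
      subst hst
      have hzx : z x = 0 := h0 x hxt
      -- The preimage takes the smallest coordinate off every vertex of the facet and gives the
      -- total to `x`; the coordinate at `w` becomes zero, so the point lies in the cone over the
      -- face opposite `w`.
      obtain ⟨w, hw, hmin⟩ := s.exists_min_image z htn
      set y : V → ℝ := fun v => z v - z w * ((if v ∈ s then 1 else 0) -
        if v = x then (s.card : ℝ) else 0) with hy
      have hyx : y x = z w * s.card := by simp [hy, hzx, hxt]
      have hyz : collapseVertex s x y = z := by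
        ext v
        by_cases hv : v ∈ s
        · rw [happ y v hv, hyx]
          have hvx : v ≠ x := fun e => hxt (e ▸ hv)
          simp only [hy, if_pos hv, if_neg hvx]
          field_simp
          ring
        · rcases eq_or_ne v x with rfl | hvx
          · rw [happx, hzx]
          · rw [happ' y v hv hvx]
            simp [hy, hv, hvx]
      refine ⟨y, ⟨⟨fun v => ?_, by rw [← hsum, hyz, hz.2]⟩, insert x (s.erase w),
        Or.inr ⟨s.erase w, Finset.erase_ssubset hw, Finset.insert_nonempty _ _, subset_rfl⟩,
        fun v hv => ?_⟩, hyz⟩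
      · rcases eq_or_ne v x with rfl | hvx
        · rw [hyx]
          exact mul_nonneg (hz.1 w) htc.le
        · by_cases hv : v ∈ s
          · simpa [hy, hv, hvx] using hmin v hv
          · simpa [hy, hv, hvx] using hz.1 v
      · rw [Finset.mem_insert, Finset.mem_erase, not_or, not_and] at hv
        by_cases hvw : v = w
        · subst hvw
          simp [hy, hw, hv.1]
        · have := hv.2 hvw
          simp [hy, hv.1, this, h0 v this]
    · exact ⟨z, ⟨hz, s, Or.inl ⟨hs, hts⟩, h0⟩, hfix z (h0 x (hxs s hs))⟩

lemma IsStackedSphere.exists_bijOn {m : ℕ} {K : PreAbstractSimplicialComplex V}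
    (hK : IsStackedSphere m K) : ∃ (s : Finset V) (L : (V → ℝ) →ₗ[ℝ] (V → ℝ)), s.card = m + 2 ∧
      Set.BijOn L (polyhedron K) (polyhedron (simplexBoundary s)) := by
  induction hK with
  | boundary s hs => exact ⟨s, LinearMap.id, hs, Set.bijOn_id _⟩
  | stack K t x _ ht hx ih =>
    obtain ⟨s, L, hs, hL⟩ := ih
    exact ⟨s, L ∘ₗ collapseVertex t x, hs, hL.comp (bijOn_collapseVertex ht hx)⟩

lemma bijOn_funLeft_simplexBoundary {W : Type} [Fintype W] [DecidableEq W] (e : W ↪ V) :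
    Set.BijOn (LinearMap.funLeft ℝ ℝ e) (polyhedron (simplexBoundary (Finset.univ.map e)))
      (polyhedron (simplexBoundary (Finset.univ : Finset W))) := by
  have hsum : ∀ y : V → ℝ, (∀ v, v ∉ Finset.univ.map e → y v = 0) →
      ∑ w, y (e w) = ∑ v, y v := by
    intro y hy
    rw [← Finset.sum_map Finset.univ e y]
    exact Finset.sum_subset (Finset.subset_univ _) fun v _ hv => hy v hv
  refine ⟨?_, ?_, ?_⟩
  · rintro y ⟨hy, s, ⟨hsn, hs⟩, h0⟩
    refine ⟨⟨fun w => hy.1 _, (hsum y fun v hv => h0 v fun h => hv (hs.1 h)).trans hy.2⟩,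
      Finset.univ.filter fun w => e w ∈ s, ⟨?_, ?_⟩, fun w hw => h0 _ fun h => hw (by simpa using h)⟩
    · obtain ⟨v, hv⟩ := hsn
      obtain ⟨w, -, rfl⟩ := Finset.mem_map.1 (hs.1 hv)
      exact ⟨w, by simpa using hv⟩
    · obtain ⟨v, hv, hvs⟩ := Finset.exists_of_ssubset hs
      obtain ⟨w, -, rfl⟩ := Finset.mem_map.1 hv
      exact Finset.filter_ssubset.2 ⟨w, Finset.mem_univ w, hvs⟩
  · rintro y ⟨-, s, ⟨-, hs⟩, hy⟩ z ⟨-, s', ⟨-, hs'⟩, hz⟩ h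
    ext v
    by_cases hv : v ∈ Finset.univ.map e
    · obtain ⟨w, -, rfl⟩ := Finset.mem_map.1 hv
      exact congrFun h w
    · rw [hy v fun h => hv (hs.1 h), hz v fun h => hv (hs'.1 h)]
  · rintro z ⟨hz, s, ⟨hsn, hs⟩, h0⟩
    have hex : ∀ w, Function.extend e z 0 (e w) = z w := e.injective.extend_apply z 0
    have hout : ∀ v, v ∉ Finset.univ.map e → Function.extend e z 0 v = 0 := by
      intro v hv
      rw [Function.extend_apply' _ _ _ (by simpa using hv), Pi.zero_apply]
    refine ⟨Function.extend e z 0, ⟨⟨fun v => ?_, ?_⟩, s.map e, ⟨by simpa using hsn,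
      Finset.map_ssubset_map.2 hs⟩, fun v hv => ?_⟩, funext hex⟩
    · by_cases hv : v ∈ Finset.univ.map e
      · obtain ⟨w, -, rfl⟩ := Finset.mem_map.1 hv
        rw [hex]
        exact hz.1 w
      · rw [hout v hv]
    · rw [← hsum _ hout]
      simp only [hex, hz.2]
    · by_cases hv' : v ∈ Finset.univ.map e
      · obtain ⟨w, -, rfl⟩ := Finset.mem_map.1 hv'
        rw [hex]
        exact h0 w fun h => hv (Finset.mem_map_of_mem e h)
      · exact hout v hv'

theorem IsStackedSphere.isPLSphere {m : ℕ} {K : PreAbstractSimplicialComplex V}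
    (hK : IsStackedSphere m K) : IsPLSphere m K := by
  obtain ⟨s, L, hs, hL⟩ := hK.exists_bijOn
  obtain ⟨e, rfl⟩ : ∃ e : Fin (m + 2) ↪ V, s = Finset.univ.map e := by
    refine ⟨(s.equivFinOfCardEq hs).symm.toEmbedding.trans (Function.Embedding.subtype _), ?_⟩
    rw [← Finset.map_map, Finset.map_univ_equiv]
    exact s.attach_map_val.symm
  exact isPLHomeomorphic_of_bijOn (LinearMap.funLeft ℝ ℝ e ∘ₗ L)
    ((bijOn_funLeft_simplexBoundary e).comp hL)

end StackedPL

/-! ### The vertex links of Kühnel's complexes -/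

/-- A sequence of facet subdivisions described through the vertex sets `F 0, …, F N` of the
simplices of a stacked ball: `F (c + 1)` arises from `F c` by replacing `y c` with the new vertex
`x (c + 1)`. -/
lemma exists_isStackedSphere_of_sequence {V : Type} [DecidableEq V] {m N : ℕ}
    {F : ℕ → Finset V} {x y : ℕ → V} (hcard : ∀ c ≤ N, (F c).card = m + 2)
    (hy : ∀ c < N, y c ∈ F c)
    (hF : ∀ c < N, F (c + 1) = insert (x (c + 1)) ((F c).erase (y c)))
    (hx : ∀ a < N, ∀ c ≤ a, x (a + 1) ∉ F c) (hy' : ∀ a ≤ N, ∀ c < a, y c ∉ F a)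
    (hxy : ∀ c < N, y c ≠ x c) :
    ∀ a ≤ N, ∃ K : PreAbstractSimplicialComplex V, IsStackedSphere m K ∧
      ∀ s, s ∈ K.faces ↔ s.Nonempty ∧ ∃ c ≤ a, ∃ j ∈ F c,
        (c < a → j ≠ y c) ∧ (0 < c → j ≠ x c) ∧ s ⊆ (F c).erase j := by
  -- The sphere is the boundary of the ball formed by `F 0, …, F a`: the facet of `F c` opposite `j`
  -- survives unless it is shared with the next simplex (`j = y c`) or with the previous one (`j = x
  -- c`).
  intro a
  induction a with
  | zero =>
    intro h0
    refine ⟨_, .boundary (F 0) (hcard 0 h0), fun s => and_congr_right fun _ => ?_⟩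
    constructor
    · intro hs
      obtain ⟨j, hj, hjs⟩ := Finset.exists_of_ssubset hs
      exact ⟨0, le_rfl, j, hj, fun h => absurd h (lt_irrefl _), fun h => absurd h (lt_irrefl _),
        Finset.subset_erase.2 ⟨hs.1, hjs⟩⟩
    · rintro ⟨c, hc, j, hj, -, -, hs⟩
      obtain rfl : c = 0 := by omega
      exact lt_of_le_of_lt hs (Finset.erase_ssubset hj)
  | succ a ih =>
    intro ha
    obtain ⟨K, hK, hfaces⟩ := ih (by omega)
    set t := (F a).erase (y a) with ht
    have htc : t.card = m + 1 := by
      rw [ht, Finset.card_erase_of_mem (hy a ha), hcard a (by omega)]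
      omega
    have hxt : x (a + 1) ∉ t := fun h => hx a ha a le_rfl (Finset.mem_of_mem_erase h)
    have heq : ∀ c ≤ a, ∀ j ∈ F c, t ⊆ (F c).erase j → t = (F c).erase j := fun c hc j hj h =>
      Finset.eq_of_subset_of_card_le h (by
        rw [Finset.card_erase_of_mem hj, hcard c (by omega), htc]; omega)
    have hfacet : IsFacet K t := by
      refine ⟨(hfaces t).2 ⟨Finset.card_pos.1 (by omega), a, le_rfl, y a, hy a ha,
        fun h => absurd h (lt_irrefl _), fun _ => hxy a ha, subset_rfl⟩, fun s hs hts => ?_⟩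
      obtain ⟨-, c, hc, j, hj, -, -, hsub⟩ := (hfaces s).1 hs
      rw [heq c hc j hj (hts.trans hsub)]
      exact hsub
    have hnew : x (a + 1) ∉ complexVertices K := fun h => by
      obtain ⟨-, c, hc, j, -, -, -, hsub⟩ := (hfaces _).1 h
      exact hx a ha c hc (Finset.mem_of_mem_erase (hsub (Finset.mem_singleton_self _)))
    have hsucc : ∀ j ∈ t, insert (x (a + 1)) (t.erase j) = (F (a + 1)).erase j := fun j hj => by
      rw [hF a ha, ← ht, Finset.erase_insert_of_ne fun e : x (a + 1) = j => hxt (e ▸ hj)]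
    have hjsucc : ∀ j ∈ t, j ∈ F (a + 1) := fun j hj => by
      rw [hF a ha]
      exact Finset.mem_insert_of_mem hj
    refine ⟨_, .stack K t (x (a + 1)) hK hfacet hnew, fun s => ?_⟩
    constructor
    · rintro (⟨hs, hts⟩ | ⟨u, hu, hsn, hsu⟩)
      · obtain ⟨hsn, c, hc, j, hj, h1, h2, hsub⟩ := (hfaces s).1 hs
        refine ⟨hsn, ?_⟩
        -- Only the facet `t` disappears; a proper part of it that omits `w` lies in the facet of
        -- the new simplex opposite `w`.
        by_cases hcj : c = a ∧ j = y a
        · obtain ⟨rfl, rfl⟩ := hcj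
          obtain ⟨w, hw, hws⟩ := Finset.not_subset.1 hts
          refine ⟨c + 1, le_rfl, w, hjsucc w hw, fun h => absurd h (lt_irrefl _),
            fun _ e => hxt (e ▸ hw), ?_⟩
          rw [← hsucc w hw]
          exact (Finset.subset_erase.2 ⟨hsub, hws⟩).trans (Finset.subset_insert _ _)
        · refine ⟨c, by omega, j, hj, fun _ e => ?_, h2, hsub⟩
          rcases lt_or_eq_of_le hc with h | rfl
          · exact h1 h e
          · exact hcj ⟨rfl, e⟩
      · refine ⟨hsn, ?_⟩
        obtain ⟨w, hw, hwu⟩ := Finset.exists_of_ssubset hu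
        refine ⟨a + 1, le_rfl, w, hjsucc w hw, fun h => absurd h (lt_irrefl _),
          fun _ e => hxt (e ▸ hw), ?_⟩
        rw [← hsucc w hw]
        exact hsu.trans (Finset.insert_subset_insert _ (Finset.subset_erase.2 ⟨hu.1, hwu⟩))
    · rintro ⟨hsn, c, hc, j, hj, h1, h2, hsub⟩
      rcases Nat.lt_or_ge a c with h | h
      · obtain rfl : c = a + 1 := by omega
        have hjt : j ∈ t := by
          rw [hF a ha] at hj
          exact (Finset.mem_insert.1 hj).resolve_left (h2 (Nat.succ_pos a))
        refine Or.inr ⟨t.erase j, Finset.erase_ssubset hjt, hsn, ?_⟩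
        rwa [hsucc j hjt]
      · refine Or.inl ⟨(hfaces s).2 ⟨hsn, c, h, j, hj, fun _ => h1 (by omega), h2, hsub⟩,
          fun hts => ?_⟩
        -- If an old facet contained `t` it would equal `t`, and so `y c` would lie in `F a` with `y
        -- a` removed; but a vertex once dropped never returns.
        have hyc : y c ∈ t := by
          rw [heq c h j hj (hts.trans hsub)]
          exact Finset.mem_erase.2 ⟨(h1 (by omega)).symm, hy c (by omega)⟩
        rcases lt_or_eq_of_le h with h | rfl
        · exact hy' a (by omega) c h (Finset.mem_of_mem_erase hyc)
        · exact Finset.notMem_erase _ _ hyc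

/-- The arcs through `v` start at `v - c` with `0 ≤ c ≤ d + 1`. Passing from `c` to `c + 1` drops
the last vertex `y c` and adds the new first vertex `x (c + 1)`. The facets of M^d omit an interior
position of an arc, that is, neither `x c` nor `y c`, which matches the boundary of the stacked
ball. -/
theorem isStackedSphere_complexLink_kuehnelComplex {d : ℕ} (hd : 1 ≤ d)
    (v : ZMod (2 * d + 3)) : IsStackedSphere (d - 1) (complexLink (kuehnelComplex d) v) := by
  set F : ℕ → Finset (ZMod (2 * d + 3)) := fun c =>
    (consecutive d (d + 2) (v - c)).erase v with hF
  set y : ℕ → ZMod (2 * d + 3) := fun c => v - c + (d + 1 : ℕ) with hy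
  set x : ℕ → ZMod (2 * d + 3) := fun c => v - c with hx
  have hv : ∀ c ≤ d + 1, ∀ z, z = v ↔ (z - (v - c)).val = c := fun c hc z => by
    rw [zmod_val_sub_eq_iff (by omega), sub_add_cancel]
  have hvv : ∀ c ≤ d + 1, (v - (v - c)).val = c := fun c hc => (hv c hc v).1 rfl
  have hyc : ∀ c z, z = y c ↔ (z - (v - c)).val = d + 1 := fun c z => by
    rw [zmod_val_sub_eq_iff (by omega)]
  have hxc : ∀ c z, z = x c ↔ (z - (v - c)).val = 0 := fun c z => by
    rw [zmod_val_sub_eq_iff (by omega), Nat.cast_zero, add_zero]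
  have hmem : ∀ c ≤ d + 1, ∀ z, z ∈ F c ↔ (z - (v - c)).val ≠ c ∧ (z - (v - c)).val < d + 2 :=
    fun c hc z => by rw [hF, Finset.mem_erase, mem_consecutive, ne_eq, hv c hc]
  have hshift : ∀ c e : ℕ, e < 2 * d + 3 →
      (v - (c : ZMod (2 * d + 3)) - (v - (c + e : ℕ))).val = e := fun c e he => by
    rw [zmod_val_sub_eq_iff he]
    push_cast
    ring
  obtain ⟨K, hK, hfaces⟩ := exists_isStackedSphere_of_sequence (m := d - 1) (N := d + 1)
    (F := F) (x := x) (y := y)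
    (fun c hc => by
      rw [hF, Finset.card_erase_of_mem (mem_consecutive.2 (by rw [hvv c hc]; omega)),
        card_consecutive (by omega)]
      omega)
    (fun c hc => by
      have := (hyc c (y c)).1 rfl
      rw [hmem c (by omega)]
      omega)
    (fun c hc => by
      ext z
      have h1 := zmod_val_sub_cases z (v - (c + 1 : ℕ)) (v - c)
      rw [hshift c 1 (by omega)] at h1
      have h2 := ZMod.val_lt (z - (v - (c : ZMod (2 * d + 3))))
      rw [hmem _ (by omega), Finset.mem_insert, Finset.mem_erase, hmem c (by omega), hxc,
        ne_eq z, hyc]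
      omega)
    -- Seen from the start of an older arc, the new vertex lies `e ≤ d + 1` steps back, at position
    -- `2d + 3 - e ≥ d + 2`, outside that arc. In the next argument a dropped vertex has position `d
    -- + 1 + e < 2d + 3` in a later arc, again outside it.
    (fun a ha c hc => by
      have h1 := zmod_val_sub_cases (x (a + 1)) (v - (a + 1 : ℕ)) (v - c)
      rw [(hxc (a + 1) _).1 rfl] at h1
      obtain ⟨e, he⟩ : ∃ e, a + 1 = c + e := ⟨a + 1 - c, by omega⟩
      rw [he, hshift c e (by omega), ← he] at h1
      rw [hmem c (by omega)]
      omega)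
    (fun a ha c hc => by
      have h1 := zmod_val_sub_cases (y c) (v - a) (v - c)
      obtain ⟨e, rfl⟩ : ∃ e, a = c + e := ⟨a - c, by omega⟩
      rw [(hyc c _).1 rfl, hshift c e (by omega)] at h1
      rw [hmem _ ha]
      omega)
    (fun c hc e => by
      have h1 := (hyc c _).1 rfl
      rw [e, (hxc c _).1 rfl] at h1
      omega) (d + 1) le_rfl
  suffices h : complexLink (kuehnelComplex d) v = K by rwa [h]
  ext s
  rw [hfaces]
  constructor
  · rintro ⟨hs, hvs, h⟩
    obtain ⟨-, i, j, hj1, hjd, h⟩ := mem_kuehnelComplex.1 h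
    refine ⟨hs, ?_⟩
    obtain ⟨hv1, hv2⟩ := h v (Finset.mem_insert_self v s)
    obtain ⟨c, hc, rfl⟩ : ∃ c : ℕ, c ≤ d + 1 ∧ i = v - c :=
      ⟨(v - i).val, by omega, by rw [ZMod.natCast_zmod_val, sub_sub_cancel]⟩
    rw [hvv c hc] at hv1 hv2
    have hj : (v - c + (j : ZMod (2 * d + 3)) - (v - c)).val = j :=
      (zmod_val_sub_eq_iff (by omega)).2 rfl
    refine ⟨c, hc, v - c + j, (hmem c hc _).2 (by omega), fun _ => ?_, fun _ => ?_,
      fun z hz => ?_⟩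
    · rw [ne_eq, hyc]
      omega
    · rw [ne_eq, hxc]
      omega
    · obtain ⟨h1, h2⟩ := h z (Finset.mem_insert_of_mem hz)
      have h3 : z ≠ v := fun e => hvs (e ▸ hz)
      rw [ne_eq, hv c hc] at h3
      refine Finset.mem_erase.2 ⟨fun e => h2 (by rw [e, hj]), (hmem c hc z).2 ⟨h3, h1⟩⟩
  · rintro ⟨hs, c, hc, j, hj, h1, h2, hsub⟩
    -- For `c = 0` the first vertex, and for `c = d + 1` the last, is `v` itself, which is not in `F
    -- c`; so `j` is an interior position even where the conditions `h1` and `h2` are void.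
    rw [hmem c hc] at hj
    rw [ne_eq, hyc] at h1
    rw [ne_eq, hxc] at h2
    refine ⟨hs, fun h => Finset.notMem_erase v _ (Finset.mem_of_mem_erase (hsub h)),
      mem_kuehnelComplex.2 ⟨Finset.insert_nonempty v s, v - c, (j - (v - c)).val, by omega,
      by omega, fun z hz => ?_⟩⟩
    rcases Finset.mem_insert.1 hz with rfl | hz
    · rw [hvv c hc]
      omega
    · obtain ⟨hzj, hz⟩ := Finset.mem_erase.1 (hsub hz)
      refine ⟨((hmem c hc z).1 hz).2, fun e => hzj ?_⟩
      exact sub_left_injective (ZMod.val_injective _ e)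

theorem mainTheorem8 (d : ℕ) (hd : 2 ≤ d) :
    (complexVertices (kuehnelComplex d)).ncard = 2 * d + 3 ∧
      IsNeighborly 2 (kuehnelComplex d) ∧
      InWalkupClass d (kuehnelComplex d) ∧
      IsTightComplex (kuehnelComplex d) := by
  refine ⟨?_, ?_, ⟨fun v _ => ?_, fun v _ => ?_⟩,
    isTightComplex_kuehnelComplex hd⟩
  · have : complexVertices (kuehnelComplex d) = Set.univ :=
      Set.eq_univ_of_forall fun v => (pair_mem_kuehnelComplex hd (S := {v}) (by simp)).resolve_left
        (Finset.singleton_ne_empty v)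
    rw [this, Set.ncard_univ, Nat.card_zmod]
  · exact fun s hs _ h => (pair_mem_kuehnelComplex hd h).resolve_left hs.ne_empty
  · exact (isStackedSphere_complexLink_kuehnelComplex (by omega) v).isPLSphere
  · exact isStackedSphere_complexLink_kuehnelComplex (by omega) v
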